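/- Let $R$ be a ring (with unit, not necessarily commutative) and let $\alpha>0$ be a constant. Computations are on a random access machine whose memory holds natural numbers and elements of $R$: operations on numbers are charged by the logarithmic cost criterion, operations on elements of $R$ (addition, subtraction, multiplication, equality test) have unit cost, and no elements of $R$ other than $0,1$ are available as constants. Vectors in $R^n$ and matrices are represented sparsely, by lists of the index-value pairs of the non-zero entries (for a matrix, one list for each column); measurement vectors in $R^m$ are stored as arrays. Write $\|x\|_0$ for the number of non-zero entries of $x$; $\mathrm{poly}(\log n)$ stands for a quantity that is at most $c\,(\log_2(n+1))^c$ for a constant $c$ independent of $n$ and $t$. There is a deterministic compressed sensing scheme over $R$ with $m=m(n,t)\le t^{1+\alpha}\cdot\mathrm{poly}(\log n)$ measurements, i.e. there are a function $m(n,t)$ with values in the non-negative integers, non-decreasing in $n$ and $t$, and deterministic algorithms $\mathcal M$, $\mathcal R$ such that for all integers $1\le t\le n$: on input $n,t$, $\mathcal M$ outputs a matrix $H\in R^{m\times n}$; and for every $x\in R^n$ with $\|x\|_0\le t$, the algorithm $\mathcal R$, given the vector $Hx$ and the memory contents left by $\mathcal M$, outputs $x$. Moreover, for all $1\le t\le n$: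 1. $\mathcal M$ runs in time $n\cdot\mathrm{poly}(\log n)$ and performs no arithmetic operations over $R$. 2. On every measurement vector $z\in R^m$, $\mathcal R$ halts after at most $t^{1+\alpha}\cdot\mathrm{poly}(\log n)$ operations over $R$, and its total running time is bounded in the same way. 3. $H$ is binary (all entries are $0$ or $1$), and every column of $H$ has at most $\mathrm{poly}(\log n)$ non-zero entries. 4. $H$ can be multiplied by an arbitrary vector $x\in R^n$ (given sparsely, together with the memory contents left by $\mathcal M$) by an algorithm that uses at most $\|x\|_0\cdot\mathrm{poly}(\log n)$ additions over $R$, no other operations over $R$, and total time at most $(\|x\|_0+1)\cdot\mathrm{poly}(\log n)$. -/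

import Mathlib

/-!
Machine model: a random access machine over a ring `R`.  Its memory consists of numbered arrays
(a program mentions only finitely many of them); the cell `i` of the array `a` has a word part
holding a natural number and a ring part holding an element of `R`.  Programs are structured
(assignment, sequence, branching, loop).  Words are charged by the logarithmic cost criterion (an
operation costs the bit length of the numbers it handles), operations on ring elements have unit
cost, and the only constants of `R` that a program may use are `0` and `1`.
-/

namespace RingRAM

/-- Expressions with a natural number as value; `get a e` is the word in cell `e` of array `a`. -/
inductive WExpr : Type
  | const (k : ℕ)
  | get (a : ℕ) (e : WExpr)
  | add (e f : WExpr)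
  | sub (e f : WExpr)
  | mul (e f : WExpr)
  | div (e f : WExpr)
  | mod (e f : WExpr)

/-- Expressions with a ring element as value; `get a e` is the ring element in cell `e` of
array `a`. -/
inductive RExpr : Type
  | zero
  | one
  | get (a : ℕ) (e : WExpr)
  | add (u v : RExpr)
  | sub (u v : RExpr)
  | mul (u v : RExpr)

/-- Tests: comparison of words, and equality of ring elements. -/
inductive Test : Type
  | wlt (e f : WExpr)
  | weq (e f : WExpr)
  | req (u v : RExpr)

/-- Programs; `setW a i e` and `setR a i u` write to cell `i` of array `a`, and `loop b P` is
"while `b` do `P`". -/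
inductive Prog : Type
  | skip
  | setW (a : ℕ) (i e : WExpr)
  | setR (a : ℕ) (i : WExpr) (u : RExpr)
  | seq (P Q : Prog)
  | ite (b : Test) (P Q : Prog)
  | loop (b : Test) (P : Prog)

/-- Memory contents. -/
structure State (R : Type*) where
  word : ℕ → ℕ → ℕ
  ring : ℕ → ℕ → R

/-- Cost of a computation: its total `time` (logarithmic cost of all word operations, plus one for
each ring operation and each access), the number `adds` of additions in the ring, and the number
`others` of other operations on ring elements (subtractions, multiplications, equality tests).
Copying a ring element and writing the constants `0`, `1` takes time, but is not a ring operation. -/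
structure Cost where
  time : ℕ
  adds : ℕ
  others : ℕ

namespace Cost

/-- The number of ring operations, equality tests included. -/
def ringOps (c : Cost) : ℕ := c.adds + c.others

instance : Add Cost := ⟨fun c d => ⟨c.time + d.time, c.adds + d.adds, c.others + d.others⟩⟩

/-- Cost of spending the time `k` without ring operations. -/
def ofTime (k : ℕ) : Cost := ⟨k, 0, 0⟩

end Cost

section Semantics

variable {R : Type*}

/-- Value of a word expression (`sub` is truncated, `div` and `mod` are integer division). -/
def WExpr.val (s : State R) : WExpr → ℕ
  | .const k => k
  | .get a e => s.word a (e.val s)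
  | .add e f => e.val s + f.val s
  | .sub e f => e.val s - f.val s
  | .mul e f => e.val s * f.val s
  | .div e f => e.val s / f.val s
  | .mod e f => e.val s % f.val s

/-- Logarithmic cost: every node is charged `1` plus the bit length of its value, so an operation
is charged for its operands, for the address it uses, and for its result. -/
def WExpr.time (s : State R) : WExpr → ℕ
  | .const k => 1 + k.size
  | .get a e => e.time s + (1 + (s.word a (e.val s)).size)
  | .add e f => e.time s + f.time s + (1 + (e.val s + f.val s).size)
  | .sub e f => e.time s + f.time s + (1 + (e.val s - f.val s).size)
  | .mul e f => e.time s + f.time s + (1 + (e.val s * f.val s).size)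
  | .div e f => e.time s + f.time s + (1 + (e.val s / f.val s).size)
  | .mod e f => e.time s + f.time s + (1 + (e.val s % f.val s).size)

variable [Ring R]

/-- Value of a ring expression. -/
def RExpr.val (s : State R) : RExpr → R
  | .zero => 0
  | .one => 1
  | .get a e => s.ring a (e.val s)
  | .add u v => u.val s + v.val s
  | .sub u v => u.val s - v.val s
  | .mul u v => u.val s * v.val s

/-- Cost of a ring expression. -/
def RExpr.cost (s : State R) : RExpr → Cost
  | .zero => ⟨1, 0, 0⟩
  | .one => ⟨1, 0, 0⟩
  | .get _ e => ⟨1 + e.time s, 0, 0⟩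
  | .add u v => u.cost s + v.cost s + ⟨1, 1, 0⟩
  | .sub u v => u.cost s + v.cost s + ⟨1, 0, 1⟩
  | .mul u v => u.cost s + v.cost s + ⟨1, 0, 1⟩

/-- Outcome of a test. -/
def Test.Holds (s : State R) : Test → Prop
  | .wlt e f => e.val s < f.val s
  | .weq e f => e.val s = f.val s
  | .req u v => u.val s = v.val s

/-- Cost of a test. -/
def Test.cost (s : State R) : Test → Cost
  | .wlt e f => ⟨1 + e.time s + f.time s, 0, 0⟩
  | .weq e f => ⟨1 + e.time s + f.time s, 0, 0⟩
  | .req u v => u.cost s + v.cost s + ⟨1, 0, 1⟩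

/-- Write `w` into the word part of cell `i` of array `a`. -/
def State.writeW (s : State R) (a i w : ℕ) : State R :=
  { s with word := Function.update s.word a (Function.update (s.word a) i w) }

/-- Write `r` into the ring part of cell `i` of array `a`. -/
def State.writeR (s : State R) (a i : ℕ) (r : R) : State R :=
  { s with ring := Function.update s.ring a (Function.update (s.ring a) i r) }

/-- `Exec P s s' c`: started in the memory `s`, the program `P` halts with the memory `s'`, and
this run has cost `c`. -/
inductive Exec : Prog → State R → State R → Cost → Prop
  | skip (s : State R) : Exec .skip s s (Cost.ofTime 1)
  | setW (s : State R) (a : ℕ) (i e : WExpr) :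
      Exec (.setW a i e) s (s.writeW a (i.val s) (e.val s))
        (Cost.ofTime (1 + i.time s + e.time s))
  | setR (s : State R) (a : ℕ) (i : WExpr) (u : RExpr) :
      Exec (.setR a i u) s (s.writeR a (i.val s) (u.val s))
        (Cost.ofTime (1 + i.time s) + u.cost s)
  | seq {P Q : Prog} {s₁ s₂ s₃ : State R} {c d : Cost}
      (hP : Exec P s₁ s₂ c) (hQ : Exec Q s₂ s₃ d) : Exec (.seq P Q) s₁ s₃ (c + d)
  | iteTrue {b : Test} {P Q : Prog} {s s' : State R} {c : Cost}
      (hb : b.Holds s) (hP : Exec P s s' c) : Exec (.ite b P Q) s s' (b.cost s + c)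
  | iteFalse {b : Test} {P Q : Prog} {s s' : State R} {c : Cost}
      (hb : ¬ b.Holds s) (hQ : Exec Q s s' c) : Exec (.ite b P Q) s s' (b.cost s + c)
  | loopTrue {b : Test} {P : Prog} {s₁ s₂ s₃ : State R} {c d : Cost}
      (hb : b.Holds s₁) (hP : Exec P s₁ s₂ c) (hL : Exec (.loop b P) s₂ s₃ d) :
      Exec (.loop b P) s₁ s₃ (b.cost s₁ + c + d)
  | loopFalse {b : Test} {P : Prog} {s : State R}
      (hb : ¬ b.Holds s) : Exec (.loop b P) s s (b.cost s)

/-- Programs are deterministic: a run is determined by the program and the initial memory. -/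
theorem Exec.deterministic {P : Prog} {s s₁ s₂ : State R} {c₁ c₂ : Cost}
    (h₁ : Exec P s s₁ c₁) (h₂ : Exec P s s₂ c₂) : s₁ = s₂ ∧ c₁ = c₂ := by
  induction h₁ generalizing s₂ c₂ with
  | skip | setW | setR => cases h₂; exact ⟨rfl, rfl⟩
  | seq _ _ ihP ihQ =>
    cases h₂ with
    | seq hP hQ =>
      obtain ⟨rfl, rfl⟩ := ihP hP
      obtain ⟨rfl, rfl⟩ := ihQ hQ
      exact ⟨rfl, rfl⟩
  | iteTrue hb _ ih =>
    cases h₂ with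
    | iteTrue _ h => obtain ⟨rfl, rfl⟩ := ih h; exact ⟨rfl, rfl⟩
    | iteFalse hb' _ => exact absurd hb hb'
  | iteFalse hb _ ih =>
    cases h₂ with
    | iteTrue hb' _ => exact absurd hb' hb
    | iteFalse _ h => obtain ⟨rfl, rfl⟩ := ih h; exact ⟨rfl, rfl⟩
  | loopTrue hb _ _ ihP ihL =>
    cases h₂ with
    | loopTrue _ hP hL =>
      obtain ⟨rfl, rfl⟩ := ihP hP
      obtain ⟨rfl, rfl⟩ := ihL hL
      exact ⟨rfl, rfl⟩
    | loopFalse hb' => exact absurd hb hb'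
  | loopFalse hb =>
    cases h₂ with
    | loopTrue hb' _ _ => exact absurd hb' hb
    | loopFalse _ => exact ⟨rfl, rfl⟩

end Semantics

end RingRAM

namespace CompressedSensing

open RingRAM

section

variable {R : Type*} [Ring R]

/-- The number of non-zero entries of a vector. -/
noncomputable def nnz {n : ℕ} (x : Fin n → R) : ℕ := {i : Fin n | x i ≠ 0}.ncard

/-- Array holding the input `(n, t)`. -/
abbrev inputArr : ℕ := 0

/-- Array holding the table of column pointers of a matrix. -/
abbrev pointerArr : ℕ := 1

/-- Array holding the column lists of a matrix. -/
abbrev columnArr : ℕ := 2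

/-- Array holding a measurement vector. -/
abbrev measurementArr : ℕ := 3

/-- Array holding the output of recovery and of multiplication. -/
abbrev outputArr : ℕ := 4

/-- Array holding a vector that is to be multiplied. -/
abbrev vectorArr : ℕ := 5

/-- Sparse representation of `x` at address `p` of array `a`: cell `p` holds the number of non-zero
entries, and the cells after it hold the index-value pairs of these entries, each exactly once. -/
def HoldsSparse (s : State R) (a p : ℕ) {n : ℕ} (x : Fin n → R) : Prop :=
  s.word a p = nnz x ∧
    ∃ e : Fin (nnz x) ≃ {i : Fin n // x i ≠ 0}, ∀ k : Fin (nnz x),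
      s.word a (p + 1 + k) = ((e k).1 : ℕ) ∧ s.ring a (p + 1 + k) = x (e k).1

/-- Sparse representation of a matrix: for each column, a pointer to the list of its non-zero
entries. -/
def HoldsMatrix (s : State R) {m n : ℕ} (H : Matrix (Fin m) (Fin n) R) : Prop :=
  ∀ j : Fin n, HoldsSparse s columnArr (s.word pointerArr j) (fun i => H i j)

/-- The first cells of array `a` hold the entries of `z`. -/
def HoldsDense (s : State R) (a : ℕ) {m : ℕ} (z : Fin m → R) : Prop :=
  ∀ i : Fin m, s.ring a i = z i

/-- `s` agrees with `s₀` outside array `a`. -/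
def AgreesOff (a : ℕ) (s₀ s : State R) : Prop :=
  ∀ b, b ≠ a → s.word b = s₀.word b ∧ s.ring b = s₀.ring b

/-- Initial memory on input `(n, t)`: `n` and `t` are in the first two cells of the input array,
and all other cells are zero. -/
def initial (R : Type*) [Ring R] (n t : ℕ) : State R where
  word a i := if a = inputArr then (if i = 0 then n else if i = 1 then t else 0) else 0
  ring _ _ := 0

/-- On input `(n, t)`, the program `M` halts with cost `c`, leaves the memory `σ`, and thereby
outputs the sparse representation of `H`. -/
def Outputs (M : Prog) (n t : ℕ) {m : ℕ} (H : Matrix (Fin m) (Fin n) R) (σ : State R)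
    (c : Cost) : Prop :=
  Exec M (initial R n t) σ c ∧ HoldsMatrix σ H

/-- `s` is the memory on which a recovery algorithm is started: the auxiliary data `σ` left by the
measurement algorithm together with the measurement vector `z`. -/
def RecoveryInput (σ : State R) {m : ℕ} (z : Fin m → R) (s : State R) : Prop :=
  AgreesOff measurementArr σ s ∧ HoldsDense s measurementArr z

/-- `s` is the data `σ` left by the measurement algorithm together with the sparse representation
of `x`. -/
def MultiplicationInput (σ : State R) {n : ℕ} (x : Fin n → R) (s : State R) : Prop :=
  AgreesOff vectorArr σ s ∧ HoldsSparse s vectorArr 0 x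

/-- `(M, Rec)` is an `m`-compressed sensing scheme over `R`: the function `m` is non-decreasing; on
input `(n, t)` with `1 ≤ t ≤ n`, `M` outputs an `m n t × n` matrix `H`; and from `H x`, for any
`x` with at most `t` non-zero entries, `Rec` computes (the sparse representation of) `x`. -/
def IsScheme (R : Type*) [Ring R] (m : ℕ → ℕ → ℕ) (M Rec : Prog) : Prop :=
  (∀ n t n' t' : ℕ, 1 ≤ t → t ≤ n → t' ≤ n' → n ≤ n' → t ≤ t' → m n t ≤ m n' t') ∧
  ∀ n t : ℕ, 1 ≤ t → t ≤ n →
    ∃ (H : Matrix (Fin (m n t)) (Fin n) R) (σ : State R) (c : Cost), Outputs M n t H σ c ∧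
      ∀ x : Fin n → R, nnz x ≤ t → ∀ s : State R, RecoveryInput σ (H.mulVec x) s →
        ∃ (s' : State R) (c' : Cost), Exec Rec s s' c' ∧ HoldsSparse s' outputArr 0 x

end

/-- `c · (log₂ (n + 1)) ^ c`; a quantity is `poly(log n)` if it is at most this for some constant
`c`. -/
noncomputable def polylog (c n : ℕ) : ℝ := c * Real.logb 2 (n + 1) ^ c

end CompressedSensing

/-! The measurement matrix comes from an unbalanced expander built from multiplicity codes. Let `w =
n.size + 6`. The `w` binary digits of a column index `j` are the coefficients of a polynomial `f`
over the field with `q` elements. Column `j` is joined to the `q` vertices `(y, f(y), f'(y), …)`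
with `m = l + 1` coordinates, so there are `q ^ m` vertices. Every vertex owns a block of `2 * w`
rows, two for each digit position, and column `j` has a `1` in the row that matches its digit. If a
block is met by only one column of the support, with coefficient `v`, then each pair of rows shows
`v` and `0` in an order that spells out `j`: the block votes for `(j, v)`.

Expansion (`exists_unique_jets`, `exists_unique_vertices`): in a nonempty set `S` of columns with
`S.card * q < h ^ m`, some column has more than half of its vertices for itself. By counting
coefficients there is a nonzero `Q` in `m` variables, with all exponents below `h`, that vanishes at
`(X, f, f', …)` for all `f` in `S`. Take `Q` of least total degree and differentiate it in its last
variable. This separant has smaller degree, so it does not vanish identically along some `f` in `S`.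
Wherever it is nonzero at a point `y`, the differential equation `Q = 0` determines its solutions in
`S` from their initial values at `y`, by comparison of orders of vanishing. The separant along `f`
has degree less than `q / 2`, so this covers more than half of the points.

Decoding: blocks wait in a queue. A block that is examined proposes a pair `(j, v)`; if more than
half of the blocks of `j` vote for it, then `v` times column `j` is subtracted, `v` is credited to
coordinate `j`, and the blocks of `j` are queued again. More than half of these blocks become zero,
so the number of nonzero blocks drops with each subtraction (`busyCount_subColumn_lt`). Hence the
queue is exhausted after at most `q ^ m * (q + 1)` examinations for any measurement vector, and for
a `t`-sparse signal at most `t * q` coordinates are touched. At the end no column has a majority.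
The remaining error has at most `t + t * q` nonzero entries, so expansion would give one of them a
majority unless the error is zero (`eq_zero_of_votes`).

Parameters: with an integer `a ≥ 1 / α` and `h = (4 * w * w) ^ a`, a prime `q` is taken between `2 *
h * w * w` and twice that, and `m` is least with `t * q * (q + 1) < h ^ m`. Then `q ≤ h ^ (1 + 1 /
a)`, so minimality of `m` bounds `q ^ m` by `t ^ (1 + α)` times a power of `w` (`Params.card_le`).

Costs are handled by `Runs`: a step costs at most a constant that depends on the program text, times
the word length, and the word length is polynomial in `w`. -/

set_option linter.unusedSectionVars false

/-! ### A program logic with cost bounds for the machine. -/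

namespace RingRAM

instance : Add WExpr := ⟨.add⟩
instance : Sub WExpr := ⟨.sub⟩
instance : Mul WExpr := ⟨.mul⟩
instance : Div WExpr := ⟨.div⟩
instance : Mod WExpr := ⟨.mod⟩
instance (k : ℕ) : OfNat WExpr k := ⟨.const k⟩

/-- The register `a`: the word in cell `0` of array `a`. -/
abbrev WExpr.reg (a : ℕ) : WExpr := .get a (.const 0)

infixr:60 " ;; " => Prog.seq

/-- Assignment to the register `a`. -/
abbrev Prog.setReg (a : ℕ) (e : WExpr) : Prog := .setW a 0 e

/-- Execute `P` for all values of the register `i` below the register `lim`. -/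
def Prog.forTo (i lim : ℕ) (P : Prog) : Prog :=
  .setReg i 0 ;; .loop (.wlt (.reg i) (.reg lim)) (P ;; .setReg i (.reg i + 1))

/-! ### Syntactic size factors -/

/-- The bit length of the value of an expression is at most `e.width * (B + 1)` if the words read
have at most `B` bits. -/
def WExpr.width : WExpr → ℕ
  | .const k => k.size
  | .get _ _ => 1
  | .add e f => e.width + f.width + 1
  | .sub e _ => e.width
  | .mul e f => e.width + f.width
  | .div e _ => e.width
  | .mod e _ => e.width

/-- The evaluation of an expression takes time at most `e.weight * (B + 1)` if the words read have
at most `B` bits. -/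
def WExpr.weight : WExpr → ℕ
  | .const k => 1 + k.size
  | .get _ e => e.weight + 2
  | .add e f => e.weight + f.weight + (e.width + f.width + 2)
  | .sub e f => e.weight + f.weight + (e.width + 1)
  | .mul e f => e.weight + f.weight + (e.width + f.width + 1)
  | .div e f => e.weight + f.weight + (e.width + 1)
  | .mod e f => e.weight + f.weight + (e.width + 1)

/-- As `WExpr.weight`, for ring expressions. -/
def RExpr.weight : RExpr → ℕ
  | .zero => 1
  | .one => 1
  | .get _ e => 1 + e.weight
  | .add u v => u.weight + v.weight + 1
  | .sub u v => u.weight + v.weight + 1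
  | .mul u v => u.weight + v.weight + 1

/-- As `WExpr.weight`, for tests. -/
def Test.weight : Test → ℕ
  | .wlt e f => 1 + e.weight + f.weight
  | .weq e f => 1 + e.weight + f.weight
  | .req u v => u.weight + v.weight + 1

/-- As `WExpr.weight`, for one step of a program. -/
def Prog.weight : Prog → ℕ
  | .skip => 1
  | .setW _ i e => 1 + i.weight + e.weight
  | .setR _ i u => 1 + i.weight + u.weight
  | .seq P Q => P.weight + Q.weight
  | .ite b P Q => b.weight + P.weight + Q.weight
  | .loop b P => b.weight + P.weight

/-- `P` contains an assignment to words of array `a`. -/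
def Prog.writesW (a : ℕ) : Prog → Bool
  | .skip => false
  | .setW b _ _ => b == a
  | .setR _ _ _ => false
  | .seq P Q => P.writesW a || Q.writesW a
  | .ite _ P Q => P.writesW a || Q.writesW a
  | .loop _ P => P.writesW a

/-- `P` contains an assignment to ring elements of array `a`. -/
def Prog.writesR (a : ℕ) : Prog → Bool
  | .skip => false
  | .setW _ _ _ => false
  | .setR b _ _ => b == a
  | .seq P Q => P.writesR a || Q.writesR a
  | .ite _ P Q => P.writesR a || Q.writesR a
  | .loop _ P => P.writesR a

/-- The expression reads no words of the two arrays that hold inputs. -/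
def WExpr.safe : WExpr → Bool
  | .const _ => true
  | .get a e => a != 3 && a != 5 && e.safe
  | .add e f => e.safe && f.safe
  | .sub e f => e.safe && f.safe
  | .mul e f => e.safe && f.safe
  | .div e f => e.safe && f.safe
  | .mod e f => e.safe && f.safe

/-- As `WExpr.safe`, for ring expressions. -/
def RExpr.safe : RExpr → Bool
  | .zero => true
  | .one => true
  | .get _ e => e.safe
  | .add u v => u.safe && v.safe
  | .sub u v => u.safe && v.safe
  | .mul u v => u.safe && v.safe

/-- As `WExpr.safe`, for tests. -/
def Test.safe : Test → Bool
  | .wlt e f => e.safe && f.safe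
  | .weq e f => e.safe && f.safe
  | .req u v => u.safe && v.safe

/-- The expression contains no ring operations. -/
def RExpr.free : RExpr → Bool
  | .zero => true
  | .one => true
  | .get _ _ => true
  | .add _ _ => false
  | .sub _ _ => false
  | .mul _ _ => false

/-- The program contains no ring operations. -/
def Prog.free : Prog → Bool
  | .skip => true
  | .setW _ _ _ => true
  | .setR _ _ u => u.free
  | .seq P Q => P.free && Q.free
  | .ite b P Q => (match b with | .req _ _ => false | _ => true) && P.free && Q.free
  | .loop b P => (match b with | .req _ _ => false | _ => true) && P.free

/-- The expression contains no ring operations but additions. -/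
def RExpr.additive : RExpr → Bool
  | .zero => true
  | .one => true
  | .get _ _ => true
  | .add u v => u.additive && v.additive
  | .sub _ _ => false
  | .mul _ _ => false

/-- The program contains no ring operations but additions. -/
def Prog.additive : Prog → Bool
  | .skip => true
  | .setW _ _ _ => true
  | .setR _ _ u => u.additive
  | .seq P Q => P.additive && Q.additive
  | .ite b P Q => (match b with | .req _ _ => false | _ => true) && P.additive && Q.additive
  | .loop b P => (match b with | .req _ _ => false | _ => true) && P.additive

section

variable {R : Type*}

@[simp] theorem WExpr.val_ofNat (s : State R) (k : ℕ) :
    (no_index (OfNat.ofNat k : WExpr)).val s = OfNat.ofNat k := rfl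
@[simp] theorem WExpr.val_const (s : State R) (k : ℕ) : (WExpr.const k).val s = k := rfl
@[simp] theorem WExpr.val_get (s : State R) (a : ℕ) (e : WExpr) :
    (WExpr.get a e).val s = s.word a (e.val s) := rfl
@[simp] theorem WExpr.val_add (s : State R) (e f : WExpr) : (e + f).val s = e.val s + f.val s := rfl
@[simp] theorem WExpr.val_sub (s : State R) (e f : WExpr) : (e - f).val s = e.val s - f.val s := rfl
@[simp] theorem WExpr.val_mul (s : State R) (e f : WExpr) : (e * f).val s = e.val s * f.val s := rfl
@[simp] theorem WExpr.val_div (s : State R) (e f : WExpr) : (e / f).val s = e.val s / f.val s := rfl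
@[simp] theorem WExpr.val_mod (s : State R) (e f : WExpr) : (e % f).val s = e.val s % f.val s := rfl

@[simp] theorem State.writeW_word (s : State R) (a i w b j : ℕ) :
    (s.writeW a i w).word b j = if b = a ∧ j = i then w else s.word b j := by
  by_cases hb : b = a
  · subst hb; by_cases hj : j = i <;> simp [State.writeW, hj]
  · simp [State.writeW, hb]

theorem State.writeW_array (s : State R) {a i w b : ℕ} (h : b ≠ a) :
    (s.writeW a i w).word b = s.word b := by
  simp [State.writeW, h]

@[simp] theorem State.writeW_ring (s : State R) (a i w : ℕ) : (s.writeW a i w).ring = s.ring := rfl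

@[simp] theorem State.writeR_word (s : State R) (a i : ℕ) (r : R) :
    (s.writeR a i r).word = s.word := rfl

@[simp] theorem State.writeR_ring (s : State R) (a i b j : ℕ) (r : R) :
    (s.writeR a i r).ring b j = if b = a ∧ j = i then r else s.ring b j := by
  by_cases hb : b = a
  · subst hb; by_cases hj : j = i <;> simp [State.writeR, hj]
  · simp [State.writeR, hb]

theorem State.writeR_array (s : State R) {a i b : ℕ} {r : R} (h : b ≠ a) :
    (s.writeR a i r).ring b = s.ring b := by
  simp [State.writeR, h]

/-! ### Bounded memory -/

/-- The words of the memory have at most `B` bits, the two input arrays excepted. -/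
def Bounded (B : ℕ) (s : State R) : Prop :=
  ∀ a i, a ≠ 3 → a ≠ 5 → s.word a i < 2 ^ B

/-- The words read by the evaluation of `e` have at most `B` bits. -/
def WExpr.Reads (B : ℕ) (s : State R) : WExpr → Prop
  | .const _ => True
  | .get a e => e.Reads B s ∧ s.word a (e.val s) < 2 ^ B
  | .add e f => e.Reads B s ∧ f.Reads B s
  | .sub e f => e.Reads B s ∧ f.Reads B s
  | .mul e f => e.Reads B s ∧ f.Reads B s
  | .div e f => e.Reads B s ∧ f.Reads B s
  | .mod e f => e.Reads B s ∧ f.Reads B s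

theorem WExpr.reads_of_safe {B : ℕ} {s : State R} (hs : Bounded B s) (e : WExpr)
    (he : e.safe = true) : e.Reads B s := by
  induction e with
  | const k => trivial
  | get a e ih =>
    simp only [WExpr.safe, Bool.and_eq_true, bne_iff_ne] at he
    exact ⟨ih he.2, hs _ _ he.1.1 he.1.2⟩
  | add e f ihe ihf | sub e f ihe ihf | mul e f ihe ihf | div e f ihe ihf | mod e f ihe ihf =>
    simp only [WExpr.safe, Bool.and_eq_true] at he
    exact ⟨ihe he.1, ihf he.2⟩

theorem WExpr.val_lt {B : ℕ} {s : State R} (e : WExpr) (he : e.Reads B s) :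
    e.val s < 2 ^ (e.width * (B + 1)) := by
  induction e with
  | const k =>
    exact k.lt_size_self.trans_le (Nat.pow_le_pow_right (by norm_num) (by simp [WExpr.width]; nlinarith))
  | get a e ih =>
    exact he.2.trans_le (Nat.pow_le_pow_right (by norm_num) (by simp [WExpr.width]))
  | add e f ihe ihf =>
    have h1 := ihe he.1
    have h2 := ihf he.2
    have h3 : 2 ^ (e.width * (B + 1)) ≤ 2 ^ ((e.width + f.width) * (B + 1)) :=
      Nat.pow_le_pow_right (by norm_num) (by nlinarith)
    have h4 : 2 ^ (f.width * (B + 1)) ≤ 2 ^ ((e.width + f.width) * (B + 1)) :=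
      Nat.pow_le_pow_right (by norm_num) (by nlinarith)
    have h5 : 2 ^ ((e.width + f.width) * (B + 1) + 1) ≤ 2 ^ ((e.width + f.width + 1) * (B + 1)) :=
      Nat.pow_le_pow_right (by norm_num) (by nlinarith)
    rw [pow_succ] at h5
    simp only [WExpr.val, WExpr.width]
    omega
  | mul e f ihe ihf =>
    have h1 := ihe he.1
    have h2 := ihf he.2
    simp only [WExpr.val, WExpr.width, add_mul, pow_add] at *
    exact Nat.mul_lt_mul'' h1 h2
  | sub e f ihe ihf => exact (Nat.sub_le _ _).trans_lt (ihe he.1)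
  | div e f ihe ihf => exact (Nat.div_le_self _ _).trans_lt (ihe he.1)
  | mod e f ihe ihf => exact (Nat.mod_le _ _).trans_lt (ihe he.1)

theorem WExpr.size_val_le {B : ℕ} {s : State R} (e : WExpr) (he : e.Reads B s) :
    (e.val s).size ≤ e.width * (B + 1) :=
  Nat.size_le.2 (e.val_lt he)

theorem WExpr.time_le {B : ℕ} {s : State R} (e : WExpr) (he : e.Reads B s) :
    e.time s ≤ e.weight * (B + 1) := by
  have hv := e.size_val_le he
  induction e with
  | const k => simp only [WExpr.time, WExpr.weight]; nlinarith
  | get a e ih =>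
    have := ih he.1 (e.size_val_le he.1)
    simp only [WExpr.time, WExpr.weight, WExpr.val, WExpr.width] at *
    nlinarith
  | add e f ihe ihf | sub e f ihe ihf | mul e f ihe ihf | div e f ihe ihf | mod e f ihe ihf =>
    have h1 := ihe he.1 (e.size_val_le he.1)
    have h2 := ihf he.2 (f.size_val_le he.2)
    simp only [WExpr.time, WExpr.weight, WExpr.val, WExpr.width] at *
    nlinarith

end

section

variable {R : Type*} [Ring R]

@[simp] theorem Cost.time_add (c d : Cost) : (c + d).time = c.time + d.time := rfl
@[simp] theorem Cost.adds_add (c d : Cost) : (c + d).adds = c.adds + d.adds := rfl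
@[simp] theorem Cost.others_add (c d : Cost) : (c + d).others = c.others + d.others := rfl
@[simp] theorem Cost.time_ofTime (k : ℕ) : (Cost.ofTime k).time = k := rfl
@[simp] theorem Cost.adds_ofTime (k : ℕ) : (Cost.ofTime k).adds = 0 := rfl
@[simp] theorem Cost.others_ofTime (k : ℕ) : (Cost.ofTime k).others = 0 := rfl

theorem RExpr.time_le {B : ℕ} {s : State R} (hs : Bounded B s) (u : RExpr) (hu : u.safe = true) :
    (u.cost s).time ≤ u.weight * (B + 1) := by
  induction u with
  | zero | one => simp [RExpr.cost, RExpr.weight]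
  | get a e =>
    have := e.time_le (e.reads_of_safe hs hu)
    simp only [RExpr.cost, RExpr.weight]
    nlinarith
  | add u v ihu ihv | sub u v ihu ihv | mul u v ihu ihv =>
    simp only [RExpr.safe, Bool.and_eq_true] at hu
    have h1 := ihu hu.1
    have h2 := ihv hu.2
    simp only [RExpr.cost, RExpr.weight, Cost.time_add]
    nlinarith

theorem Test.time_le {B : ℕ} {s : State R} (hs : Bounded B s) (b : Test) (hb : b.safe = true) :
    (b.cost s).time ≤ b.weight * (B + 1) := by
  cases b with
  | wlt e f | weq e f =>
    simp only [Test.safe, Bool.and_eq_true] at hb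
    have h1 := e.time_le (e.reads_of_safe hs hb.1)
    have h2 := f.time_le (f.reads_of_safe hs hb.2)
    simp only [Test.cost, Test.weight]
    nlinarith
  | req u v =>
    simp only [Test.safe, Bool.and_eq_true] at hb
    have h1 := u.time_le hs hb.1
    have h2 := v.time_le hs hb.2
    simp only [Test.cost, Test.weight, Cost.time_add]
    nlinarith

theorem RExpr.ringOps_le (s : State R) (u : RExpr) : (u.cost s).ringOps ≤ (u.cost s).time := by
  induction u with
  | zero | one | get => simp [RExpr.cost, Cost.ringOps]
  | add u v ihu ihv | sub u v ihu ihv | mul u v ihu ihv =>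
    simp only [RExpr.cost, Cost.ringOps, Cost.time_add, Cost.adds_add, Cost.others_add] at *
    omega

theorem Test.ringOps_le (s : State R) (b : Test) : (b.cost s).ringOps ≤ (b.cost s).time := by
  cases b with
  | wlt | weq => simp [Test.cost, Cost.ringOps]
  | req u v =>
    have h1 := u.ringOps_le s
    have h2 := v.ringOps_le s
    simp only [Test.cost, Cost.ringOps, Cost.time_add, Cost.adds_add, Cost.others_add] at *
    omega

/-- Each ring operation is also charged one unit of time, so time bounds serve as bounds for the
operations as well. -/
theorem Exec.ringOps_le {P : Prog} {s s' : State R} {c : Cost} (h : Exec P s s' c) :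
    c.ringOps ≤ c.time := by
  induction h with
  | skip | setW => simp [Cost.ringOps]
  | setR s a i u =>
    have := u.ringOps_le s
    simp only [Cost.ringOps, Cost.time_add, Cost.adds_add, Cost.others_add, Cost.time_ofTime,
      Cost.adds_ofTime, Cost.others_ofTime] at *
    omega
  | seq _ _ ih1 ih2 =>
    simp only [Cost.ringOps, Cost.time_add, Cost.adds_add, Cost.others_add] at *
    omega
  | @iteTrue b _ _ s _ _ _ _ ih | @iteFalse b _ _ s _ _ _ _ ih =>
    have := b.ringOps_le s
    simp only [Cost.ringOps, Cost.time_add, Cost.adds_add, Cost.others_add] at *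
    omega
  | @loopTrue b _ s _ _ _ _ _ _ _ ih1 ih2 =>
    have := b.ringOps_le s
    simp only [Cost.ringOps, Cost.time_add, Cost.adds_add, Cost.others_add] at *
    omega
  | @loopFalse b _ s => exact b.ringOps_le s

/-- The absence of ring operations is visible in the program text, so for concrete programs the
hypothesis is checked by computation. -/
theorem Exec.ringOps_eq_zero {P : Prog} {s s' : State R} {c : Cost} (h : Exec P s s' c)
    (hP : P.free = true) : c.ringOps = 0 := by
  have hu : ∀ (u : RExpr) (s : State R), u.free = true → (u.cost s).ringOps = 0 := by
    intro u s hu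
    cases u <;> simp_all [RExpr.free, RExpr.cost, Cost.ringOps]
  have hb : ∀ (b : Test) (s : State R), (match b with | .req _ _ => false | _ => true) = true →
      (b.cost s).ringOps = 0 := by
    intro b s hb
    cases b <;> simp_all [Test.cost, Cost.ringOps]
  simp only [Cost.ringOps] at *
  induction h with
  | skip | setW => simp
  | setR s a i u => simpa using hu u s hP
  | seq _ _ ih1 ih2 =>
    simp only [Prog.free, Bool.and_eq_true] at hP
    have := ih1 hP.1
    have := ih2 hP.2
    simp only [Cost.adds_add, Cost.others_add]; omega
  | @iteTrue b _ _ s _ _ _ _ ih =>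
    simp only [Prog.free, Bool.and_eq_true] at hP
    have := hb b s hP.1.1
    have := ih hP.1.2
    simp only [Cost.adds_add, Cost.others_add]; omega
  | @iteFalse b _ _ s _ _ _ _ ih =>
    simp only [Prog.free, Bool.and_eq_true] at hP
    have := hb b s hP.1.1
    have := ih hP.2
    simp only [Cost.adds_add, Cost.others_add]; omega
  | @loopTrue b _ s _ _ _ _ _ _ _ ih1 ih2 =>
    have h2 := ih2 hP
    simp only [Prog.free, Bool.and_eq_true] at hP
    have := hb b s hP.1
    have := ih1 hP.2
    simp only [Cost.adds_add, Cost.others_add]; omega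
  | @loopFalse b _ s =>
    simp only [Prog.free, Bool.and_eq_true] at hP
    exact hb b s hP.1

theorem Exec.others_eq_zero {P : Prog} {s s' : State R} {c : Cost} (h : Exec P s s' c)
    (hP : P.additive = true) : c.others = 0 := by
  have hu : ∀ (u : RExpr) (s : State R), u.additive = true → (u.cost s).others = 0 := by
    intro u s hu
    induction u <;> simp_all [RExpr.additive, RExpr.cost]
  have hb : ∀ (b : Test) (s : State R), (match b with | .req _ _ => false | _ => true) = true →
      (b.cost s).others = 0 := by
    intro b s hb
    cases b <;> simp_all [Test.cost]
  induction h with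
  | skip | setW => simp
  | setR s a i u => simpa using hu u s hP
  | seq _ _ ih1 ih2 =>
    simp only [Prog.additive, Bool.and_eq_true] at hP
    simp [ih1 hP.1, ih2 hP.2]
  | @iteTrue b _ _ s _ _ _ _ ih =>
    simp only [Prog.additive, Bool.and_eq_true] at hP
    simp [hb b s hP.1.1, ih hP.1.2]
  | @iteFalse b _ _ s _ _ _ _ ih =>
    simp only [Prog.additive, Bool.and_eq_true] at hP
    simp [hb b s hP.1.1, ih hP.2]
  | @loopTrue b _ s _ _ _ _ _ _ _ ih1 ih2 =>
    have h2 := ih2 hP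
    simp only [Prog.additive, Bool.and_eq_true] at hP
    simp [hb b s hP.1, ih1 hP.2, h2]
  | @loopFalse b _ s =>
    simp only [Prog.additive, Bool.and_eq_true] at hP
    exact hb b s hP.1

/-! ### Frames -/

/-- `s'` agrees with `s` on the arrays that are not written by `P`. -/
structure Frame (P : Prog) (s s' : State R) : Prop where
  word : ∀ a, P.writesW a = false → s'.word a = s.word a
  ring : ∀ a, P.writesR a = false → s'.ring a = s.ring a

theorem Frame.refl (P : Prog) (s : State R) : Frame P s s := ⟨fun _ _ => rfl, fun _ _ => rfl⟩

theorem Frame.trans {P : Prog} {s₁ s₂ s₃ : State R} (h : Frame P s₁ s₂) (h' : Frame P s₂ s₃) :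
    Frame P s₁ s₃ :=
  ⟨fun a ha => (h'.word a ha).trans (h.word a ha), fun a ha => (h'.ring a ha).trans (h.ring a ha)⟩

/-- Which arrays survive a run is read off the syntax. For concrete programs the side conditions
hold by `rfl`, and later invariants need to mention only what changes. -/
theorem Exec.frame {P : Prog} {s s' : State R} {c : Cost} (h : Exec P s s' c) : Frame P s s' := by
  induction h with
  | skip => exact Frame.refl _ _
  | setW s a i e =>
    exact ⟨fun b hb => State.writeW_array _ (by rintro rfl; simp [Prog.writesW] at hb),
      fun _ _ => rfl⟩
  | setR s a i u =>
    exact ⟨fun _ _ => rfl,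
      fun b hb => State.writeR_array _ (by rintro rfl; simp [Prog.writesR] at hb)⟩
  | seq _ _ ih1 ih2 =>
    constructor <;> intro a ha <;> simp only [Prog.writesW, Prog.writesR, Bool.or_eq_false_iff] at ha
    · exact (ih2.word a ha.2).trans (ih1.word a ha.1)
    · exact (ih2.ring a ha.2).trans (ih1.ring a ha.1)
  | iteTrue _ _ ih =>
    constructor <;> intro a ha <;> simp only [Prog.writesW, Prog.writesR, Bool.or_eq_false_iff] at ha
    · exact ih.word a ha.1
    · exact ih.ring a ha.1
  | iteFalse _ _ ih =>
    constructor <;> intro a ha <;> simp only [Prog.writesW, Prog.writesR, Bool.or_eq_false_iff] at ha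
    · exact ih.word a ha.2
    · exact ih.ring a ha.2
  | loopTrue _ _ _ ih1 ih2 =>
    exact ⟨fun a ha => (ih2.word a ha).trans (ih1.word a ha),
      fun a ha => (ih2.ring a ha).trans (ih1.ring a ha)⟩
  | loopFalse => exact Frame.refl _ _

/-! ### Runs with a bounded number of steps -/

/-- If the words of `s` have at most `B` bits, then `P` started in `s` halts after at most `N`
steps, keeps the bound on the words, and leaves a memory with the property `Q`. -/
def Runs (B N : ℕ) (P : Prog) (s : State R) (Q : State R → Prop) : Prop :=
  Bounded B s → ∃ (s' : State R) (c : Cost), Exec P s s' c ∧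
    c.time ≤ N * (P.weight * (B + 1)) ∧ Bounded B s' ∧ Q s'

variable {B N N' : ℕ} {P P' : Prog} {s : State R} {Q Q' : State R → Prop}

theorem Runs.mono (h : Runs B N P s Q) (hN : N ≤ N') (hQ : ∀ s', Q s' → Q' s') :
    Runs B N' P s Q' := by
  intro hs
  obtain ⟨s', c, h1, h2, h3, h4⟩ := h hs
  exact ⟨s', c, h1, h2.trans (Nat.mul_le_mul_right _ hN), h3, hQ _ h4⟩

theorem Runs.le (h : Runs B N P s Q) (hN : N ≤ N') : Runs B N' P s Q := h.mono hN fun _ => id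

theorem Runs.frame (h : Runs B N P s Q) : Runs B N P s (fun s' => Q s' ∧ Frame P s s') := by
  intro hs
  obtain ⟨s', c, h1, h2, h3, h4⟩ := h hs
  exact ⟨s', c, h1, h2, h3, h4, h1.frame⟩

theorem Runs.skip (hQ : Q s) : Runs B (N + 1) .skip s Q :=
  fun hs => ⟨s, _, .skip s, by simp [Prog.weight]; nlinarith, hs, hQ⟩

theorem Bounded.writeW (hs : Bounded B s) (a i : ℕ) {w : ℕ} (hw : w < 2 ^ B) :
    Bounded B (s.writeW a i w) := by
  intro b j hb hb'
  rw [State.writeW_word]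
  split_ifs
  · exact hw
  · exact hs b j hb hb'

/-- The variant with `Reads` in place of `safe` is needed for reading the index list of an input
vector: the words of that array are bounded only in the cells that belong to the list. -/
theorem Runs.setW' {a : ℕ} {i e : WExpr} (hi : Bounded B s → i.Reads B s)
    (he : Bounded B s → e.Reads B s)
    (hv : e.val s < 2 ^ B) (hQ : Q (s.writeW a (i.val s) (e.val s))) :
    Runs B (N + 1) (.setW a i e) s Q := by
  suffices h : Runs B 1 (.setW a i e) s Q from h.le (by omega)
  intro hs
  refine ⟨_, _, .setW s a i e, ?_, hs.writeW _ _ hv, hQ⟩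
  have h1 := i.time_le (hi hs)
  have h2 := e.time_le (he hs)
  simp only [Cost.time_ofTime, Prog.weight]
  nlinarith

theorem Runs.setW {a : ℕ} {i e : WExpr} (hv : e.val s < 2 ^ B)
    (hQ : Q (s.writeW a (i.val s) (e.val s))) (hi : i.safe = true := by rfl)
    (he : e.safe = true := by rfl) :
    Runs B (N + 1) (.setW a i e) s Q :=
  .setW' (fun hs => i.reads_of_safe hs hi) (fun hs => e.reads_of_safe hs he) hv hQ

theorem Runs.setR {a : ℕ} {i : WExpr} {u : RExpr}
    (hQ : Q (s.writeR a (i.val s) (u.val s))) (hi : i.safe = true := by rfl)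
    (hu : u.safe = true := by rfl) :
    Runs B (N + 1) (.setR a i u) s Q := by
  suffices h : Runs B 1 (.setR a i u) s Q from h.le (by omega)
  intro hs
  refine ⟨_, _, .setR s a i u, ?_, hs, hQ⟩
  have h1 := i.time_le (i.reads_of_safe hs hi)
  have h2 := u.time_le hs hu
  simp only [Cost.time_ofTime, Cost.time_add, Prog.weight]
  nlinarith

theorem Runs.seq (h : Runs B N P s fun s' => Runs B N' P' s' Q) : Runs B (N + N') (P ;; P') s Q := by
  intro hs
  obtain ⟨s₁, c, h1, h2, h3, h4⟩ := h hs
  obtain ⟨s₂, d, k1, k2, k3, k4⟩ := h4 h3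
  refine ⟨s₂, _, h1.seq k1, ?_, k3, k4⟩
  simp only [Cost.time_add, Prog.weight]
  calc c.time + d.time ≤ N * (P.weight * (B + 1)) + N' * (P'.weight * (B + 1)) := by omega
    _ ≤ _ := by
      have : 0 ≤ N * (P'.weight * (B + 1)) + N' * (P.weight * (B + 1)) := Nat.zero_le _
      nlinarith

theorem Runs.setW_seq {a : ℕ} {i e : WExpr} (hv : e.val s < 2 ^ B)
    (hQ : Runs B N P (s.writeW a (i.val s) (e.val s)) Q) (hi : i.safe = true := by rfl)
    (he : e.safe = true := by rfl) :
    Runs B (N + 1) (.setW a i e ;; P) s Q :=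
  add_comm N 1 ▸ .seq (.setW (N := 0) hv hQ hi he)

theorem Runs.setR_seq {a : ℕ} {i : WExpr} {u : RExpr}
    (hQ : Runs B N P (s.writeR a (i.val s) (u.val s)) Q) (hi : i.safe = true := by rfl)
    (hu : u.safe = true := by rfl) :
    Runs B (N + 1) (.setR a i u ;; P) s Q :=
  add_comm N 1 ▸ .seq (.setR (N := 0) hQ hi hu)

theorem Runs.ite {b : Test} (h1 : b.Holds s → Runs B N P s Q) (h2 : ¬ b.Holds s → Runs B N P' s Q)
    (hb : b.safe = true := by rfl) : Runs B (N + 1) (.ite b P P') s Q := by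
  intro hs
  have ht := b.time_le hs hb
  by_cases h : b.Holds s
  · obtain ⟨s', c, k1, k2, k3, k4⟩ := h1 h hs
    refine ⟨s', _, .iteTrue h k1, ?_, k3, k4⟩
    simp only [Cost.time_add, Prog.weight]
    have : 0 ≤ N * ((b.weight + P'.weight) * (B + 1)) + (P.weight + P'.weight) * (B + 1) :=
      Nat.zero_le _
    nlinarith
  · obtain ⟨s', c, k1, k2, k3, k4⟩ := h2 h hs
    refine ⟨s', _, .iteFalse h k1, ?_, k3, k4⟩
    simp only [Cost.time_add, Prog.weight]
    have : 0 ≤ N * ((b.weight + P.weight) * (B + 1)) + (P.weight + P'.weight) * (B + 1) :=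
      Nat.zero_le _
    nlinarith

theorem Runs.loopTrue {b : Test} (hb : b.Holds s)
    (h : Runs B N P s fun s' => Runs B N' (.loop b P) s' Q)
    (hb' : b.safe = true := by rfl) : Runs B (1 + N + N') (.loop b P) s Q := by
  intro hs
  have ht := b.time_le hs hb'
  obtain ⟨s₁, c, h1, h2, h3, h4⟩ := h hs
  obtain ⟨s₂, d, k1, k2, k3, k4⟩ := h4 h3
  refine ⟨s₂, _, .loopTrue hb h1 k1, ?_, k3, k4⟩
  simp only [Cost.time_add, Prog.weight] at *
  have : 0 ≤ N * (b.weight * (B + 1)) + P.weight * (B + 1) := Nat.zero_le _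
  nlinarith

theorem Runs.loopFalse {b : Test} (hb : ¬ b.Holds s) (h : Q s)
    (hb' : b.safe = true := by rfl) : Runs B 1 (.loop b P) s Q := by
  intro hs
  have ht := b.time_le hs hb'
  refine ⟨s, _, .loopFalse hb, ?_, hs, h⟩
  simp only [Prog.weight] at *
  nlinarith

/-- Loop rule by induction on the number of remaining rounds. `I k` is the invariant after `k`
rounds, stated for the memory in which the counter already has its new value. Each round costs the
body plus `2`, for the test and the increment. -/
theorem Runs.forTo {i lim n Nb : ℕ} (I : ℕ → State R → Prop)
    (hlim : s.word lim 0 = n) (hn : n < 2 ^ B)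
    (h0 : I 0 (s.writeW i 0 0))
    (hstep : ∀ k s', k < n → I k s' → s'.word i 0 = k → Frame (.forTo i lim P) s s' →
      Runs B Nb P s' (fun s'' => I (k + 1) (s''.writeW i 0 (k + 1))))
    (hpost : ∀ s', I n s' → s'.word i 0 = n → Frame (.forTo i lim P) s s' → Q s')
    (hPi : P.writesW i = false := by rfl) (hPl : P.writesW lim = false := by rfl)
    (hil : i ≠ lim := by decide)
    (hi : i ≠ 3 ∧ i ≠ 5 := by decide) (hl : lim ≠ 3 ∧ lim ≠ 5 := by decide) :
    Runs B (n * (Nb + 2) + 2) (.forTo i lim P) s Q := by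
  have hframe : ∀ {s₁ s₂ : State R}, Frame P s₁ s₂ → Frame (.forTo i lim P) s₁ s₂ := by
    intro s₁ s₂ h
    constructor <;> intro a ha <;>
      simp only [Prog.forTo, Prog.writesW, Prog.writesR, Bool.or_eq_false_iff] at ha
    · exact h.word a ha.2.1
    · exact h.ring a ha.2.1
  have hwi : ∀ (s₁ : State R) (w : ℕ), Frame (.forTo i lim P) s₁ (s₁.writeW i 0 w) := by
    intro s₁ w
    constructor <;> intro a ha
    · simp only [Prog.forTo, Prog.writesW, Bool.or_eq_false_iff, beq_eq_false_iff_ne] at ha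
      exact State.writeW_array _ ha.1.symm
    · rfl
  have hlimf : ∀ {s₁ : State R}, Frame (.forTo i lim P) s s₁ → s₁.word lim 0 = n := by
    intro s₁ h
    rw [h.word lim (by simp [Prog.forTo, Prog.writesW, hPl, hil]), hlim]
  have key : ∀ d k s', k + d = n → I k s' → s'.word i 0 = k → Frame (.forTo i lim P) s s' →
      Runs B (d * (Nb + 2) + 1) (.loop (.wlt (.reg i) (.reg lim)) (P ;; .setReg i (.reg i + 1))) s'
        Q := by
    intro d
    induction d with
    | zero =>
      intro k s' hk hI hi' hf
      obtain rfl : k = n := by omega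
      refine (Runs.loopFalse ?_ (hpost s' hI hi' hf) ?_).le (by omega)
      · simp [Test.Holds, hi', hlimf hf]
      · simp [Test.safe, WExpr.safe, hi, hl]
    | succ d ih =>
      intro k s' hk hI hi' hf
      refine (Runs.loopTrue (N := Nb + 1) (N' := d * (Nb + 2) + 1) ?_ ?_ ?_).le (by linarith)
      · simp only [Test.Holds, WExpr.val_get, WExpr.val_const, hi', hlimf hf]; omega
      · refine Runs.seq (N' := 0 + 1) ((hstep k s' (by omega) hI hi' hf).frame.mono le_rfl ?_)
        rintro s'' ⟨hI', hf'⟩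
        have hk' : s''.word i 0 = k := by rw [hf'.word i hPi, hi']
        refine Runs.setW ?_ ?_ rfl ?_
        · simp only [WExpr.val_add, WExpr.val_get, WExpr.val_const, WExpr.val_ofNat, hk']; omega
        · simp only [WExpr.val_add, WExpr.val_get, WExpr.val_const, WExpr.val_ofNat, hk']
          exact ih (k + 1) _ (by omega) hI' (by simp)
            (hf.trans ((hframe hf').trans (hwi _ _)))
        · change ((_ && _ && _) && _) = true
          simp [hi, WExpr.safe]
      · simp [Test.safe, WExpr.safe, hi, hl]
  refine (Runs.setW_seq (N := n * (Nb + 2) + 1) ?_ ?_ rfl rfl).le (by omega)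
  · simp
  · exact key n 0 _ (by omega) h0 (by simp) (hwi _ _)

end

end RingRAM

/-! ### Multiplicity codes: polynomials determined by their derivatives at a point. -/

namespace CompressedSensing

open Polynomial

section Multiplicity

/-- First-order expansion of a multivariate polynomial in one variable, modulo an ideal. -/
theorem MvPolynomial.aeval_sub_aeval_mem {σ F A : Type*} [DecidableEq σ] [CommRing F] [CommRing A]
    [Algebra F A] (J : Ideal A) (g g' : σ → A) (i : σ) (h : ∀ k, k ≠ i → g k - g' k ∈ J)
    (hi : (g i - g' i) ^ 2 ∈ J) (Q : MvPolynomial σ F) :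
    MvPolynomial.aeval g Q - MvPolynomial.aeval g' Q -
      MvPolynomial.aeval g' (MvPolynomial.pderiv i Q) * (g i - g' i) ∈ J := by
  induction Q using MvPolynomial.induction_on with
  | C a => simp
  | add P Q hP hQ =>
    convert J.add_mem hP hQ using 1
    simp only [map_add]; ring
  | mul_X P k hP =>
    simp only [map_mul, MvPolynomial.aeval_X, Derivation.leibniz, smul_eq_mul, map_add]
    -- The expansion is multiplied by one more variable. The variable `i` itself leaves a term with
    -- the square of `g i - g' i`; any other variable leaves a multiple of `g k - g' k`. Both lie in
    -- `J`.
    by_cases hk : k = i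
    · subst hk
      simp only [MvPolynomial.pderiv_X_self, map_one]
      convert J.add_mem (J.mul_mem_right (g k) hP)
        (J.mul_mem_left (MvPolynomial.aeval g' (MvPolynomial.pderiv k P)) hi) using 1
      ring
    · rw [MvPolynomial.pderiv_X_of_ne hk]
      simp only [map_zero]
      convert J.add_mem (J.mul_mem_right (g k) hP) (J.mul_mem_left
        (MvPolynomial.aeval g' P + MvPolynomial.aeval g' (MvPolynomial.pderiv i P) * (g i - g' i))
        (h k hk)) using 1
      ring

variable {F : Type*} [Field F]

/-- The tuple `(X, f, f', f'', …)`. -/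
noncomputable def jet {m : ℕ} (f : F[X]) (i : Fin m) : F[X] :=
  if (i : ℕ) = 0 then X else derivative^[i - 1] f

theorem natDegree_jet_le {m w : ℕ} {f : F[X]} (hw : 1 ≤ w) (hf : f.natDegree ≤ w) (i : Fin m) :
    (jet f i).natDegree ≤ w := by
  unfold jet
  split_ifs
  · simpa using hw
  · exact (natDegree_iterate_derivative _ _).trans ((Nat.sub_le _ _).trans hf)

theorem natDegree_aeval_jet_le {m w T : ℕ} {f : F[X]} (hw : 1 ≤ w) (hf : f.natDegree ≤ w)
    (Q : MvPolynomial (Fin m) F) (hQ : Q.totalDegree ≤ T) :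
    (MvPolynomial.aeval (jet f) Q).natDegree ≤ T * w :=
  MvPolynomial.aeval_natDegree_le Q hQ _ fun i => natDegree_jet_le hw hf i

theorem totalDegree_le_of_exponents_lt {m h : ℕ} {Q : MvPolynomial (Fin m) F}
    (hQ : ∀ e ∈ Q.support, ∀ i, e i < h) : Q.totalDegree ≤ m * (h - 1) := by
  refine Finset.sup_le fun e he => ?_
  rw [Finsupp.sum_fintype _ _ (fun _ => rfl)]
  calc ∑ i, e i ≤ ∑ _i : Fin m, (h - 1) := Finset.sum_le_sum fun i _ => Nat.le_sub_one_of_lt (hQ e he i)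
    _ = m * (h - 1) := by simp

/-- Interpolation: a nonzero polynomial with small exponents that vanishes at given jets. -/
theorem exists_interpolation {m h q w : ℕ} (hw : 1 ≤ w) (S : Finset F[X])
    (hS : ∀ f ∈ S, f.natDegree ≤ w) (hq : m * (h - 1) * w < q) (hcard : S.card * q < h ^ m) :
    ∃ Q : MvPolynomial (Fin m) F, Q ≠ 0 ∧ (∀ e ∈ Q.support, ∀ i, e i < h) ∧
      ∀ f ∈ S, MvPolynomial.aeval (jet f) Q = 0 := by
  classical
  let mon : (Fin m → Fin h) → MvPolynomial (Fin m) F := fun e =>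
    MvPolynomial.monomial (Finsupp.equivFunOnFinite.symm fun i => (e i : ℕ)) 1
  have hmon_inj : ∀ e e' : Fin m → Fin h,
      (Finsupp.equivFunOnFinite.symm fun i => (e i : ℕ) : Fin m →₀ ℕ) =
        Finsupp.equivFunOnFinite.symm (fun i => (e' i : ℕ)) → e = e' := by
    intro e e' h
    have := Finsupp.equivFunOnFinite.symm.injective h
    funext i
    exact Fin.ext (congrFun this i)
  let comb : ((Fin m → Fin h) → F) →ₗ[F] MvPolynomial (Fin m) F :=
    Fintype.linearCombination F mon
  have hcoeff : ∀ c e, (comb c).coeff (Finsupp.equivFunOnFinite.symm fun i => (e i : ℕ)) = c e := by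
    intro c e
    simp only [comb, Fintype.linearCombination_apply, MvPolynomial.coeff_sum, mon,
      MvPolynomial.coeff_smul, MvPolynomial.coeff_monomial, smul_eq_mul]
    rw [Finset.sum_eq_single e]
    · simp
    · intro e' _ he'
      rw [if_neg (fun h => he' (hmon_inj _ _ h)), mul_zero]
    · simp
  have hsupp : ∀ c, ∀ e ∈ (comb c).support, ∀ i, e i < h := by
    intro c e he i
    by_contra hlt
    refine MvPolynomial.mem_support_iff.1 he ?_
    simp only [comb, Fintype.linearCombination_apply, MvPolynomial.coeff_sum, mon,
      MvPolynomial.coeff_smul, MvPolynomial.coeff_monomial, smul_eq_mul]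
    refine Finset.sum_eq_zero fun e' _ => ?_
    rw [if_neg, mul_zero]
    rintro rfl
    exact hlt (e' i).2
  have htot : ∀ c, (comb c).totalDegree ≤ m * (h - 1) := by
    intro c
    refine totalDegree_le_of_exponents_lt (hsupp c)
  have hdeg : ∀ c, ∀ f : S, MvPolynomial.aeval (jet (f : F[X])) (comb c) ∈ degreeLT F q := by
    intro c f
    rw [mem_degreeLT]
    refine (degree_le_natDegree).trans_lt ?_
    exact_mod_cast (natDegree_aeval_jet_le hw (hS f f.2) _ (htot c)).trans_lt hq
  -- There are `h ^ m` free coefficients, and for each `f ∈ S` the substituted polynomial has degree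
  -- below `q`, which gives at most `q` linear conditions. The hypothesis `hcard` makes the kernel
  -- nontrivial.
  let Φ : ((Fin m → Fin h) → F) →ₗ[F] (S → degreeLT F q) := LinearMap.pi fun f =>
    LinearMap.codRestrict (degreeLT F q)
      ((MvPolynomial.aeval (jet (f : F[X]))).toLinearMap ∘ₗ comb) fun c => hdeg c f
  have hker : LinearMap.ker Φ ≠ ⊥ := by
    apply LinearMap.ker_ne_bot_of_finrank_lt
    rw [Module.finrank_pi_fintype, Module.finrank_fintype_fun_eq_card]
    rw [(degreeLTEquiv F q).finrank_eq]
    simpa using hcard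
  obtain ⟨c, hc, hc0⟩ := (Submodule.ne_bot_iff _).1 hker
  refine ⟨comb c, ?_, hsupp c, ?_⟩
  · rintro h0
    apply hc0
    funext e
    rw [← hcoeff c e, h0]
    simp
  · intro f hf
    have := congrFun (LinearMap.mem_ker.1 hc) ⟨f, hf⟩
    exact congrArg Subtype.val this

/-- The chain rule; it serves to exclude that the minimal interpolating polynomial involves only the
variable for `X`. -/
theorem derivative_aeval {σ : Type*} [Fintype σ] [DecidableEq σ] (g : σ → F[X])
    (Q : MvPolynomial σ F) :
    derivative (MvPolynomial.aeval g Q) =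
      ∑ i, MvPolynomial.aeval g (MvPolynomial.pderiv i Q) * derivative (g i) := by
  induction Q using MvPolynomial.induction_on with
  | C a => simp
  | add P Q hP hQ => simp [hP, hQ, add_mul, Finset.sum_add_distrib]
  | mul_X P k hP =>
    have hterm : ∀ i, MvPolynomial.aeval g (MvPolynomial.pderiv i (P * MvPolynomial.X k)) *
        derivative (g i) = MvPolynomial.aeval g (MvPolynomial.pderiv i P) * derivative (g i) * g k +
        if i = k then MvPolynomial.aeval g P * derivative (g k) else 0 := by
      intro i
      rw [Derivation.leibniz, MvPolynomial.pderiv_X, smul_eq_mul, smul_eq_mul, map_add, map_mul,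
        map_mul, MvPolynomial.aeval_X]
      by_cases hik : i = k
      · subst hik; simp; ring
      · rw [Pi.single_eq_of_ne (Ne.symm hik), if_neg hik, map_zero]; ring
    rw [Finset.sum_congr rfl fun i _ => hterm i, Finset.sum_add_distrib, ← Finset.sum_mul, ← hP,
      Finset.sum_ite_eq' Finset.univ k, if_pos (Finset.mem_univ k), map_mul, MvPolynomial.aeval_X,
      derivative_mul]

/-- If two polynomials satisfy the same differential equation and have the same initial values at
`y`, then they are equal, or the separant vanishes at `y`. -/
theorem eval_separant_eq_zero {m : ℕ} {Q : MvPolynomial (Fin m) F} {f g : F[X]} {i : Fin m} {s : ℕ}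
    (hi : (i : ℕ) = s + 1) (hvars : ∀ k ∈ Q.vars, k ≤ i)
    (hf : MvPolynomial.aeval (jet f) Q = 0) (hg : MvPolynomial.aeval (jet g) Q = 0) (hfg : f ≠ g)
    (hfac : ∀ k ≤ (g - f).natDegree, (k.factorial : F) ≠ 0) {y : F}
    (hy : ∀ j ≤ s, (derivative^[j] f).eval y = (derivative^[j] g).eval y) :
    (MvPolynomial.aeval (jet f) (MvPolynomial.pderiv i Q)).eval y = 0 := by
  set e := g - f with he
  have he0 : e ≠ 0 := sub_ne_zero.2 hfg.symm
  set K := e.rootMultiplicity y with hK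
  -- The value is `K!` times a nonzero number, and `K!` is invertible because `K` is at most the
  -- degree of `e`.
  have hKe : (derivative^[K] e).eval y ≠ 0 := by
    rw [hK, eval_iterate_derivative_rootMultiplicity, nsmul_eq_mul]
    refine mul_ne_zero (hfac _ ?_) (eval_divByMonic_pow_rootMultiplicity_ne_zero _ he0)
    simpa using natDegree_le_of_dvd (pow_rootMultiplicity_dvd e y) he0
  have hsK : s < K := by
    by_contra hle
    refine hKe ?_
    rw [he, iterate_derivative_sub, eval_sub, hy K (not_lt.1 hle), sub_self]
  have hdvd : ∀ j, (X - C y) ^ (K - j) ∣ derivative^[j] e := fun j =>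
    pow_sub_dvd_iterate_derivative_of_pow_dvd j (pow_rootMultiplicity_dvd e y)
  -- One order more than `e^(s)` is guaranteed to have. The lower derivatives of `e` vanish to this
  -- order, and so does the square of `e^(s)`, because `s < K`. Modulo `J` only the first-order term
  -- in the variable `i` survives.
  set J : Ideal F[X] := Ideal.span {(X - C y) ^ (K - s + 1)} with hJ
  -- The jet of `g` cut off after coordinate `i`. `Q` does not see the later coordinates, and there
  -- `u` has to agree with the jet of `f`.
  let u : Fin m → F[X] := fun k => if k ≤ i then jet g k else jet f k
  have hu : MvPolynomial.aeval u Q = 0 := by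
    rw [← hg]
    refine MvPolynomial.eval₂Hom_congr' rfl (fun k hk _ => ?_) rfl
    simp [u, hvars k hk]
  have hdiff : ∀ k : Fin m, ∀ j : ℕ, (k : ℕ) = j + 1 → k ≤ i → u k - jet f k = derivative^[j] e := by
    intro k j hkj hki
    simp [u, hki, jet, hkj, he]
  have hui : u i - jet f i = derivative^[s] e := hdiff i s hi le_rfl
  have hmem := MvPolynomial.aeval_sub_aeval_mem J u (jet f) i ?_ ?_ Q
  · rw [hu, hf, hui, sub_zero, zero_sub, neg_mem_iff, hJ, Ideal.mem_span_singleton] at hmem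
    by_contra hne
    have hcop : IsCoprime ((X - C y) ^ (K - s + 1))
        (MvPolynomial.aeval (jet f) (MvPolynomial.pderiv i Q)) := by
      refine IsCoprime.pow_left ((irreducible_X_sub_C y).coprime_iff_not_dvd.2 ?_)
      rwa [dvd_iff_isRoot]
    have h1 := hcop.dvd_of_dvd_mul_left hmem
    -- If the separant were nonzero at `y`, then `e^(s)` would vanish to order `K - s + 1`.
    -- Differentiating `K - s` more times makes `e^(K)` vanish at `y`, against the choice of `K`.
    have h2 := pow_sub_dvd_iterate_derivative_of_pow_dvd (K - s) h1
    rw [← Function.iterate_add_apply, Nat.sub_add_cancel hsK.le, Nat.add_sub_cancel_left, pow_one,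
      dvd_iff_isRoot] at h2
    exact hKe h2
  · intro k hk
    by_cases hki : k ≤ i
    · have hlt : (k : ℕ) < i := lt_of_le_of_ne hki (fun h => hk (Fin.ext h))
      rcases Nat.eq_zero_or_eq_succ_pred (k : ℕ) with h0 | h1
      · simp [u, hki, jet, h0]
      · rw [hdiff k _ h1 hki, hJ, Ideal.mem_span_singleton]
        exact (pow_dvd_pow _ (by omega)).trans (hdvd _)
    · simp [u, hki]
  · rw [hui, hJ, Ideal.mem_span_singleton]
    have h2 := pow_dvd_pow_of_dvd (hdvd s) 2
    rw [← pow_mul] at h2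
    exact (pow_dvd_pow _ (by omega)).trans h2

/-- With this the separant stays in the class of polynomials among which `Q` is minimal. -/
theorem support_pderiv_lt {m h : ℕ} {Q : MvPolynomial (Fin m) F} (i : Fin m)
    (hQ : ∀ e ∈ Q.support, ∀ k, e k < h) :
    ∀ e ∈ (MvPolynomial.pderiv i Q).support, ∀ k, e k < h := by
  intro e he k
  rw [MvPolynomial.mem_support_iff, MvPolynomial.coeff_pderiv] at he
  have := hQ _ (MvPolynomial.mem_support_iff.2 (left_ne_zero_of_mul he)) k
  simp only [Finsupp.coe_add, Pi.add_apply] at this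
  omega

theorem totalDegree_pderiv_lt {m : ℕ} {Q : MvPolynomial (Fin m) F} {i : Fin m}
    (hQ : MvPolynomial.pderiv i Q ≠ 0) :
    (MvPolynomial.pderiv i Q).totalDegree < Q.totalDegree := by
  have key : ∀ e ∈ (MvPolynomial.pderiv i Q).support, (e.sum fun _ k => k) < Q.totalDegree := by
    intro e he
    rw [MvPolynomial.mem_support_iff, MvPolynomial.coeff_pderiv] at he
    have h1 := MvPolynomial.le_totalDegree
      (MvPolynomial.mem_support_iff.2 (left_ne_zero_of_mul he))
    rw [Finsupp.sum_add_index' (fun _ => rfl) (fun _ _ _ => rfl), Finsupp.sum_single_index rfl] at h1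
    omega
  obtain ⟨e, he⟩ := MvPolynomial.support_nonempty.2 hQ
  exact (Finset.sup_lt_iff (by simpa using (Nat.zero_le _).trans_lt (key e he))).2 key

/-- Among few polynomials of small degree there is one that is determined, at most points, by the
values of its first derivatives. -/
theorem exists_unique_jets {p m h w : ℕ} [Fact p.Prime] (hm : 1 ≤ m) (hw : 1 ≤ w)
    (hp : 2 * (m * h * w) ≤ p) (hh : 1 ≤ h)
    (S : Finset (ZMod p)[X]) (hS : ∀ f ∈ S, f.natDegree ≤ w) (hne : S.Nonempty)
    (hcard : S.card * p < h ^ m) :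
    ∃ f ∈ S, ∃ Z : Finset (ZMod p), 2 * Z.card < p ∧ ∀ y ∉ Z, ∀ g ∈ S,
      (∀ j < m - 1, (derivative^[j] f).eval y = (derivative^[j] g).eval y) → g = f := by
  classical
  have hlow : m * (h - 1) * w < m * h * w := by
    have : m * (h - 1) < m * h := Nat.mul_lt_mul_of_pos_left (by omega) hm
    exact Nat.mul_lt_mul_of_pos_right this hw
  have hex : ∃ d, ∃ Q : MvPolynomial (Fin m) (ZMod p), Q.totalDegree = d ∧ Q ≠ 0 ∧
      (∀ e ∈ Q.support, ∀ i, e i < h) ∧ ∀ f ∈ S, MvPolynomial.aeval (jet f) Q = 0 := by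
    obtain ⟨Q, hQ⟩ := exists_interpolation (h := h) hw S hS (q := p) (by omega) hcard
    exact ⟨_, Q, rfl, hQ⟩
  -- `Q` has least total degree among the nonzero interpolating polynomials with exponents below
  -- `h`. A nonzero partial derivative of `Q` therefore cannot vanish along all of `S`.
  obtain ⟨Q, hd, hQ0, hexp, hvan⟩ := Nat.find_spec hex
  have hmin : ∀ Q' : MvPolynomial (Fin m) (ZMod p), Q'.totalDegree < Q.totalDegree → Q' ≠ 0 →
      (∀ e ∈ Q'.support, ∀ i, e i < h) → ∃ f ∈ S, MvPolynomial.aeval (jet f) Q' ≠ 0 := by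
    intro Q' hlt h0 he
    by_contra! hall
    exact Nat.find_min hex (hd ▸ hlt) ⟨Q', rfl, h0, he, hall⟩
  obtain ⟨f₀, hf₀⟩ := hne
  have hvars : Q.vars.Nonempty := by
    rw [Finset.nonempty_iff_ne_empty]
    intro h0
    rw [MvPolynomial.vars_eq_empty_iff_eq_C] at h0
    have := hvan f₀ hf₀
    rw [h0, MvPolynomial.aeval_C, ← C_eq_algebraMap, C_eq_zero] at this
    exact hQ0 (by rw [h0, this, map_zero])
  set i := Q.vars.max' hvars with hi
  have hle : ∀ k ∈ Q.vars, k ≤ i := fun k hk => Finset.le_max' _ k hk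
  -- The exponents of `Q` are smaller than the characteristic, so differentiation in an occurring
  -- variable does not annihilate `Q`.
  have hhp : h ≤ p := by
    have : h * 1 ≤ h * (m * w) := Nat.mul_le_mul_left _ (Nat.mul_pos hm hw)
    nlinarith
  have hpd : MvPolynomial.pderiv i Q ≠ 0 := by
    obtain ⟨e, he, hei⟩ := (MvPolynomial.mem_vars_iff_mem_support i).1 (Finset.max'_mem _ hvars)
    rw [Finsupp.mem_support_iff] at hei
    intro h0
    have h1 := MvPolynomial.coeff_pderiv (i := i) Q (e - Finsupp.single i 1)
    have h2 : e - Finsupp.single i 1 + Finsupp.single i 1 = e := by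
      ext k
      by_cases hk : k = i
      · subst hk; simp; omega
      · simp [Ne.symm hk]
    rw [h0, h2, MvPolynomial.coeff_zero] at h1
    rcases mul_eq_zero.1 h1.symm with h3 | h3
    · exact MvPolynomial.mem_support_iff.1 he h3
    · have h4 : ((e i : ℕ) : ZMod p) = 0 := by
        rw [← h3]
        simp only [Finsupp.coe_tsub, Pi.sub_apply, Finsupp.single_eq_same]
        rw [Nat.cast_sub (by omega)]; simp
      rw [ZMod.natCast_eq_zero_iff] at h4
      exact absurd (Nat.le_of_dvd (by omega) h4) (by have := hexp e he i; omega)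
  have hexp' := support_pderiv_lt i hexp
  obtain ⟨f, hf, hsep⟩ := hmin _ (totalDegree_pderiv_lt hpd) hpd hexp'
  -- If only the variable for `X` occurred, then differentiating `Q(X) = 0` would make the separant
  -- vanish as well.
  have hi0 : (i : ℕ) ≠ 0 := by
    intro hi0
    apply hsep
    have h1 := derivative_aeval (jet f) Q
    rw [hvan f hf, derivative_zero, Finset.sum_eq_single i] at h1
    · simpa [jet, hi0] using h1.symm
    · intro k _ hk
      rw [MvPolynomial.pderiv_eq_zero_of_notMem_vars, map_zero, zero_mul]
      intro hkv
      exact hk (le_antisymm (hle k hkv) (by rw [Fin.le_def, hi0]; omega))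
    · simp
  obtain ⟨s, hs⟩ := Nat.exists_eq_succ_of_ne_zero hi0
  -- The exceptional points are the roots of the separant along `f`. Its degree is at most `m * (h -
  -- 1) * w`, which is less than `p / 2`.
  refine ⟨f, hf, (MvPolynomial.aeval (jet f) (MvPolynomial.pderiv i Q)).roots.toFinset, ?_, ?_⟩
  · have h1 := (Multiset.toFinset_card_le _).trans
      (card_roots' (MvPolynomial.aeval (jet f) (MvPolynomial.pderiv i Q)))
    have h2 := natDegree_aeval_jet_le hw (hS f hf) _ (totalDegree_le_of_exponents_lt hexp')
    omega
  · intro y hy g hg hag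
    by_contra hne
    refine hy ?_
    rw [Multiset.mem_toFinset, mem_roots hsep, IsRoot]
    refine eval_separant_eq_zero hs hle (hvan f hf) (hvan g hg) (Ne.symm hne) ?_
      (fun j hj => hag j (by have := i.2; omega))
    intro k hk
    rw [Ne, ZMod.natCast_eq_zero_iff, (Fact.out : p.Prime).dvd_factorial]
    have := (natDegree_sub_le g f).trans (max_le (hS g hg) (hS f hf))
    have : w * 1 ≤ w * (m * h) := Nat.mul_le_mul_left _ (Nat.mul_pos hm hh)
    nlinarith

end Multiplicity

end CompressedSensing

/-! ### The bipartite graph of columns and vertices. -/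

namespace CompressedSensing

open Polynomial

/-- The binary digit of `j` at position `b`. -/
def bit (j b : ℕ) : ℕ := j / 2 ^ b % 2

theorem bit_lt_two (j b : ℕ) : bit j b < 2 := Nat.mod_lt _ two_pos

theorem eq_of_bit_eq {w j j' : ℕ} (hj : j < 2 ^ w) (hj' : j' < 2 ^ w)
    (h : ∀ b < w, bit j b = bit j' b) : j = j' := by
  refine Nat.eq_of_testBit_eq fun b => ?_
  by_cases hb : b < w
  · have := h b hb
    simp only [bit] at this
    simp [Nat.testBit_eq_decide_div_mod_eq, this]
  · rw [Nat.testBit_lt_two_pow (hj.trans_le (Nat.pow_le_pow_right two_pos (not_lt.1 hb))),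
      Nat.testBit_lt_two_pow (hj'.trans_le (Nat.pow_le_pow_right two_pos (not_lt.1 hb)))]

theorem sum_bit (w j : ℕ) : ∑ b ∈ Finset.range w, bit j b * 2 ^ b = j % 2 ^ w := by
  induction w with
  | zero => simp [Nat.mod_one]
  | succ w ih => rw [Finset.sum_range_succ, ih, bit, Nat.mod_pow_succ]; ring

/-- The polynomial whose coefficients are the binary digits of `j`. -/
noncomputable def digitPoly (q w j : ℕ) : (ZMod q)[X] :=
  ∑ b ∈ Finset.range w, C (bit j b : ZMod q) * X ^ b

theorem coeff_digitPoly (q w j b : ℕ) :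
    (digitPoly q w j).coeff b = if b < w then (bit j b : ZMod q) else 0 := by
  simp [digitPoly, coeff_X_pow]

theorem natDegree_digitPoly_le (q w j : ℕ) : (digitPoly q w j).natDegree ≤ w :=
  natDegree_le_iff_coeff_eq_zero.2 fun b hb => by
    rw [coeff_digitPoly, if_neg (by omega)]

theorem digitPoly_injective {q w j j' : ℕ} (hq : 2 ≤ q) (hj : j < 2 ^ w) (hj' : j' < 2 ^ w)
    (h : digitPoly q w j = digitPoly q w j') : j = j' := by
  refine eq_of_bit_eq hj hj' fun b hb => ?_
  have := congrArg (fun f => coeff f b) h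
  simp only [coeff_digitPoly, if_pos hb] at this
  rw [ZMod.natCast_eq_natCast_iff'] at this
  rwa [Nat.mod_eq_of_lt ((bit_lt_two _ _).trans_le hq),
    Nat.mod_eq_of_lt ((bit_lt_two _ _).trans_le hq)] at this

/-- The tuple `(y, f(y), f'(y), …)` of length `i + 1` in base `q`, where `f` is the polynomial
of `j`. -/
noncomputable def vertex (q w j y : ℕ) : ℕ → ℕ
  | 0 => y
  | i + 1 => vertex q w j y i * q + ((derivative^[i] (digitPoly q w j)).eval (y : ZMod q)).val

theorem vertex_lt {q w j y : ℕ} (hq : 0 < q) (hy : y < q) (i : ℕ) :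
    vertex q w j y i < q ^ (i + 1) := by
  have : NeZero q := ⟨hq.ne'⟩
  induction i with
  | zero => simpa [vertex] using hy
  | succ i ih =>
    have h1 := ZMod.val_lt ((derivative^[i] (digitPoly q w j)).eval (y : ZMod q))
    rw [vertex, pow_succ]
    nlinarith

/-- The coordinates are digits in base `q`: the remainder modulo `q` is the last one, and the
quotient encodes the others. -/
theorem vertex_eq {q w j j' y y' : ℕ} (hq : 0 < q) {i : ℕ}
    (h : vertex q w j y i = vertex q w j' y' i) :
    y = y' ∧ ∀ k < i, (derivative^[k] (digitPoly q w j)).eval (y : ZMod q) =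
      (derivative^[k] (digitPoly q w j')).eval (y : ZMod q) := by
  have : NeZero q := ⟨hq.ne'⟩
  induction i with
  | zero => exact ⟨h, fun k hk => absurd hk (by omega)⟩
  | succ i ih =>
    simp only [vertex] at h
    have h1 := ZMod.val_lt ((derivative^[i] (digitPoly q w j)).eval (y : ZMod q))
    have h2 := ZMod.val_lt ((derivative^[i] (digitPoly q w j')).eval (y' : ZMod q))
    have h3 := congrArg (· / q) h
    have h4 := congrArg (· % q) h
    simp only [mul_comm _ q, Nat.mul_add_div hq, Nat.div_eq_of_lt h1, Nat.div_eq_of_lt h2,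
      add_zero, Nat.mul_add_mod, Nat.mod_eq_of_lt h1, Nat.mod_eq_of_lt h2] at h3 h4
    obtain ⟨rfl, hk⟩ := ih h3
    refine ⟨rfl, fun k hk' => ?_⟩
    rcases Nat.lt_succ_iff_lt_or_eq.1 hk' with hlt | rfl
    · exact hk k hlt
    · exact ZMod.val_injective q h4

/-- Few columns: one of them has most of its vertices for itself. -/
theorem exists_unique_vertices {q w m h : ℕ} (hq : q.Prime) (hm : 1 ≤ m) (hw : 1 ≤ w)
    (hh : 1 ≤ h) (hqm : 2 * (m * h * w) ≤ q) (S : Finset ℕ) (hS : ∀ j ∈ S, j < 2 ^ w)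
    (hne : S.Nonempty) (hcard : S.card * q < h ^ m) :
    ∃ j ∈ S, ∃ U ⊆ Finset.range q, q < 2 * U.card ∧ ∀ y ∈ U, ∀ j' ∈ S, ∀ y',
      vertex q w j' y' (m - 1) = vertex q w j y (m - 1) → j' = j := by
  classical
  have : Fact q.Prime := ⟨hq⟩
  obtain ⟨f, hf, Z, hZ, huniq⟩ := exists_unique_jets hm hw hqm hh (S.image (digitPoly q w))
    (by simp only [Finset.mem_image]; rintro _ ⟨j, _, rfl⟩; exact natDegree_digitPoly_le q w j)
    (hne.image _) ((Nat.mul_le_mul_right _ Finset.card_image_le).trans_lt hcard)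
  obtain ⟨j, hj, rfl⟩ := Finset.mem_image.1 hf
  refine ⟨j, hj, (Finset.range q).filter fun y : ℕ => (y : ZMod q) ∉ Z, Finset.filter_subset _ _,
    ?_, ?_⟩
  · have h1 : ((Finset.range q).filter fun y : ℕ => ¬ (y : ZMod q) ∉ Z).card ≤ Z.card := by
      refine Finset.card_le_card_of_injOn (fun y : ℕ => (y : ZMod q)) ?_ ?_
      · intro y hy
        simpa using (Finset.mem_filter.1 hy).2
      · intro y hy y' hy' he
        rw [Finset.mem_coe, Finset.mem_filter, Finset.mem_range] at hy hy'
        simpa [ZMod.natCast_eq_natCast_iff', Nat.mod_eq_of_lt hy.1, Nat.mod_eq_of_lt hy'.1] using he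
    have h2 := Finset.card_filter_add_card_filter_not (s := Finset.range q)
      (fun y : ℕ => (y : ZMod q) ∉ Z)
    rw [Finset.card_range] at h2
    omega
  · intro y hy j' hj' y' he
    rw [Finset.mem_filter] at hy
    obtain ⟨rfl, hd⟩ := vertex_eq hq.pos he
    exact digitPoly_injective hq.two_le (hS _ hj') (hS _ hj)
      (huniq _ hy.2 _ (Finset.mem_image_of_mem _ hj') fun k hk => (hd k hk).symm)

end CompressedSensing

/-! ### Computation of the parameters on the machine. -/

namespace CompressedSensing

open RingRAM

/-- Powers of expressions. -/
def _root_.RingRAM.WExpr.pow (e : WExpr) : ℕ → WExpr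
  | 0 => 1
  | a + 1 => e.pow a * e

@[simp] theorem _root_.RingRAM.WExpr.val_pow {R : Type*} (s : State R) (e : WExpr) (a : ℕ) :
    (e.pow a).val s = e.val s ^ a := by
  induction a with
  | zero => simp [WExpr.pow]
  | succ a ih => simp [WExpr.pow, ih, pow_succ]

theorem _root_.RingRAM.WExpr.safe_pow {e : WExpr} (he : e.safe = true) (a : ℕ) :
    (e.pow a).safe = true := by
  induction a with
  | zero => rfl
  | succ a ih =>
    change ((e.pow a).safe && e.safe) = true
    simp [ih, he]

/-- Computes the number `w = size n + 6` of binary digits into register 10. -/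
def sizeProg : Prog :=
  .setReg 10 6 ;; .setReg 40 1 ;;
  .forTo 41 0 (.ite (.wlt (.reg 40) (.reg 0 + 1))
    (.setReg 40 (.reg 40 * 2) ;; .setReg 10 (.reg 10 + 1)) .skip)

/-- Searches a prime in `(N, 2 N]`, where `N = 2 h w²` and `h = (4 w²) ^ a`, and stores it in
register 11. -/
def primeProg (a : ℕ) : Prog :=
  .setReg 42 ((4 * .reg 10 * .reg 10 : WExpr).pow a) ;;
  .setReg 43 (2 * .reg 42 * .reg 10 * .reg 10) ;;
  .forTo 44 43 (
    .setReg 45 0 ;; .setReg 46 (.reg 43 + .reg 44 + 1) ;; .setReg 47 (.reg 46 - 2) ;;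
    .forTo 48 47 (.ite (.weq (.reg 46 % (.reg 48 + 2)) 0) (.setReg 45 1) .skip) ;;
    .ite (.weq (.reg 45) 0) (.setReg 11 (.reg 46)) .skip)

/-- Computes the least `m` with `t q (q + 1) < h ^ m`; stores `m - 1` in register 12 and `q ^ m` in
register 13. -/
def lengthProg : Prog :=
  .setReg 49 (.get 0 1 * .reg 11 * (.reg 11 + 1)) ;;
  .setReg 50 1 ;; .setReg 51 0 ;; .setReg 13 1 ;;
  .forTo 52 10 (.ite (.wlt (.reg 50) (.reg 49 + 1))
    (.setReg 50 (.reg 50 * .reg 42) ;; .setReg 51 (.reg 51 + 1) ;;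
      .setReg 13 (.reg 13 * .reg 11)) .skip) ;;
  .setReg 12 (.reg 51 - 1)

variable {R : Type*} [Ring R] {B : ℕ} {s : State R} {Q : State R → Prop}

theorem runs_sizeProg {n : ℕ} (hn : s.word 0 0 = n) (hB : 2 * n + n.size + 6 < 2 ^ B)
    (hQ : ∀ s', s'.word 10 0 = n.size + 6 → Frame sizeProg s s' → Q s') :
    Runs B (n * 5 + 4) sizeProg s Q := by
  refine (Runs.frame (Q := fun s' => s'.word 10 0 = n.size + 6) ?_).mono le_rfl
    fun s' h => hQ s' h.1 h.2
  refine Runs.setW_seq (N := n * 5 + 3) (by simp; omega) ?_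
  refine Runs.setW_seq (N := n * 5 + 2) (by simp only [WExpr.val_ofNat]; omega) ?_
  -- Doubling continues as long as `2 ^ e ≤ n`. The loop has `n` rounds, which is enough since `n <
  -- 2 ^ n`, and affordable since measurement may take time linear in `n`.
  refine Runs.forTo (n := n) (Nb := 3) (fun k s => ∃ e, s.word 10 0 = e + 6 ∧ s.word 40 0 = 2 ^ e ∧
    e ≤ n.size ∧ (e = k ∨ n < 2 ^ e)) (by simpa using hn) (by omega) ⟨0, by simp⟩ ?_ ?_
  · rintro k s' hk ⟨e, h1, h2, h3, h4⟩ - hF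
    have h0 : s'.word 0 0 = n := by rw [hF.word 0 rfl]; simpa using hn
    refine Runs.ite (N := 2) (fun h => ?_) (fun h => ?_)
    · simp only [Test.Holds, WExpr.val_get, WExpr.val_const, WExpr.val_add, WExpr.val_ofNat, h0,
        h2] at h
      have he : e < n.size := Nat.lt_size.2 (by omega)
      refine Runs.setW_seq ?_ (Runs.setW ?_ ⟨e + 1, ?_⟩)
      · simp [h2]; omega
      · simp [h1]; omega
      · refine ⟨by simp [h1], by simp [h2, pow_succ], by omega, ?_⟩
        rcases h4 with rfl | h4
        · exact Or.inl rfl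
        · omega
    · simp only [Test.Holds, WExpr.val_get, WExpr.val_const, WExpr.val_add, WExpr.val_ofNat, h0,
        h2] at h
      exact Runs.skip ⟨e, by simpa using h1, by simpa using h2, h3, Or.inr (by omega)⟩
  · rintro s' ⟨e, h1, h2, h3, h4⟩ - -
    have : n.size ≤ e := Nat.size_le.2 (by
      rcases h4 with rfl | h4
      · exact Nat.lt_two_pow_self
      · exact h4)
    rw [h1]; omega

theorem runs_primeProg {a w h N : ℕ} (hw : s.word 10 0 = w) (hh : h = (4 * w * w) ^ a)
    (hN : N = 2 * h * w * w) (hN1 : 1 ≤ N) (hB : 4 * N + h < 2 ^ B)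
    (hQ : ∀ s', s'.word 42 0 = h → (s'.word 11 0).Prime → N < s'.word 11 0 →
      s'.word 11 0 ≤ 2 * N → Frame (primeProg a) s s' → Q s') :
    Runs B (N * (2 * N * 4 + 10) + 4) (primeProg a) s Q := by
  refine (Runs.frame (Q := fun s' => s'.word 42 0 = h ∧ (s'.word 11 0).Prime ∧ N < s'.word 11 0 ∧
      s'.word 11 0 ≤ 2 * N) ?_).mono le_rfl
    fun s' h => hQ s' h.1.1 h.1.2.1 h.1.2.2.1 h.1.2.2.2 h.2
  refine Runs.setW_seq (N := N * (2 * N * 4 + 10) + 3) (by simp only [WExpr.val_pow, WExpr.val_mul, WExpr.val_get, WExpr.val_const, WExpr.val_ofNat, hw, ← hh]; omega) ?_ rfl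
    (WExpr.safe_pow rfl a)
  refine Runs.setW_seq (N := N * (2 * N * 4 + 10) + 2) (by simp [hw, ← hh, ← hN]; omega) ?_
  set s₁ := (s.writeW 42 _ _).writeW 43 _ _ with hs₁
  have h42 : s₁.word 42 0 = h := by simp [hs₁, hw, hh]
  have h43 : s₁.word 43 0 = N := by simp [hs₁, hw, ← hh, hN]
  clear_value s₁
  -- The invariant is conditional: it promises nothing before the first prime has been met, and
  -- later primes overwrite earlier ones. Bertrand's postulate removes the condition at the end.
  refine Runs.forTo (n := N) (Nb := 2 * N * 4 + 8)
    (fun k s => (∃ p, p.Prime ∧ N < p ∧ p ≤ N + k) →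
      (s.word 11 0).Prime ∧ N < s.word 11 0 ∧ s.word 11 0 ≤ N + k) h43 (by omega) ?_ ?_ ?_
  · rintro ⟨p, -, h1, h2⟩; omega
  · intro k s' hk hI h44 hF
    have h43' : s'.word 43 0 = N := by rw [hF.word 43 rfl, h43]
    refine Runs.setW_seq (N := 2 * N * 4 + 7) (by simp) ?_
    refine Runs.setW_seq (N := 2 * N * 4 + 6) (by simp [h43', h44]; omega) ?_
    refine Runs.setW_seq (N := 2 * N * 4 + 5) (by simp [h43', h44]; omega) ?_
    set s₂ := ((s'.writeW 45 _ _).writeW 46 _ _).writeW 47 _ _ with hs₂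
    have h45 : s₂.word 45 0 = 0 := by simp [hs₂]
    have h46 : s₂.word 46 0 = N + k + 1 := by simp [hs₂, h43', h44]
    have h47 : s₂.word 47 0 = N + k + 1 - 2 := by simp [hs₂, h43', h44]
    have h11 : s₂.word 11 = s'.word 11 := by simp [hs₂, State.writeW_array]
    clear_value s₂
    -- Trial division by `i + 2` for `i < N + k + 1 - 2`, that is, by all numbers from `2` up to the
    -- candidate, which is excluded.
    refine Runs.seq (N := 2 * N * 4 + 2) (N' := 3) ((Runs.forTo (n := N + k + 1 - 2) (Nb := 2)
      (fun i s => s.word 45 0 = 0 ↔ ∀ p < i, ¬ (p + 2) ∣ N + k + 1)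
      h47 (by omega) (by simp [h45]) ?_ ?_).le
        (by have : N + k + 1 - 2 ≤ 2 * N := by omega
            nlinarith))
    · intro i s₃ hi hI h48 hF
      have h46' : s₃.word 46 0 = N + k + 1 := by rw [hF.word 46 rfl, h46]
      refine Runs.ite (N := 1) (fun h => Runs.setW ?_ ?_) (fun h => Runs.skip ?_)
      · simp only [WExpr.val_ofNat]; omega
      · simp only [Test.Holds, WExpr.val_mod, WExpr.val_get, WExpr.val_const, WExpr.val_add,
          WExpr.val_ofNat, h46', h48] at h
        simp only [WExpr.val_ofNat, State.writeW_word]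
        simp only [Nat.reduceEqDiff, false_and, if_false, and_self, if_true, one_ne_zero, false_iff]
        exact fun h' => h' i (by omega) (Nat.dvd_of_mod_eq_zero h)
      · simp only [Test.Holds, WExpr.val_mod, WExpr.val_get, WExpr.val_const, WExpr.val_add,
          WExpr.val_ofNat, h46', h48] at h
        simp only [State.writeW_word, Nat.reduceEqDiff, false_and, if_false]
        rw [hI]
        constructor
        · intro h' p hp
          rcases Nat.lt_succ_iff_lt_or_eq.1 hp with hp | rfl
          · exact h' p hp
          · exact fun hd => h (Nat.mod_eq_zero_of_dvd hd)
        · exact fun h' p hp => h' p (by omega)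
    · intro s₃ hI _ hF
      have h46' : s₃.word 46 0 = N + k + 1 := by rw [hF.word 46 rfl, h46]
      have h11' : s₃.word 11 0 = s'.word 11 0 := by rw [hF.word 11 rfl, h11]
      have hprime : s₃.word 45 0 = 0 ↔ (N + k + 1).Prime := by
        rw [hI]
        constructor
        · intro h'
          refine Nat.prime_def_lt'.2 ⟨by omega, fun m hm hlt hd => ?_⟩
          refine h' (m - 2) (by omega) ?_
          rwa [Nat.sub_add_cancel hm]
        · intro h' p hp hd
          rcases (Nat.dvd_prime h').1 hd with h1 | h1 <;> omega
      refine Runs.ite (N := 2) (fun h => Runs.setW ?_ ?_) (fun h => Runs.skip ?_)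
      · simp [h46']; omega
      · simp only [Test.Holds, WExpr.val_get, WExpr.val_const, WExpr.val_ofNat] at h
        rintro -
        simp only [WExpr.val_get, WExpr.val_const, WExpr.val_ofNat, h46', State.writeW_word]
        simp [hprime.1 h]
      · simp only [Test.Holds, WExpr.val_get, WExpr.val_const, WExpr.val_ofNat] at h
        rintro ⟨p, hp, h1, h2⟩
        simp only [State.writeW_word, Nat.reduceEqDiff, false_and, if_false, h11']
        have := hI.not.1 h
        have hne : p ≠ N + k + 1 := by
          rintro rfl
          exact h (hprime.2 hp)
        obtain ⟨k1, k2, k3⟩ := ‹(∃ p, p.Prime ∧ N < p ∧ p ≤ N + k) → _› ⟨p, hp, h1, by omega⟩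
        exact ⟨k1, k2, by omega⟩
  · intro s' hI _ hF
    obtain ⟨p, hp, h1, h2⟩ := Nat.exists_prime_lt_and_le_two_mul N (by omega)
    obtain ⟨k1, k2, k3⟩ := hI ⟨p, hp, h1, by omega⟩
    exact ⟨by rw [hF.word 42 rfl, h42], k1, k2, by omega⟩

theorem runs_lengthProg {w q h t T D : ℕ} (hw : s.word 10 0 = w) (hq : s.word 11 0 = q)
    (hh : s.word 42 0 = h) (ht : s.word 0 1 = t) (hT : T = t * q * (q + 1)) (hT1 : 1 ≤ T)
    (hTh : T < h ^ w) (hq1 : 1 ≤ q) (hD : T * h ≤ D) (hD' : q ^ w ≤ D) (hB : D + w + h < 2 ^ B)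
    (hQ : ∀ s' m, 1 ≤ m → m ≤ w → s'.word 12 0 = m - 1 → s'.word 13 0 = q ^ m → T < h ^ m →
      h ^ (m - 1) ≤ T → Frame lengthProg s s' → Q s') :
    Runs B (w * 6 + 7) lengthProg s Q := by
  refine (Runs.frame (Q := fun s' => ∃ m, 1 ≤ m ∧ m ≤ w ∧ s'.word 12 0 = m - 1 ∧
      s'.word 13 0 = q ^ m ∧ T < h ^ m ∧ h ^ (m - 1) ≤ T) ?_).mono le_rfl
    fun s' ⟨⟨m, h1, h2, h3, h4, h5, h6⟩, hF⟩ => hQ s' m h1 h2 h3 h4 h5 h6 hF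
  have hh1 : 1 ≤ h := by
    rcases Nat.eq_zero_or_pos h with rfl | h0
    · rcases Nat.eq_zero_or_pos w with rfl | h0
      · omega
      · rw [zero_pow h0.ne'] at hTh; omega
    · exact h0
  have hTD : T ≤ D := (Nat.le_mul_of_pos_right T hh1).trans hD
  have h1D : 1 ≤ D := hT1.trans hTD
  refine Runs.setW_seq (N := w * 6 + 6) (by simp [ht, hq, ← hT]; omega) ?_
  refine Runs.setW_seq (N := w * 6 + 5) (by simp only [WExpr.val_ofNat]; omega) ?_
  refine Runs.setW_seq (N := w * 6 + 4) (by simp only [WExpr.val_ofNat]; omega) ?_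
  refine Runs.setW_seq (N := w * 6 + 3) (by simp only [WExpr.val_ofNat]; omega) ?_
  set s₁ := (((s.writeW 49 _ _).writeW 50 _ _).writeW 51 _ _).writeW 13 _ _ with hs₁
  have h10 : s₁.word 10 0 = w := by simp [hs₁, hw]
  have h11 : s₁.word 11 0 = q := by simp [hs₁, hq]
  have h42 : s₁.word 42 0 = h := by simp [hs₁, hh]
  have h49 : s₁.word 49 0 = T := by simp [hs₁, ht, hq, hT]
  have h50 : s₁.word 50 0 = 1 := by simp [hs₁]
  have h51 : s₁.word 51 0 = 0 := by simp [hs₁]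
  have h13 : s₁.word 13 0 = 1 := by simp [hs₁]
  clear_value s₁
  -- `m` grows until `T < h ^ m`, and the last conjunct records its minimality. For `m = 0` that
  -- conjunct says `1 ≤ T`, by truncated subtraction.
  refine Runs.seq (N' := 1) (Runs.forTo (n := w) (Nb := 4)
    (fun k s => ∃ m, m ≤ k ∧ s.word 50 0 = h ^ m ∧ s.word 51 0 = m ∧ s.word 13 0 = q ^ m ∧
      (m = k ∨ T < h ^ m) ∧ h ^ (m - 1) ≤ T) h10 (by omega) ⟨0, by simp [h50, h51, h13, hT1]⟩ ?_ ?_)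
  · rintro k s' hk ⟨m, k1, k2, k3, k4, k5, k6⟩ - hF
    have h49' : s'.word 49 0 = T := by rw [hF.word 49 rfl, h49]
    have h42' : s'.word 42 0 = h := by rw [hF.word 42 rfl, h42]
    have h11' : s'.word 11 0 = q := by rw [hF.word 11 rfl, h11]
    refine Runs.ite (N := 3) (fun hlt => ?_) (fun hlt => ?_)
    · simp only [Test.Holds, WExpr.val_get, WExpr.val_const, WExpr.val_add, WExpr.val_ofNat, h49',
        k2] at hlt
      have h1 : h ^ m * h ≤ T * h := Nat.mul_le_mul_right _ (by omega)
      have h2 : q ^ m * q ≤ q ^ w := by rw [← pow_succ]; exact Nat.pow_le_pow_right hq1 (by omega)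
      refine Runs.setW_seq ?_ (Runs.setW_seq ?_ (Runs.setW ?_ ⟨m + 1, ?_⟩))
      · simp [k2, h42']; omega
      · simp [k3]; omega
      · simp [k4, h11']; omega
      · refine ⟨by omega, by simp [k2, h42', pow_succ], by simp [k3], by simp [k4, h11', pow_succ],
          ?_, ?_⟩
        · rcases k5 with rfl | k5
          · exact Or.inl rfl
          · omega
        · simpa using (by omega : h ^ m ≤ T)
    · simp only [Test.Holds, WExpr.val_get, WExpr.val_const, WExpr.val_add, WExpr.val_ofNat, h49',
        k2] at hlt
      exact Runs.skip ⟨m, by omega, by simpa using k2, by simpa using k3, by simpa using k4,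
        Or.inr (by omega), k6⟩
  · rintro s' ⟨m, k1, k2, k3, k4, k5, k6⟩ - -
    have hTm : T < h ^ m := by
      rcases k5 with rfl | k5
      · exact hTh
      · exact k5
    refine Runs.setW (by simp [k3]; omega) ⟨m, ?_, k1, by simp [k3], by simpa using k4, hTm, k6⟩
    rcases Nat.eq_zero_or_pos m with rfl | h0
    · simp at hTm; omega
    · exact h0

end CompressedSensing

/-! ### Computation of the vertices and of the column lists. -/

namespace CompressedSensing

open RingRAM

/-- Writes the binary digits of the number in register 53 into array 57. -/
def digitsProg : Prog :=
  .setReg 55 (.reg 53) ;;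
  .forTo 56 10 (.setW 57 (.reg 56) (.reg 55 % 2) ;; .setReg 55 (.reg 55 / 2))

/-- Appends to register 58, in base `q`, the value of the polynomial in array 57 at the point in
register 54, and replaces the polynomial by its derivative. -/
def evalProg : Prog :=
  .setReg 60 0 ;; .setReg 61 1 ;;
  .forTo 62 10 (
    .setReg 60 ((.reg 60 + .get 57 (.reg 62) * .reg 61) % .reg 11) ;;
    .setReg 61 (.reg 61 * .reg 54 % .reg 11) ;;
    .setW 57 (.reg 62) ((.reg 62 + 1) * .get 57 (.reg 62 + 1) % .reg 11)) ;;
  .setReg 58 (.reg 58 * .reg 11 + .reg 60)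

/-- Computes the vertex for the column in register 53 and the point in register 54. -/
def vertexProg : Prog :=
  digitsProg ;; .setReg 58 (.reg 54) ;; .forTo 59 12 evalProg

/-- The address of the current matrix entry. -/
def entryAddr : WExpr := .reg 53 * (.reg 11 * .reg 10 + 1) + 1 + .reg 54 * .reg 10 + .reg 63

/-- Writes the matrix entries for the column in register 53 and the point in register 54. -/
def entryProg : Prog :=
  .setReg 55 (.reg 53) ;;
  .forTo 63 10 (
    .setW 2 entryAddr ((.reg 58 * .reg 10 + .reg 63) * 2 + .reg 55 % 2) ;;
    .setR 2 entryAddr .one ;;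
    .setReg 55 (.reg 55 / 2))

/-- Writes the matrix. -/
def tableProg : Prog :=
  .forTo 53 0 (
    .setW 1 (.reg 53) (.reg 53 * (.reg 11 * .reg 10 + 1)) ;;
    .setW 2 (.reg 53 * (.reg 11 * .reg 10 + 1)) (.reg 11 * .reg 10) ;;
    .forTo 54 11 (vertexProg ;; entryProg))

variable {R : Type*} [Ring R] {B : ℕ} {s : State R} {Q : State R → Prop}

theorem runs_digitsProg {w j : ℕ} (hj : s.word 53 0 = j) (hw : s.word 10 0 = w)
    (hB : j + w + 2 < 2 ^ B)
    (hQ : ∀ s', (∀ b, s'.word 57 b = if b < w then bit j b else s.word 57 b) →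
      Frame digitsProg s s' → Q s') :
    Runs B (w * 4 + 3) digitsProg s Q := by
  refine (Runs.frame (Q := fun s' => ∀ b, s'.word 57 b = if b < w then bit j b else s.word 57 b)
    ?_).mono le_rfl fun s' h => hQ s' h.1 h.2
  refine Runs.setW_seq (N := w * 4 + 2) (by simp [hj]; omega) ?_
  refine Runs.forTo (n := w) (Nb := 2) (fun k s' => s'.word 55 0 = j / 2 ^ k ∧
    ∀ b, s'.word 57 b = if b < k then bit j b else s.word 57 b) (by simpa using hw) (by omega)
    (by simp [hj]) ?_ ?_
  · rintro k s' hk ⟨h1, h2⟩ h56 -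
    have hlt : j / 2 ^ k < 2 ^ B := (Nat.div_le_self _ _).trans_lt (by omega)
    refine Runs.setW_seq ?_ (Runs.setW ?_ ⟨?_, fun b => ?_⟩)
    · simp only [WExpr.val_mod, WExpr.val_get, WExpr.val_const, WExpr.val_ofNat, h1]
      exact (Nat.mod_lt _ two_pos).trans_le (by omega)
    · simp [h1]
      exact (Nat.div_le_self _ _).trans_lt hlt
    · simp [h1, pow_succ, Nat.div_div_eq_div_mul]
    · simp only [WExpr.val_mod, WExpr.val_get, WExpr.val_const, WExpr.val_ofNat, h1, h56,
        State.writeW_word, h2]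
      simp only [Nat.reduceEqDiff, false_and, if_false, true_and]
      by_cases hb : b = k
      · simp [hb, bit]
      · rw [if_neg hb]
        exact if_congr (by omega) rfl rfl
  · rintro s' ⟨-, h2⟩ - -
    exact h2

-- One pass over the coefficients both evaluates and differentiates: round `k` uses coefficient `k`
-- for the value and then overwrites it with `k + 1` times coefficient `k + 1`. The cells from `w`
-- on are never written, so the coefficient read beyond the end remains correct.
open Polynomial in
theorem runs_evalProg {w q y r : ℕ} (hw1 : 1 ≤ w) (hq : 2 ≤ q) (hw : s.word 10 0 = w) (hq' : s.word 11 0 = q)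
    (hy : s.word 54 0 = y) (hr : s.word 58 0 = r) (f : (ZMod q)[X])
    (hf : ∀ b, (s.word 57 b : ZMod q) = f.coeff b) (hfw : ∀ b, w ≤ b → f.coeff b = 0)
    (hB : r * q + q + w < 2 ^ B)
    (hQ : ∀ s', s'.word 58 0 = r * q + (f.eval (y : ZMod q)).val →
      (∀ b, (s'.word 57 b : ZMod q) = (derivative f).coeff b) →
      (∀ b, w ≤ b → s'.word 57 b = s.word 57 b) → Frame evalProg s s' → Q s') :
    Runs B (w * 5 + 5) evalProg s Q := by
  have : NeZero q := ⟨by omega⟩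
  refine (Runs.frame (Q := fun s' => s'.word 58 0 = r * q + (f.eval (y : ZMod q)).val ∧
      (∀ b, (s'.word 57 b : ZMod q) = (derivative f).coeff b) ∧
      (∀ b, w ≤ b → s'.word 57 b = s.word 57 b)) ?_).mono le_rfl
    fun s' h => hQ s' h.1.1 h.1.2.1 h.1.2.2 h.2
  refine Runs.setW_seq (N := w * 5 + 4) (by simp) ?_
  refine Runs.setW_seq (N := w * 5 + 3) (by simp only [WExpr.val_ofNat]; omega) ?_
  set s₁ := (s.writeW 60 _ _).writeW 61 _ _ with hs₁
  have h10 : s₁.word 10 0 = w := by simp [hs₁, hw]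
  have h11 : s₁.word 11 0 = q := by simp [hs₁, hq']
  have h54 : s₁.word 54 0 = y := by simp [hs₁, hy]
  have h57 : s₁.word 57 = s.word 57 := by simp [hs₁, State.writeW_array]
  have h58 : s₁.word 58 0 = r := by simp [hs₁, hr]
  have h60 : s₁.word 60 0 = 0 := by simp [hs₁]
  have h61 : s₁.word 61 0 = 1 := by simp [hs₁]
  clear_value s₁
  refine Runs.seq (N' := 1) (Runs.forTo (n := w) (Nb := 3) (fun k s' => s'.word 60 0 < q ∧
    (s'.word 60 0 : ZMod q) = ∑ b ∈ Finset.range k, f.coeff b * (y : ZMod q) ^ b ∧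
    (s'.word 61 0 : ZMod q) = (y : ZMod q) ^ k ∧
    (∀ b, (s'.word 57 b : ZMod q) = if b < k then (derivative f).coeff b else f.coeff b) ∧
    (∀ b, w ≤ b → s'.word 57 b = s.word 57 b)) h10 (by omega) ?_ ?_ ?_)
  · simp [h60, h61, h57, hf]; omega
  · rintro k s' hk ⟨k1, k2, k3, k4, k5⟩ h62 hF
    have h11' : s'.word 11 0 = q := by rw [hF.word 11 rfl, h11]
    have h54' : s'.word 54 0 = y := by rw [hF.word 54 rfl, h54]
    have hlt : ∀ x, x % q < 2 ^ B := fun x => (Nat.mod_lt x (by omega)).trans_le (by omega)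
    have hc := k4 k
    rw [if_neg (lt_irrefl k)] at hc
    refine Runs.setW_seq ?_ (Runs.setW_seq ?_ (Runs.setW ?_ ⟨?_, ?_, ?_, fun b => ?_, fun b hb => ?_⟩))
    · simpa [h11'] using hlt _
    · simpa [h11'] using hlt _
    · simpa [h11'] using hlt _
    · simp [h11']
      exact Nat.mod_lt _ (by omega)
    · simp [h11', h62, Finset.sum_range_succ, k2, k3, hc]
    · simp [h11', h54', pow_succ, k3]
    · simp only [WExpr.val_mod, WExpr.val_mul, WExpr.val_add, WExpr.val_get, WExpr.val_const,
        WExpr.val_ofNat, h62, State.writeW_word, h11']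
      simp only [Nat.reduceEqDiff, false_and, if_false, true_and]
      by_cases hb : b = k
      -- Cell `k + 1` has not been overwritten yet and still holds a coefficient of `f`.
      · have := k4 (k + 1)
        rw [if_neg (by omega)] at this
        simp [hb, this, coeff_derivative, mul_comm]
      · rw [if_neg hb, k4]
        exact if_congr (by omega) rfl rfl
    · have : b ≠ k := by omega
      simp [h62, this, k5 b hb]
  · rintro s' ⟨k1, k2, k3, k4, k5⟩ _ hF
    have h11' : s'.word 11 0 = q := by rw [hF.word 11 rfl, h11]
    have h58' : s'.word 58 0 = r := by rw [hF.word 58 rfl, h58]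
    have hev : (f.eval (y : ZMod q)).val = s'.word 60 0 := by
      have hdeg : f.natDegree ≤ w - 1 :=
        natDegree_le_iff_coeff_eq_zero.2 fun b hb => hfw b (by omega)
      rw [eval_eq_sum_range' (n := w) (by omega), ← k2, ZMod.val_natCast_of_lt k1]
    refine Runs.setW ?_ ⟨?_, ?_, ?_⟩
    · simp [h58', h11']; omega
    · simp [h58', h11', hev]
    · intro b
      have := k4 b
      simp only [State.writeW_word, Nat.reduceEqDiff, false_and, if_false, this]
      split_ifs with hb
      · rfl
      · rw [coeff_derivative, hfw b (by omega), hfw (b + 1) (by omega), zero_mul]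
    · intro b hb
      simpa using k5 b hb

open Polynomial in
theorem runs_vertexProg {w q l j y : ℕ} (hw1 : 1 ≤ w) (hq : 2 ≤ q) (hw : s.word 10 0 = w)
    (hq' : s.word 11 0 = q) (hl : s.word 12 0 = l) (hj : s.word 53 0 = j) (hy : s.word 54 0 = y)
    (hyq : y < q) (h57 : ∀ b, w ≤ b → s.word 57 b = 0) (hB : q ^ (l + 1) + q + w + j + 2 < 2 ^ B)
    (hQ : ∀ s', s'.word 58 0 = vertex q w j y l → (∀ b, w ≤ b → s'.word 57 b = 0) →
      Frame vertexProg s s' → Q s') :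
    Runs B (w * 4 + 3 + (l * (w * 5 + 7) + 3)) vertexProg s Q := by
  refine (Runs.frame (Q := fun s' => s'.word 58 0 = vertex q w j y l ∧
    (∀ b, w ≤ b → s'.word 57 b = 0)) ?_).mono le_rfl fun s' h => hQ s' h.1.1 h.1.2 h.2
  refine Runs.seq (runs_digitsProg hj hw (by omega) fun s₁ k1 hF => ?_)
  have h54 : s₁.word 54 0 = y := by rw [hF.word 54 rfl, hy]
  have h10 : s₁.word 10 0 = w := by rw [hF.word 10 rfl, hw]
  have h11 : s₁.word 11 0 = q := by rw [hF.word 11 rfl, hq']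
  have h12 : s₁.word 12 0 = l := by rw [hF.word 12 rfl, hl]
  have hll : l < q ^ (l + 1) := (Nat.lt_pow_self hq).trans (Nat.pow_lt_pow_right hq (by omega))
  refine Runs.setW_seq (by simp [h54]; omega) ?_
  refine Runs.forTo (n := l) (Nb := w * 5 + 5) (fun k s' => s'.word 58 0 = vertex q w j y k ∧
    (∀ b, (s'.word 57 b : ZMod q) = (derivative^[k] (digitPoly q w j)).coeff b) ∧
    (∀ b, w ≤ b → s'.word 57 b = 0)) (by simpa using h12) (by omega) ?_ ?_ ?_
  · refine ⟨by simp [h54, vertex], fun b => ?_, fun b hb => ?_⟩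
    · simp only [State.writeW_word, Nat.reduceEqDiff, false_and, if_false, k1,
        Function.iterate_zero, id, coeff_digitPoly]
      split_ifs with hb
      · rfl
      · simp [h57 b (by omega)]
    · simp [k1, h57 b hb, hb]
  · rintro k s' hk ⟨h1, h2, h3⟩ - hF'
    refine runs_evalProg (q := q) (y := y) (r := vertex q w j y k) hw1 hq
      (by rw [hF'.word 10 rfl]; simpa using h10) (by rw [hF'.word 11 rfl]; simpa using h11)
      (by rw [hF'.word 54 rfl]; simpa using h54) h1 _ h2 ?_ ?_ ?_
    · intro b hb
      rw [coeff_iterate_derivative, coeff_digitPoly, if_neg (by omega), smul_zero]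
    -- The next prefix of the vertex is below `q ^ (k + 2)`, hence at most `q ^ (l + 1)` bounds the
    -- words of all rounds.
    · have h4 := vertex_lt (w := w) (j := j) (by omega : 0 < q) hyq k
      have h5 : q ^ (k + 2) ≤ q ^ (l + 1) := Nat.pow_le_pow_right (by omega) (by omega)
      have h6 : (vertex q w j y k + 1) * q ≤ q ^ (k + 2) := by
        rw [pow_succ _ (k + 1)]
        exact Nat.mul_le_mul_right _ h4
      rw [add_mul, one_mul] at h6
      omega
    · intro s'' g1 g2 g3 _
      refine ⟨by simpa [vertex] using g1, fun b => ?_, fun b hb => ?_⟩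
      · rw [Function.iterate_succ_apply', ← g2 b]
        simp
      · simp [g3 b hb, h3 b hb]
  · rintro s' ⟨h1, -, h3⟩ - -
    exact ⟨h1, h3⟩

/-- The row of the entry number `b` in the block of column `j` at the point `y`. -/
noncomputable def row (q w l j y b : ℕ) : ℕ := (vertex q w j y l * w + b) * 2 + bit j b

/-- The word at address `A` of the table of column lists. -/
noncomputable def entry (q w l A : ℕ) : ℕ :=
  if A % (q * w + 1) = 0 then q * w
  else row q w l (A / (q * w + 1)) ((A % (q * w + 1) - 1) / w) ((A % (q * w + 1) - 1) % w)

theorem addr_lt {q w y b : ℕ} (hy : y < q) (hb : b < w) : y * w + b < q * w := by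
  have : (y + 1) * w ≤ q * w := Nat.mul_le_mul_right _ hy
  rw [add_mul] at this
  omega

theorem addr_mod {q w j y b : ℕ} (hy : y < q) (hb : b < w) :
    (j * (q * w + 1) + 1 + y * w + b) % (q * w + 1) = y * w + b + 1 := by
  have := addr_lt hy hb
  rw [show j * (q * w + 1) + 1 + y * w + b = (y * w + b + 1) + (q * w + 1) * j by ring,
    Nat.add_mul_mod_self_left, Nat.mod_eq_of_lt (by omega)]

theorem entry_head (q w l j : ℕ) : entry q w l (j * (q * w + 1)) = q * w := by
  simp [entry]

theorem entry_eq {q w l j y b : ℕ} (hy : y < q) (hb : b < w) :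
    entry q w l (j * (q * w + 1) + 1 + y * w + b) = row q w l j y b := by
  have := addr_lt hy hb
  have hd : (j * (q * w + 1) + 1 + y * w + b) / (q * w + 1) = j := by
    rw [show j * (q * w + 1) + 1 + y * w + b = (y * w + b + 1) + (q * w + 1) * j by ring,
      Nat.add_mul_div_left _ _ (by omega), Nat.div_eq_of_lt (by omega), zero_add]
  rw [entry, addr_mod hy hb, if_neg (by omega), hd, Nat.add_sub_cancel, mul_comm y w,
    Nat.mul_add_div (by omega), Nat.div_eq_of_lt hb, Nat.mul_add_mod, Nat.mod_eq_of_lt hb, add_zero]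

theorem row_lt {q w l j y b : ℕ} (hy : y < q) (hb : b < w) :
    row q w l j y b < q ^ (l + 1) * w * 2 := by
  have h1 := addr_lt (vertex_lt (w := w) (j := j) (by omega : 0 < q) hy l) hb
  have h2 := bit_lt_two j b
  rw [row]
  omega

/-- The table of column lists is correct below the address `A`. -/
def TableBelow (q w l A : ℕ) (s : State R) : Prop :=
  ∀ A' < A, s.word 2 A' = entry q w l A' ∧ (A' % (q * w + 1) ≠ 0 → s.ring 2 A' = 1)

theorem runs_entryProg {w q l j y : ℕ} (hw : s.word 10 0 = w)
    (hq' : s.word 11 0 = q) (hj : s.word 53 0 = j) (hy : s.word 54 0 = y)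
    (hr : s.word 58 0 = vertex q w j y l) (hyq : y < q)
    (hB : j + w + q ^ (l + 1) * w * 2 < 2 ^ B) (hT : TableBelow q w l (j * (q * w + 1) + 1 + y * w) s)
    (hQ : ∀ s', TableBelow q w l (j * (q * w + 1) + 1 + (y + 1) * w) s' →
      Frame entryProg s s' → Q s') :
    Runs B (w * 5 + 3) entryProg s Q := by
  refine (Runs.frame (Q := TableBelow q w l (j * (q * w + 1) + 1 + (y + 1) * w)) ?_).mono
    le_rfl fun s' h => hQ s' h.1 h.2
  refine Runs.setW_seq (N := w * 5 + 2) (by simp [hj]; omega) ?_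
  refine Runs.forTo (n := w) (Nb := 3) (fun k s' => s'.word 55 0 = j / 2 ^ k ∧
    TableBelow q w l (j * (q * w + 1) + 1 + y * w + k) s') (by simpa using hw) (by omega)
    ?_ ?_ ?_
  · exact ⟨by simp [hj], fun A hA => by simpa using hT A hA⟩
  · rintro k s' hk ⟨h1, h2⟩ h63 hF
    have h10' : s'.word 10 0 = w := by rw [hF.word 10 rfl]; simpa using hw
    have h11' : s'.word 11 0 = q := by rw [hF.word 11 rfl]; simpa using hq'
    have h53' : s'.word 53 0 = j := by rw [hF.word 53 rfl]; simpa using hj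
    have h54' : s'.word 54 0 = y := by rw [hF.word 54 rfl]; simpa using hy
    have h58' : s'.word 58 0 = vertex q w j y l := by rw [hF.word 58 rfl]; simpa using hr
    have haddr : entryAddr.val s' = j * (q * w + 1) + 1 + y * w + k := by
      simp [entryAddr, h10', h11', h53', h54', h63]
    have hval : ((.reg 58 * .reg 10 + .reg 63) * 2 + .reg 55 % 2 : WExpr).val s' =
        row q w l j y k := by
      simp [h58', h10', h63, h1, row, bit]
    have hlt : j / 2 ^ k < 2 ^ B := (Nat.div_le_self _ _).trans_lt (by omega)
    refine Runs.setW_seq ?_ (Runs.setR_seq (Runs.setW ?_ ⟨?_, ?_⟩))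
    · rw [hval]
      exact (row_lt hyq hk).trans (by omega)
    · simp [h1]
      exact (Nat.div_le_self _ _).trans_lt hlt
    · simp [h1, pow_succ, Nat.div_div_eq_div_mul]
    · have haddr' : entryAddr.val (s'.writeW 2 (entryAddr.val s')
          (((.reg 58 * .reg 10 + .reg 63) * 2 + .reg 55 % 2 : WExpr).val s')) =
          j * (q * w + 1) + 1 + y * w + k := by
        simp [entryAddr, h10', h11', h53', h54', h63]
      rw [haddr', haddr, hval]
      intro A hA
      simp only [State.writeW_word, State.writeW_ring, State.writeR_word, State.writeR_ring]
      simp only [Nat.reduceEqDiff, false_and, if_false, true_and]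
      by_cases hAk : A = j * (q * w + 1) + 1 + y * w + k
      · rw [if_pos hAk, if_pos hAk, hAk, entry_eq hyq hk]
        exact ⟨rfl, fun _ => rfl⟩
      · rw [if_neg hAk, if_neg hAk]
        exact h2 A (by omega)
  · rintro s' ⟨-, h2⟩ - -
    convert h2 using 1
    ring

theorem runs_tableProg {n w q l : ℕ} (hw1 : 1 ≤ w) (hq : 2 ≤ q) (hn : s.word 0 0 = n)
    (hw : s.word 10 0 = w) (hq' : s.word 11 0 = q) (hl : s.word 12 0 = l)
    (h57 : ∀ b, s.word 57 b = 0)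
    (hB : n * (q * w + 1) + q ^ (l + 1) * w * 2 + q * w + q + w + n + 2 < 2 ^ B)
    (hQ : ∀ s', (∀ j < n, s'.word 1 j = j * (q * w + 1)) →
      TableBelow q w l (n * (q * w + 1)) s' → Frame tableProg s s' → Q s') :
    Runs B (n * (q * (w * 9 + l * (w * 5 + 7) + 11) + 6) + 2) tableProg s Q := by
  refine (Runs.frame (Q := fun s' => (∀ j < n, s'.word 1 j = j * (q * w + 1)) ∧
    TableBelow q w l (n * (q * w + 1)) s') ?_).mono le_rfl fun s' h => hQ s' h.1.1 h.1.2 h.2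
  refine Runs.forTo (n := n) (Nb := q * (w * 9 + l * (w * 5 + 7) + 11) + 4) (fun k s' =>
    (∀ j < k, s'.word 1 j = j * (q * w + 1)) ∧ TableBelow q w l (k * (q * w + 1)) s' ∧
    ∀ b, w ≤ b → s'.word 57 b = 0) hn (by omega) ?_ ?_ ?_
  · exact ⟨by simp, fun A hA => by simp at hA, fun b _ => by simp [h57]⟩
  · rintro j s₁ hj ⟨h1, h2, h3⟩ h53 hF
    have h10 : s₁.word 10 0 = w := by rw [hF.word 10 rfl, hw]
    have h11 : s₁.word 11 0 = q := by rw [hF.word 11 rfl, hq']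
    have h12 : s₁.word 12 0 = l := by rw [hF.word 12 rfl, hl]
    have hjn : (j + 1) * (q * w + 1) ≤ n * (q * w + 1) := Nat.mul_le_mul_right _ hj
    rw [add_mul, one_mul] at hjn
    refine Runs.setW_seq (N := q * (w * 9 + l * (w * 5 + 7) + 11) + 3) ?_
      (Runs.setW_seq (N := q * (w * 9 + l * (w * 5 + 7) + 11) + 2) ?_ ?_)
    · simp only [WExpr.val_mul, WExpr.val_get, WExpr.val_const, WExpr.val_add, WExpr.val_ofNat, h10,
        h11, h53]
      omega
    · simp [h10, h11]; omega
    set s₂ := (s₁.writeW 1 _ _).writeW 2 _ _ with hs₂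
    have g10 : s₂.word 10 0 = w := by simp [hs₂, h10]
    have g11 : s₂.word 11 0 = q := by simp [hs₂, h11]
    have g12 : s₂.word 12 0 = l := by simp [hs₂, h12]
    have g53 : s₂.word 53 0 = j := by simp [hs₂, h53]
    have g57 : s₂.word 57 = s₁.word 57 := by simp [hs₂, State.writeW_array]
    have g1 : ∀ i < j + 1, s₂.word 1 i = i * (q * w + 1) := by
      intro i hi
      by_cases hij : i = j
      · simp [hs₂, h53, hij, h10, h11]
      · simp [hs₂, h53, hij, h1 i (by omega)]
    -- The header cell holds the length `q * w` of the column list. Its ring part is left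
    -- unspecified by `TableBelow`.
    have g2 : TableBelow q w l (j * (q * w + 1) + 1 + 0 * w) s₂ := by
      intro A hA
      by_cases hAj : A = j * (q * w + 1)
      · subst hAj
        rw [entry_head]
        simp [hs₂, h53, h10, h11]
      · have := h2 A (by omega)
        simpa [hs₂, h53, h10, h11, hAj] using this
    clear_value s₂
    refine Runs.forTo (n := q) (Nb := w * 4 + 3 + (l * (w * 5 + 7) + 3) + (w * 5 + 3))
      (fun y s' => TableBelow q w l (j * (q * w + 1) + 1 + y * w) s' ∧
        ∀ b, w ≤ b → s'.word 57 b = 0) g11 (by omega) ?_ ?_ ?_ |>.le (le_of_eq (by ring))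
    · exact ⟨fun A hA => by simpa using g2 A hA, fun b hb => by simp [g57, h3 b hb]⟩
    · rintro y s₃ hy ⟨k1, k2⟩ h54 hF
      have e10 : s₃.word 10 0 = w := by rw [hF.word 10 rfl, g10]
      have e11 : s₃.word 11 0 = q := by rw [hF.word 11 rfl, g11]
      have e12 : s₃.word 12 0 = l := by rw [hF.word 12 rfl, g12]
      have e53 : s₃.word 53 0 = j := by rw [hF.word 53 rfl, g53]
      have hpw : q ^ (l + 1) ≤ q ^ (l + 1) * w * 2 := by nlinarith [Nat.zero_le (q ^ (l + 1))]
      refine Runs.seq (runs_vertexProg hw1 hq e10 e11 e12 e53 h54 hy k2 (by omega)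
        fun s₄ f1 f2 hF' => ?_)
      refine runs_entryProg (j := j) (y := y) (l := l) (by rw [hF'.word 10 rfl, e10])
        (by rw [hF'.word 11 rfl, e11]) (by rw [hF'.word 53 rfl, e53])
        (by rw [hF'.word 54 rfl, h54]) f1 hy (by omega) ?_ fun s₅ f3 hF'' => ⟨?_, fun b hb => ?_⟩
      · intro A hA
        rw [hF'.word 2 rfl, hF'.ring 2 rfl]
        exact k1 A hA
      · exact fun A hA => by simpa using f3 A hA
      · simp [hF''.word 57 rfl, f2 b hb]
    · rintro s₃ ⟨k1, k2⟩ - hF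
      refine ⟨fun i hi => ?_, fun A hA => ?_, fun b hb => ?_⟩
      · simp [hF.word 1 rfl, g1 i hi]
      · simpa using k1 A (by rw [add_mul] at hA; omega)
      · simp [k2 b hb]
  · rintro s' ⟨h1, h2, -⟩ - -
    exact ⟨h1, h2⟩

end CompressedSensing

/-! ### The measurement matrix in memory, and its product with a sparse vector. -/

namespace CompressedSensing

open RingRAM

section

variable {R : Type*} [Ring R]

/-! ### Sparse representations -/

/-- An injective enumeration of the support by `N` positions yields both the equivalence that
`HoldsSparse` asks for and the equality of `N` with the number of nonzero entries. -/
theorem holdsSparse_of {s : State R} {a p n : ℕ} {x : Fin n → R} (N : ℕ) (f : ℕ → ℕ)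
    (hf : ∀ k < N, ∃ h : f k < n, x ⟨f k, h⟩ ≠ 0)
    (hinj : ∀ k < N, ∀ k' < N, f k = f k' → k = k')
    (hsurj : ∀ i : Fin n, x i ≠ 0 → ∃ k < N, f k = i) (hp : s.word a p = N)
    (hw : ∀ k < N, s.word a (p + 1 + k) = f k)
    (hr : ∀ k < N, ∀ h : f k < n, s.ring a (p + 1 + k) = x ⟨f k, h⟩) :
    HoldsSparse s a p x := by
  let g : Fin N → {i : Fin n // x i ≠ 0} := fun k => ⟨⟨f k, (hf k k.2).1⟩, (hf k k.2).2⟩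
  have hg : Function.Bijective g := by
    constructor
    · intro k k' h
      have := congrArg (fun i => (i.1 : ℕ)) h
      exact Fin.ext (hinj k k.2 k' k'.2 this)
    · rintro ⟨i, hi⟩
      obtain ⟨k, hk, h⟩ := hsurj i hi
      exact ⟨⟨k, hk⟩, Subtype.ext (Fin.ext h)⟩
  have hN : nnz x = N := by
    have h1 : nnz x = Nat.card {i : Fin n // x i ≠ 0} := rfl
    rw [h1, ← Nat.card_congr (Equiv.ofBijective g hg), Nat.card_fin]
  refine ⟨hp.trans hN.symm, (finCongr hN).trans (Equiv.ofBijective g hg), fun k => ?_⟩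
  have hk : (k : ℕ) < N := hN ▸ k.2
  exact ⟨hw k hk, hr k hk _⟩

theorem HoldsSparse.eq_of_ne_zero {s : State R} {a p n : ℕ} {x x' : Fin n → R}
    (h : HoldsSparse s a p x) (h' : HoldsSparse s a p x') {i : Fin n} (hi : x i ≠ 0) :
    x' i = x i := by
  obtain ⟨hN, e, he⟩ := h
  obtain ⟨hN', e', he'⟩ := h'
  obtain ⟨k, hk⟩ := e.surjective ⟨i, hi⟩
  have hlt : (k : ℕ) < nnz x' := by rw [← hN', hN]; exact k.2
  have h1 := he k
  have h2 := he' ⟨k, hlt⟩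
  rw [hk] at h1
  simp only at h2
  have h3 : (e' ⟨k, hlt⟩).1 = i := Fin.ext (h2.1.symm.trans h1.1)
  rw [← h3, ← h2.2, h1.2, h3]

theorem HoldsSparse.unique {s : State R} {a p n : ℕ} {x x' : Fin n → R}
    (h : HoldsSparse s a p x) (h' : HoldsSparse s a p x') : x = x' := by
  funext i
  by_cases hi : x i = 0
  · by_cases hi' : x' i = 0
    · rw [hi, hi']
    · exact h'.eq_of_ne_zero h hi'
  · exact (h.eq_of_ne_zero h' hi).symm

/-- The main theorem speaks of every matrix that the final memory represents; by uniqueness it is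
enough to treat `mat`. -/
theorem HoldsMatrix.unique {s : State R} {m n : ℕ} {H H' : Matrix (Fin m) (Fin n) R}
    (h : HoldsMatrix s H) (h' : HoldsMatrix s H') : H = H' := by
  ext i j
  exact congrFun ((h j).unique (h' j)) i

theorem nnz_le {n : ℕ} (x : Fin n → R) : nnz x ≤ n := by
  have := Set.ncard_le_ncard (Set.subset_univ {i : Fin n | x i ≠ 0})
  rwa [Set.ncard_univ, Nat.card_fin] at this

/-! ### The measurement matrix -/

/-- The row of entry number `k` of column `j`. -/
noncomputable def rowAt (q w l j k : ℕ) : ℕ := row q w l j (k / w) (k % w)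

theorem row_div {q w l j y b : ℕ} (hb : b < w) :
    row q w l j y b / (2 * w) = vertex q w j y l := by
  have h1 := bit_lt_two j b
  rw [row, ← Nat.div_div_eq_div_mul, mul_comm _ 2, Nat.mul_add_div two_pos, Nat.div_eq_of_lt h1,
    add_zero, mul_comm _ w, Nat.mul_add_div (by omega), Nat.div_eq_of_lt hb, add_zero]

/-- Division by `2 * w` recovers the vertex, whose first coordinate is the point `y`. For equal
vertices, the position of the row inside the block gives the digit position. -/
theorem row_injective {q w l j y b y' b' : ℕ} (hq : 0 < q) (hb : b < w) (hb' : b' < w)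
    (h : row q w l j y b = row q w l j y' b') : y = y' ∧ b = b' := by
  have h1 := congrArg (· / (2 * w)) h
  simp only [row_div hb, row_div hb'] at h1
  obtain ⟨rfl, -⟩ := vertex_eq hq h1
  refine ⟨rfl, ?_⟩
  simp only [row] at h
  have := bit_lt_two j b
  have := bit_lt_two j b'
  omega

theorem rowAt_add {q w l j y b : ℕ} (hb : b < w) : rowAt q w l j (y * w + b) = row q w l j y b := by
  rw [rowAt, mul_comm, Nat.mul_add_div (by omega), Nat.div_eq_of_lt hb, Nat.mul_add_mod,
    Nat.mod_eq_of_lt hb, add_zero]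

theorem rowAt_injective {q w l j k k' : ℕ} (hw : 0 < w) (hk : k < q * w)
    (h : rowAt q w l j k = rowAt q w l j k') : k = k' := by
  have hq : 0 < q := by
    rcases Nat.eq_zero_or_pos q with rfl | h
    · simp at hk
    · exact h
  obtain ⟨h1, h2⟩ := row_injective hq (Nat.mod_lt _ hw) (Nat.mod_lt _ hw) h
  rw [← Nat.div_add_mod k w, ← Nat.div_add_mod k' w, h1, h2]

theorem rowAt_lt {q w l j k : ℕ} (hk : k < q * w) : rowAt q w l j k < q ^ (l + 1) * w * 2 := by
  have hw : 0 < w := by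
    rcases Nat.eq_zero_or_pos w with rfl | h
    · simp at hk
    · exact h
  exact row_lt (Nat.div_lt_of_lt_mul (by rwa [mul_comm])) (Nat.mod_lt _ hw)

/-- Column `j` has a non-zero entry in row `i`. -/
def Hits (q w l j i : ℕ) : Prop := ∃ k < q * w, i = rowAt q w l j k

open Classical in
/-- The measurement matrix. -/
noncomputable def mat (R : Type*) [Ring R] (q w l m n : ℕ) : Matrix (Fin m) (Fin n) R :=
  fun i j => if Hits q w l j i then 1 else 0

open Classical in
theorem mat_mulVec {q w l m n : ℕ} (x : Fin n → R) (i : Fin m) :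
    (mat R q w l m n).mulVec x i = ∑ j : Fin n, if Hits q w l j i then x j else 0 := by
  simp [Matrix.mulVec, dotProduct, mat]

/-- The memory holds the parameters and the table of column lists. -/
structure Table (n q w l : ℕ) (s : State R) : Prop where
  hn : s.word 0 0 = n
  hw : s.word 10 0 = w
  hq : s.word 11 0 = q
  hv : s.word 13 0 = q ^ (l + 1)
  ptr : ∀ j < n, s.word 1 j = j * (q * w + 1)
  tab : TableBelow q w l (n * (q * w + 1)) s

theorem Table.congr {n q w l : ℕ} {s s' : State R} (h : Table n q w l s)
    (h0 : s'.word 0 = s.word 0) (h10 : s'.word 10 = s.word 10) (h11 : s'.word 11 = s.word 11)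
    (h13 : s'.word 13 = s.word 13) (h1 : s'.word 1 = s.word 1) (h2 : s'.word 2 = s.word 2)
    (hr : s'.ring 2 = s.ring 2) : Table n q w l s' := by
  obtain ⟨k1, k2, k3, k4, k5, k6⟩ := h
  refine ⟨h0 ▸ k1, h10 ▸ k2, h11 ▸ k3, h13 ▸ k4, h1 ▸ k5, fun A hA => ?_⟩
  rw [h2, hr]
  exact k6 A hA

theorem Table.frame {n q w l : ℕ} {s s' : State R} {P : Prog} (h : Table n q w l s)
    (hF : Frame P s s') (h0 : P.writesW 0 = false := by rfl) (h10 : P.writesW 10 = false := by rfl)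
    (h11 : P.writesW 11 = false := by rfl) (h13 : P.writesW 13 = false := by rfl)
    (h1 : P.writesW 1 = false := by rfl) (h2 : P.writesW 2 = false := by rfl)
    (hr : P.writesR 2 = false := by rfl) : Table n q w l s' :=
  h.congr (hF.word _ h0) (hF.word _ h10) (hF.word _ h11) (hF.word _ h13) (hF.word _ h1)
    (hF.word _ h2) (hF.ring _ hr)

theorem Table.agreesOff {n q w l a : ℕ} {s s' : State R} (h : Table n q w l s)
    (hs : AgreesOff a s s') (ha : a ≠ 0 ∧ a ≠ 1 ∧ a ≠ 2 ∧ a ≠ 10 ∧ a ≠ 11 ∧ a ≠ 13) :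
    Table n q w l s' :=
  h.congr (hs _ ha.1.symm).1 (hs _ ha.2.2.2.1.symm).1 (hs _ ha.2.2.2.2.1.symm).1
    (hs _ ha.2.2.2.2.2.symm).1 (hs _ ha.2.1.symm).1 (hs _ ha.2.2.1.symm).1 (hs _ ha.2.2.1.symm).2

theorem Table.head {n q w l : ℕ} {s : State R} (h : Table n q w l s) {j : ℕ} (hj : j < n) :
    s.word 2 (j * (q * w + 1)) = q * w := by
  exact (h.tab _ (Nat.mul_lt_mul_of_pos_right hj (by omega))).1.trans (entry_head q w l j)

theorem Table.read {n q w l : ℕ} {s : State R} (h : Table n q w l s) {j y b : ℕ} (hj : j < n)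
    (hy : y < q) (hb : b < w) :
    s.word 2 (j * (q * w + 1) + 1 + y * w + b) = row q w l j y b ∧
      s.ring 2 (j * (q * w + 1) + 1 + y * w + b) = 1 := by
  have h1 : (j + 1) * (q * w + 1) ≤ n * (q * w + 1) := Nat.mul_le_mul_right _ hj
  rw [add_mul, one_mul] at h1
  have h2 := addr_lt hy hb
  have h3 := h.tab (j * (q * w + 1) + 1 + y * w + b) (by omega)
  rw [entry_eq hy hb, addr_mod hy hb] at h3
  exact ⟨h3.1, h3.2 (by omega)⟩

theorem Table.readAt {n q w l : ℕ} {s : State R} (h : Table n q w l s) {j k : ℕ} (hj : j < n)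
    (hk : k < q * w) :
    s.word 2 (j * (q * w + 1) + 1 + k) = rowAt q w l j k ∧
      s.ring 2 (j * (q * w + 1) + 1 + k) = 1 := by
  have hw : 0 < w := by
    rcases Nat.eq_zero_or_pos w with rfl | h
    · simp at hk
    · exact h
  have := h.read hj (Nat.div_lt_of_lt_mul (by rwa [mul_comm] : k < w * q)) (Nat.mod_lt k hw)
  rwa [add_assoc, mul_comm (k / w), Nat.div_add_mod] at this

/-- Since `1 ≠ 0`, all `q * w` listed entries are truly nonzero, as the sparse representation
demands. The matrix may have more rows than the blocks use; the additional rows are zero. -/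
theorem Table.holdsMatrix [Nontrivial R] {n q w l m : ℕ} {s : State R} (h : Table n q w l s)
    (hw : 0 < w) (hm : q ^ (l + 1) * w * 2 ≤ m) : HoldsMatrix s (mat R q w l m n) := by
  intro j
  rw [h.ptr j j.2]
  refine holdsSparse_of (q * w) (rowAt q w l j) (fun k hk => ?_)
    (fun k hk k' _ he => rowAt_injective hw hk he) (fun i hi => ?_) (h.head j.2)
    (fun k hk => (h.readAt j.2 hk).1) fun k hk hlt => ?_
  · refine ⟨(rowAt_lt hk).trans_le hm, ?_⟩
    simp only [mat]
    rw [if_pos ⟨k, hk, rfl⟩]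
    exact one_ne_zero
  · by_contra hne
    push Not at hne
    refine hi (if_neg ?_)
    rintro ⟨k, hk, he⟩
    exact hne k hk he.symm
  · rw [(h.readAt j.2 hk).2, mat, if_pos ⟨k, hk, rfl⟩]

/-! ### Multiplication by a sparse vector -/

/-- Adds to array 4 the multiple of a column by the ring element in cell `k + 1` of array 5, where
`k` is in register 81 and the address of the column is in register 83. -/
def addProg : Prog :=
  .forTo 85 84 (.setR 4 (.get 2 (.reg 83 + 1 + .reg 85))
    (.add (.get 4 (.get 2 (.reg 83 + 1 + .reg 85))) (.get 5 (.reg 81 + 1))))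

/-- Multiplies the measurement matrix by the sparse vector in array 5. -/
def mulProg : Prog :=
  .setReg 80 (.get 5 0) ;;
  .forTo 81 80 (
    .setReg 82 (.get 5 (.reg 81 + 1)) ;; .setReg 83 (.get 1 (.reg 82)) ;;
    .setReg 84 (.get 2 (.reg 83)) ;; addProg)

open Classical in
theorem runs_addProg {B n q w l j k : ℕ} {s : State R} {Q : State R → Prop} (hs : Table n q w l s)
    (hw : 0 < w) (hj : j < n) (hk : s.word 81 0 = k) (hp : s.word 83 0 = j * (q * w + 1))
    (hc : s.word 84 0 = q * w) (hB : q * w < 2 ^ B)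
    (hQ : ∀ s', (∀ i, s'.ring 4 i = s.ring 4 i + if Hits q w l j i then s.ring 5 (k + 1) else 0) →
      Q s') :
    Runs B (q * w * 3 + 2) addProg s Q := by
  refine Runs.forTo (n := q * w) (Nb := 1) (fun a s' => ∀ i, s'.ring 4 i = s.ring 4 i +
    if ∃ k' < a, i = rowAt q w l j k' then s.ring 5 (k + 1) else 0) hc hB
    (fun i => by simp) ?_ ?_
  · rintro a s₄ ha hI' h85 hF'
    have f81 : s₄.word 81 0 = k := by rw [hF'.word 81 rfl, hk]
    have f83 : s₄.word 83 0 = j * (q * w + 1) := by rw [hF'.word 83 rfl, hp]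
    have fr5 : s₄.ring 5 = s.ring 5 := hF'.ring 5 rfl
    have hrow := ((hs.frame hF').readAt hj ha).1
    refine Runs.setR fun i => ?_
    simp only [WExpr.val_add, WExpr.val_get, WExpr.val_const, WExpr.val_ofNat, f83, h85, hrow,
      RExpr.val, State.writeW_ring, State.writeR_ring, f81, fr5, true_and]
    by_cases hi : i = rowAt q w l j a
    -- The rows of a column are distinct, so this row has not been incremented in an earlier round.
    · rw [if_pos hi, hI', if_neg, if_pos ⟨a, by omega, hi⟩, hi, add_zero]
      rintro ⟨k', hk', h⟩
      have := rowAt_injective hw ha h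
      omega
    · rw [if_neg hi, hI']
      congr 1
      refine if_congr ⟨fun ⟨k', h1, h2⟩ => ⟨k', by omega, h2⟩, ?_⟩ rfl rfl
      rintro ⟨k', h1, h2⟩
      refine ⟨k', ?_, h2⟩
      have : k' ≠ a := by rintro rfl; exact hi h2
      omega
  · rintro s₄ hI' - -
    exact hQ s₄ fun i => (hI' i).trans (by congr)

/-- Reading a cell of an input array: the bound on the word comes from what the array represents
instead of `Bounded`. -/
theorem _root_.RingRAM.Runs.setReg_get_seq {B N r a : ℕ} {e : WExpr} {P : Prog} {s : State R}
    {Q : State R → Prop} (hv : s.word a (e.val s) < 2 ^ B)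
    (hQ : Runs B N P (s.writeW r 0 (s.word a (e.val s))) Q) (he : e.safe = true := by rfl) :
    Runs B (N + 1) (.setReg r (.get a e) ;; P) s Q :=
  add_comm N 1 ▸ .seq (.setW' (N := 0) (fun hb => WExpr.reads_of_safe hb _ rfl)
    (fun hb => ⟨WExpr.reads_of_safe hb _ he, hv⟩) hv hQ)

open Classical in
theorem runs_mulProg {B n q w l m : ℕ} {s : State R} (hs : Table n q w l s) (hw : 0 < w)
    {x : Fin n → R} (hx : HoldsSparse s 5 0 x) (h4 : ∀ i, s.ring 4 i = 0)
    (hB : n * (q * w + 1) + q * w + n < 2 ^ B) :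
    Runs B (nnz x * (q * w * 3 + 7) + 3) mulProg s fun s' =>
      HoldsDense s' 4 ((mat R q w l m n).mulVec x) := by
  obtain ⟨hx0, e, he⟩ := hx
  have hxn := nnz_le x
  let idx : ℕ → ℕ := fun k => s.word 5 (0 + 1 + k)
  let v : ℕ → R := fun k => s.ring 5 (0 + 1 + k)
  have hidx : ∀ k < nnz x, idx k < n := by
    intro k hk
    have := (he ⟨k, hk⟩).1
    simp only at this
    simp only [idx, this]
    exact (e ⟨k, hk⟩).1.2
  refine Runs.setReg_get_seq (N := nnz x * (q * w * 3 + 7) + 2) ?_ ?_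
  · simp only [WExpr.val_ofNat, hx0]; omega
  set s₁ := s.writeW 80 _ _ with hs₁
  have hT₁ : Table n q w l s₁ := hs.congr (by simp [hs₁, State.writeW_array])
    (by simp [hs₁, State.writeW_array]) (by simp [hs₁, State.writeW_array])
    (by simp [hs₁, State.writeW_array]) (by simp [hs₁, State.writeW_array])
    (by simp [hs₁, State.writeW_array]) (by simp [hs₁])
  have h80 : s₁.word 80 0 = nnz x := by simp [hs₁, hx0]
  have h5 : s₁.word 5 = s.word 5 := by simp [hs₁, State.writeW_array]
  have hr : s₁.ring = s.ring := rfl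
  clear_value s₁
  refine Runs.forTo (n := nnz x) (Nb := q * w * 3 + 5) (fun k s' =>
    ∀ i, s'.ring 4 i = ∑ k' ∈ Finset.range k, if Hits q w l (idx k') i then v k' else 0)
    h80 (by omega) (fun i => by simp [hr, h4]) ?_ ?_
  · rintro k s₂ hk hI h81 hF
    have hT₂ := hT₁.frame hF
    have g5 : s₂.word 5 = s.word 5 := by rw [hF.word 5 rfl, h5]
    have gr5 : s₂.ring 5 = s.ring 5 := by rw [hF.ring 5 rfl, hr]
    have hj := hidx k hk
    have hidx' : s.word 5 (k + 1) = idx k := by simp only [idx]; congr 1; omega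
    have hv' : s.ring 5 (k + 1) = v k := by simp only [v]; congr 1; omega
    have hjn : (idx k + 1) * (q * w + 1) ≤ n * (q * w + 1) := Nat.mul_le_mul_right _ hj
    rw [add_mul, one_mul] at hjn
    refine Runs.setReg_get_seq (N := q * w * 3 + 4) ?_ ?_
    · simp only [WExpr.val_add, WExpr.val_get, WExpr.val_const, WExpr.val_ofNat, h81, g5, hidx']
      omega
    refine Runs.setW_seq (N := q * w * 3 + 3) ?_ (Runs.setW_seq (N := q * w * 3 + 2) ?_ ?_)
    · simp [h81, g5, hidx', hT₂.ptr _ hj]; omega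
    · simp [h81, g5, hidx', hT₂.ptr _ hj, hT₂.head hj]; omega
    set s₃ := ((s₂.writeW 82 _ _).writeW 83 _ _).writeW 84 _ _ with hs₃
    have hT₃ : Table n q w l s₃ := hT₂.congr (by simp [hs₃, State.writeW_array])
      (by simp [hs₃, State.writeW_array]) (by simp [hs₃, State.writeW_array])
      (by simp [hs₃, State.writeW_array]) (by simp [hs₃, State.writeW_array])
      (by simp [hs₃, State.writeW_array]) (by simp [hs₃])
    have e81 : s₃.word 81 0 = k := by simp [hs₃, h81]
    have e83 : s₃.word 83 0 = idx k * (q * w + 1) := by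
      simp [hs₃, h81, g5, hidx', hT₂.ptr _ hj]
    have e84 : s₃.word 84 0 = q * w := by
      simp [hs₃, h81, g5, hidx', hT₂.ptr _ hj, hT₂.head hj]
    have er : s₃.ring = s₂.ring := rfl
    clear_value s₃
    refine runs_addProg hT₃ hw hj e81 e83 e84 (by omega) fun s₄ hI' i => ?_
    rw [Finset.sum_range_succ, ← hI i, ← hv', ← gr5, ← er]
    exact hI' i
  · rintro s' hI - - i
    rw [hI, mat_mulVec, Finset.sum_range]
    have h1 : ∀ k : Fin (nnz x), (if Hits q w l (idx k) i then v k else 0) =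
        if Hits q w l ((e k).1 : ℕ) i then x (e k).1 else 0 := by
      intro k
      simp only [idx, v, (he k).1, (he k).2]
    -- The sum over list positions becomes a sum over the support through `e`; the remaining
    -- coordinates contribute zero.
    rw [Finset.sum_congr rfl fun k _ => h1 k,
      Equiv.sum_comp e fun j : {j : Fin n // x j ≠ 0} => if Hits q w l (j.1 : ℕ) i then x j.1 else 0,
      ← Finset.sum_subtype (Finset.univ.filter fun j => x j ≠ 0) (by simp)
        (fun j : Fin n => if Hits q w l j i then x j else 0), Finset.sum_filter]
    refine Finset.sum_congr rfl fun j _ => ?_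
    by_cases hj : x j = 0 <;> simp [hj]

end

end CompressedSensing

/-! ### Combinatorics of the majority decoder. -/

namespace CompressedSensing

section

variable {R : Type*} [Ring R]

/-! ### Votes -/

/-- The block `r` of `A` is `v` times the block of a column whose digits are those of `j`. -/
def Vote (w : ℕ) (A : ℕ → R) (j : ℕ) (v : R) (r : ℕ) : Prop :=
  ∀ b < w, A ((r * w + b) * 2 + bit j b) = v ∧ A ((r * w + b) * 2 + (1 - bit j b)) = 0

/-- The block `r` of `A` is not zero. -/
def Busy (w : ℕ) (A : ℕ → R) (r : ℕ) : Prop :=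
  ∃ b < w, ∃ c < 2, A ((r * w + b) * 2 + c) ≠ 0

open Classical in
/-- The number of non-zero blocks among the first `M`. -/
noncomputable def busyCount (w M : ℕ) (A : ℕ → R) : ℕ :=
  ((Finset.range M).filter (Busy w A)).card

open Classical in
/-- Subtract `v` times the column `j`. -/
noncomputable def subColumn (q w l : ℕ) (A : ℕ → R) (j : ℕ) (v : R) (i : ℕ) : R :=
  if Hits q w l j i then A i - v else A i

theorem block_inj {w r r' b b' c c' : ℕ} (hb : b < w) (hb' : b' < w) (hc : c < 2) (hc' : c' < 2)
    (h : (r * w + b) * 2 + c = (r' * w + b') * 2 + c') : r = r' ∧ b = b' ∧ c = c' := by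
  have h1 : r * w + b = r' * w + b' := by omega
  have h2 := congrArg (· / w) h1
  simp only [mul_comm _ w, Nat.mul_add_div (Nat.zero_lt_of_lt hb), Nat.div_eq_of_lt hb,
    Nat.div_eq_of_lt hb', add_zero] at h2
  subst h2
  omega

/-- A row number splits uniquely into block, digit position and digit. So a column meets exactly one
row of each pair in each block it is joined to. -/
theorem hits_iff {q w l j r b c : ℕ} (hb : b < w) (hc : c < 2) :
    Hits q w l j ((r * w + b) * 2 + c) ↔ (∃ y < q, vertex q w j y l = r) ∧ c = bit j b := by
  constructor
  · rintro ⟨k, hk, h⟩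
    rw [rowAt, row] at h
    obtain ⟨h1, h2, h3⟩ := block_inj hb (Nat.mod_lt k (by omega)) hc (bit_lt_two _ _) h
    refine ⟨⟨k / w, Nat.div_lt_of_lt_mul (by rwa [mul_comm]), h1.symm⟩, ?_⟩
    rw [h3, ← h2]
  · rintro ⟨⟨y, hy, rfl⟩, rfl⟩
    exact ⟨y * w + b, addr_lt hy hb, (rowAt_add hb).symm⟩

theorem hits_flip {q w l j r b : ℕ} (hb : b < w) :
    ¬ Hits q w l j ((r * w + b) * 2 + (1 - bit j b)) := by
  have := bit_lt_two j b
  rw [hits_iff hb (by omega)]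
  omega

theorem Vote.busy {w : ℕ} {A : ℕ → R} {j : ℕ} {v : R} {r : ℕ} (h : Vote w A j v r) (hw : 0 < w)
    (hv : v ≠ 0) : Busy w A r :=
  ⟨0, hw, bit j 0, bit_lt_two _ _, by rwa [(h 0 hw).1]⟩

theorem subColumn_of_ne {q w l : ℕ} {A : ℕ → R} {j : ℕ} {v : R} {r b c : ℕ} (hb : b < w)
    (hc : c < 2) (hr : ∀ y < q, vertex q w j y l ≠ r) :
    subColumn q w l A j v ((r * w + b) * 2 + c) = A ((r * w + b) * 2 + c) := by
  rw [subColumn, if_neg]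
  rw [hits_iff hb hc]
  rintro ⟨⟨y, hy, h⟩, -⟩
  exact hr y hy h

theorem vote_subColumn_iff {q w l : ℕ} {A : ℕ → R} {j j' : ℕ} {v v' : R} {r : ℕ}
    (hr : ∀ y < q, vertex q w j y l ≠ r) :
    Vote w (subColumn q w l A j v) j' v' r ↔ Vote w A j' v' r := by
  refine forall_congr' fun b => forall_congr' fun hb => ?_
  have := bit_lt_two j' b
  rw [subColumn_of_ne hb this hr, subColumn_of_ne hb (by omega) hr]

theorem busy_subColumn_iff {q w l : ℕ} {A : ℕ → R} {j : ℕ} {v : R} {r : ℕ}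
    (hr : ∀ y < q, vertex q w j y l ≠ r) :
    Busy w (subColumn q w l A j v) r ↔ Busy w A r := by
  constructor
  · rintro ⟨b, hb, c, hc, h⟩
    exact ⟨b, hb, c, hc, by rwa [subColumn_of_ne hb hc hr] at h⟩
  · rintro ⟨b, hb, c, hc, h⟩
    exact ⟨b, hb, c, hc, by rwa [subColumn_of_ne hb hc hr]⟩

/-- A voting block is exactly `v` times the block of the column, so the subtraction cancels it
completely. -/
theorem Vote.not_busy_subColumn {q w l : ℕ} {A : ℕ → R} {j y : ℕ} {v : R} (hy : y < q)
    (h : Vote w A j v (vertex q w j y l)) :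
    ¬ Busy w (subColumn q w l A j v) (vertex q w j y l) := by
  rintro ⟨b, hb, c, hc, hne⟩
  apply hne
  have hbit := bit_lt_two j b
  by_cases hcb : c = bit j b
  · rw [subColumn, if_pos ((hits_iff hb hc).2 ⟨⟨y, hy, rfl⟩, hcb⟩), hcb, (h b hb).1, sub_self]
  · obtain rfl : c = 1 - bit j b := by omega
    rw [subColumn, if_neg (hits_flip hb), (h b hb).2]

open Classical in
/-- The number of votes for `(j, v)`. -/
noncomputable def voteCount (q w l : ℕ) (A : ℕ → R) (j : ℕ) (v : R) : ℕ :=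
  ((Finset.range q).filter fun y => Vote w A j v (vertex q w j y l)).card

theorem vertex_inj {q w j y y' l : ℕ} (hq : 0 < q) (h : vertex q w j y l = vertex q w j y' l) :
    y = y' := (vertex_eq hq h).1

/-- The potential argument for termination. More than half of the `q` blocks of the column vote, are
nonzero before and zero afterwards. Fewer than half can become nonzero, and no other block changes.
-/
theorem busyCount_subColumn_lt {q w l : ℕ} {A : ℕ → R} {j : ℕ} {v : R} (hw : 0 < w) (hv : v ≠ 0)
    (hq : 0 < q) (h : q < 2 * voteCount q w l A j v) :
    busyCount w (q ^ (l + 1)) (subColumn q w l A j v) < busyCount w (q ^ (l + 1)) A := by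
  classical
  set V := (Finset.range q).filter fun y => Vote w A j v (vertex q w j y l) with hV
  set V' := (Finset.range q).filter fun y => ¬ Vote w A j v (vertex q w j y l) with hV'
  have hcard : V.card + V'.card = q := by
    have := Finset.card_filter_add_card_filter_not (s := Finset.range q)
      fun y => Vote w A j v (vertex q w j y l)
    rwa [Finset.card_range] at this
  have hinj : ∀ T : Finset ℕ, (T.image fun y => vertex q w j y l).card = T.card := fun T =>
    Finset.card_image_of_injective _ fun y y' h => vertex_inj hq h
  -- A block that is nonzero after the subtraction is either outside the column and nonzero before,
  -- or a block of the column that did not vote.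
  have hsub : (Finset.range (q ^ (l + 1))).filter (Busy w (subColumn q w l A j v)) ⊆
      ((Finset.range (q ^ (l + 1))).filter (Busy w A) \ V.image fun y => vertex q w j y l) ∪
        V'.image fun y => vertex q w j y l := by
    intro r hr
    rw [Finset.mem_filter] at hr
    rw [Finset.mem_union, Finset.mem_sdiff, Finset.mem_filter]
    by_cases hex : ∃ y < q, vertex q w j y l = r
    · obtain ⟨y, hy, rfl⟩ := hex
      right
      refine Finset.mem_image_of_mem _ (Finset.mem_filter.2 ⟨Finset.mem_range.2 hy, fun hvote => ?_⟩)
      exact hvote.not_busy_subColumn hy hr.2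
    · push Not at hex
      refine Or.inl ⟨⟨hr.1, (busy_subColumn_iff hex).1 hr.2⟩, fun hmem => ?_⟩
      obtain ⟨y, hy, h⟩ := Finset.mem_image.1 hmem
      exact hex y (Finset.mem_range.1 (Finset.mem_filter.1 hy).1) h
  have hVsub : (V.image fun y => vertex q w j y l) ⊆
      (Finset.range (q ^ (l + 1))).filter (Busy w A) := by
    intro r hr
    obtain ⟨y, hy, rfl⟩ := Finset.mem_image.1 hr
    obtain ⟨hy, hvote⟩ := Finset.mem_filter.1 hy
    exact Finset.mem_filter.2 ⟨Finset.mem_range.2 (vertex_lt hq (Finset.mem_range.1 hy) l),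
      hvote.busy hw hv⟩
  have h1 := Finset.card_le_card hsub
  have h2 := Finset.card_union_le
    ((Finset.range (q ^ (l + 1))).filter (Busy w A) \ V.image fun y => vertex q w j y l)
    (V'.image fun y => vertex q w j y l)
  rw [Finset.card_sdiff_of_subset hVsub, hinj, hinj] at h2
  have h3 := Finset.card_le_card hVsub
  rw [hinj] at h3
  have h4 : voteCount q w l A j v = V.card := rfl
  unfold busyCount
  omega

open Classical in
/-- Columns for which more than half of the blocks vote have a block that is waiting. -/
def Examined (n q w l : ℕ) (A : ℕ → R) (waiting : Set ℕ) : Prop :=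
  ∀ j < n, ∀ v : R, v ≠ 0 → 2 * ((Finset.range q).filter fun y =>
    Vote w A j v (vertex q w j y l) ∧ vertex q w j y l ∉ waiting).card ≤ q

/-- Examination of the block `r` without a change of `A`. -/
theorem Examined.pop {n q w l : ℕ} {A : ℕ → R} {W W' : Set ℕ} {r : ℕ} (h : Examined n q w l A W)
    (hW : ∀ r' ∈ W, r' = r ∨ r' ∈ W')
    (hr : ∀ j < n, ∀ v : R, v ≠ 0 → Vote w A j v r → 2 * voteCount q w l A j v ≤ q) :
    Examined n q w l A W' := by
  classical
  intro j hj v hv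
  by_cases hvote : Vote w A j v r
  · refine le_trans (Nat.mul_le_mul_left 2 (Finset.card_le_card fun y hy => ?_)) (hr j hj v hv hvote)
    rw [Finset.mem_filter] at hy ⊢
    exact ⟨hy.1, hy.2.1⟩
  · refine le_trans (Nat.mul_le_mul_left 2 (Finset.card_le_card fun y hy => ?_)) (h j hj v hv)
    rw [Finset.mem_filter] at hy ⊢
    refine ⟨hy.1, hy.2.1, fun hmem => ?_⟩
    rcases hW _ hmem with he | hmem'
    · exact hvote (he ▸ hy.2.1)
    · exact hy.2.2 hmem'

/-- Examination of the block `r` followed by a subtraction. -/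
theorem Examined.update {n q w l : ℕ} {A : ℕ → R} {W W' : Set ℕ} {r j : ℕ} {v : R}
    (h : Examined n q w l A W) (hW : ∀ r' ∈ W, r' = r ∨ r' ∈ W')
    (hcol : ∀ y < q, vertex q w j y l ∈ W')
    (hr : ∀ j' < n, ∀ v' : R, v' ≠ 0 → Vote w A j' v' r → j' = j) :
    Examined n q w l (subColumn q w l A j v) W' := by
  classical
  intro j' hj' v' hv'
  refine le_trans (Nat.mul_le_mul_left 2 (Finset.card_le_card fun y hy => ?_)) (h j' hj' v' hv')
  rw [Finset.mem_filter] at hy ⊢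
  -- All blocks of the updated column `j` are waiting again, so a block that is not waiting lies
  -- outside that column. Its contents, and hence its vote, are unchanged.
  have hne : ∀ y' < q, vertex q w j y' l ≠ vertex q w j' y l := fun y' hy' he =>
    hy.2.2 (he ▸ hcol y' hy')
  have hvote := (vote_subColumn_iff hne).1 hy.2.1
  refine ⟨hy.1, hvote, fun hmem => ?_⟩
  rcases hW _ hmem with he | hmem'
  · have := hr j' hj' v' hv' (he ▸ hvote)
    exact hne y (Finset.mem_range.1 hy.1) (by rw [this])
  · exact hy.2.2 hmem'

/-! ### Correctness of the decoder -/

open Classical in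
/-- The measurement of the vector `x` of length `n` in row `i`. -/
noncomputable def measure (q w l n : ℕ) (x : ℕ → R) (i : ℕ) : R :=
  ∑ j ∈ Finset.range n, if Hits q w l j i then x j else 0

-- A nonzero block must be joined to a column of the support, and each column is joined to only `q`
-- blocks. For honest measurements this bounds the number of updates independently of the number of
-- blocks.
open Classical in
theorem busyCount_le {q w l n M : ℕ} {x z : ℕ → R}
    (hz : ∀ r < M, ∀ b < w, ∀ c < 2, z ((r * w + b) * 2 + c) =
      measure q w l n x ((r * w + b) * 2 + c)) :
    busyCount w M z ≤ ((Finset.range n).filter fun j => x j ≠ 0).card * q := by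
  have hsub : (Finset.range M).filter (Busy w z) ⊆
      (((Finset.range n).filter fun j => x j ≠ 0) ×ˢ Finset.range q).image
        fun p => vertex q w p.1 p.2 l := by
    intro r hr
    obtain ⟨hrM, b, hb, c, hc, hne⟩ := Finset.mem_filter.1 hr
    rw [hz r (Finset.mem_range.1 hrM) b hb c hc] at hne
    obtain ⟨j, hj, hne'⟩ := Finset.exists_ne_zero_of_sum_ne_zero hne
    have hhit : Hits q w l j ((r * w + b) * 2 + c) := by
      by_contra h
      exact hne' (if_neg h)
    rw [if_pos hhit] at hne'
    obtain ⟨⟨y, hy, rfl⟩, -⟩ := (hits_iff hb hc).1 hhit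
    exact Finset.mem_image.2 ⟨(j, y), by simp [hy, hne', Finset.mem_range.1 hj], rfl⟩
  refine (Finset.card_le_card hsub).trans (Finset.card_image_le.trans ?_)
  rw [Finset.card_product, Finset.card_range]

open Classical in
/-- If no column has a majority of votes, then the residual vector vanishes, provided that it is
sparse. -/
theorem eq_zero_of_votes {q w l h n : ℕ} {u A : ℕ → R} (hq : q.Prime) (hw : 1 ≤ w) (hh : 1 ≤ h)
    (hqm : 2 * ((l + 1) * h * w) ≤ q) (hn : n ≤ 2 ^ w)
    (hA : ∀ r < q ^ (l + 1), ∀ b < w, ∀ c < 2, A ((r * w + b) * 2 + c) =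
      measure q w l n u ((r * w + b) * 2 + c))
    (hcard : ((Finset.range n).filter fun j => u j ≠ 0).card * q < h ^ (l + 1))
    (hvotes : ∀ j < n, ∀ v : R, v ≠ 0 → 2 * voteCount q w l A j v ≤ q) :
    ∀ j < n, u j = 0 := by
  by_contra! hne
  obtain ⟨j₀, hj₀, hu₀⟩ := hne
  -- Expansion applied to the support of `u`: each vertex that `j` has for itself is a vote for `(j,
  -- u j)`, and there are more than `q / 2` of them.
  obtain ⟨j, hj, U, hU, hUcard, huniq⟩ := exists_unique_vertices hq (m := l + 1) (by omega) hw hh hqm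
    ((Finset.range n).filter fun j => u j ≠ 0)
    (fun j hj => (Finset.mem_range.1 (Finset.mem_filter.1 hj).1).trans_le hn)
    ⟨j₀, by simp [hj₀, hu₀]⟩ hcard
  obtain ⟨hjn, huj⟩ := Finset.mem_filter.1 hj
  rw [Finset.mem_range] at hjn
  refine absurd (hvotes j hjn (u j) huj) (not_le.2 (hUcard.trans_le
    (Nat.mul_le_mul_left 2 (Finset.card_le_card fun y hy => ?_))))
  have hyq := Finset.mem_range.1 (hU hy)
  refine Finset.mem_filter.2 ⟨hU hy, fun b hb => ?_⟩
  have hbit := bit_lt_two j b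
  have key : ∀ c < 2, A ((vertex q w j y l * w + b) * 2 + c) = if c = bit j b then u j else 0 := by
    intro c hc
    rw [hA _ (vertex_lt hq.pos hyq l) b hb c hc, measure, Finset.sum_eq_single j]
    · refine if_congr ?_ rfl rfl
      rw [hits_iff hb hc]
      exact ⟨fun h => h.2, fun h => ⟨⟨y, hyq, rfl⟩, h⟩⟩
    · intro j' hj' hne
      by_cases hu : u j' = 0
      · simp [hu]
      · rw [if_neg]
        rw [hits_iff hb hc]
        rintro ⟨⟨y', -, he⟩, -⟩
        exact hne (huniq y hy j' (Finset.mem_filter.2 ⟨hj', hu⟩) y' he)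
    · intro h
      exact absurd (Finset.mem_range.2 hjn) h
  refine ⟨by rw [key _ hbit, if_pos rfl], ?_⟩
  rw [key _ (by omega), if_neg (by omega)]

end

end CompressedSensing

/-! ### The recovery program. -/

namespace CompressedSensing

open RingRAM

/-- The number `2 * (r * w + b)` for the block `r` in register 95 and the digit `b` in
register 98. -/
def digitAddr : WExpr := (.reg 95 * .reg 10 + .reg 98) * 2

/-- Decodes the block in register 95: the column goes to register 96, the ring element to cell 0 of
array 30. -/
def decodeProg : Prog :=
  .setReg 96 0 ;; .setReg 97 1 ;;
  .forTo 98 10 (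
    .ite (.req (.get 3 (digitAddr + 1)) .zero) .skip (.setReg 96 (.reg 96 + .reg 97)) ;;
    .setReg 97 (.reg 97 * 2)) ;;
  .ite (.req (.get 3 (.reg 95 * .reg 10 * 2)) .zero)
    (.setR 30 0 (.get 3 (.reg 95 * .reg 10 * 2 + 1))) (.setR 30 0 (.get 3 (.reg 95 * .reg 10 * 2)))

/-- Decides whether the block of the column at the address in register 99, at the point in
register 101, votes. -/
def checkProg : Prog :=
  .setReg 102 1 ;;
  .forTo 103 10 (
    .setReg 104 (.get 2 (.reg 99 + 1 + .reg 101 * .reg 10 + .reg 103)) ;;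
    .ite (.req (.get 3 (.reg 104)) (.get 30 0)) .skip (.setReg 102 0) ;;
    .ite (.req (.get 3 (.reg 104 + 1 - .reg 104 % 2 * 2)) .zero) .skip (.setReg 102 0))

/-- Counts the votes for the decoded column and ring element. -/
def countProg : Prog :=
  .setReg 99 (.get 1 (.reg 96)) ;; .setReg 100 0 ;;
  .forTo 101 11 (checkProg ;; .setReg 100 (.reg 100 + .reg 102))

/-- The address of the entry for the point in register 105 and the digit in register 106. -/
def updateAddr : WExpr := .get 2 (.reg 99 + 1 + .reg 105 * .reg 10 + .reg 106)

/-- Subtracts a multiple of a column, and appends its blocks to the queue. -/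
def subtractProg : Prog :=
  .forTo 105 11 (
    .forTo 106 10 (.setR 3 updateAddr (.sub (.get 3 updateAddr) (.get 30 0))) ;;
    .setW 20 (.reg 91) (.get 2 (.reg 99 + 1 + .reg 105 * .reg 10) / (2 * .reg 10)) ;;
    .setReg 91 (.reg 91 + 1))

/-- Adds the decoded multiple of a unit vector to the result in array 21. -/
def creditProg : Prog :=
  .setR 21 (.reg 96) (.add (.get 21 (.reg 96)) (.get 30 0)) ;;
  .setW 22 (.reg 92) (.reg 96) ;; .setReg 92 (.reg 92 + 1)

/-- Examines the block with position in the queue in register 94. -/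
def examineProg : Prog :=
  .setReg 95 (.get 20 (.reg 94)) ;; decodeProg ;;
  .ite (.wlt (.reg 96) (.reg 0))
    (.ite (.req (.get 30 0) .zero) .skip
      (countProg ;; .ite (.wlt (.reg 11) (.reg 100 * 2)) (subtractProg ;; creditProg) .skip)) .skip

/-- Initializes the queue. -/
def queueProg : Prog :=
  .forTo 90 13 (.setW 20 (.reg 90) (.reg 90)) ;;
  .setReg 91 (.reg 13) ;; .setReg 92 0 ;; .setReg 93 (.reg 13 * (.reg 11 + 1))

/-- Collects the non-zero entries of array 21. -/
def collectProg : Prog :=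
  .setReg 107 0 ;;
  .forTo 108 92 (
    .setReg 109 (.get 22 (.reg 108)) ;;
    .ite (.req (.get 21 (.reg 109)) .zero) .skip
      (.setReg 107 (.reg 107 + 1) ;; .setW 4 (.reg 107) (.reg 109) ;;
        .setR 4 (.reg 107) (.get 21 (.reg 109)) ;; .setR 21 (.reg 109) .zero)) ;;
  .setW 4 0 (.reg 107)

/-- The recovery algorithm. -/
def recProg : Prog :=
  queueProg ;;
  .forTo 94 93 (.ite (.wlt (.reg 94) (.reg 91)) examineProg .skip) ;;
  collectProg

section

variable {R : Type*} [Ring R] {B : ℕ} {s : State R} {Q : State R → Prop}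

/-- Nothing is claimed for a block that does not vote; the program then leaves arbitrary candidates,
which the later tests filter. If the block votes for `(j, v)` with `v ≠ 0`, these candidates are `j`
and `v`, so a block votes for at most one such pair. -/
theorem runs_decodeProg {w r : ℕ} (hw1 : 1 ≤ w) (hw : s.word 10 0 = w) (hr : s.word 95 0 = r)
    (hB : w + 2 ^ (w + 1) < 2 ^ B)
    (hQ : ∀ s', (∀ j v, v ≠ 0 → j < 2 ^ w → Vote w (s.ring 3) j v r →
      s'.word 96 0 = j ∧ s'.ring 30 0 = v) → Frame decodeProg s s' → Q s') :
    Runs B (w * 5 + 7) decodeProg s Q := by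
  classical
  refine (Runs.frame (Q := fun s' => ∀ j v, v ≠ 0 → j < 2 ^ w → Vote w (s.ring 3) j v r →
      s'.word 96 0 = j ∧ s'.ring 30 0 = v) ?_).mono le_rfl fun s' h => hQ s' h.1 h.2
  have hBw := Nat.pow_lt_pow_right one_lt_two (show w < w + 1 by omega)
  have hBw1 := Nat.one_le_two_pow (n := w)
  refine Runs.setW_seq (N := w * 5 + 6) (by simp) ?_
  refine Runs.setW_seq (N := w * 5 + 5) (by simp only [WExpr.val_ofNat]; omega) ?_
  set s₁ := (s.writeW 96 _ _).writeW 97 _ _ with hs₁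
  have h10 : s₁.word 10 0 = w := by simp [hs₁, hw]
  have h95 : s₁.word 95 0 = r := by simp [hs₁, hr]
  have h96 : s₁.word 96 0 = 0 := by simp [hs₁]
  have h97 : s₁.word 97 0 = 1 := by simp [hs₁]
  have hring : s₁.ring = s.ring := rfl
  clear_value s₁
  refine Runs.seq (N := w * 5 + 2) (N' := 3) (Runs.forTo (n := w) (Nb := 3) (fun k s' =>
    s'.word 96 0 = (∑ b ∈ Finset.range k, if s.ring 3 ((r * w + b) * 2 + 1) = 0 then 0 else 2 ^ b) ∧
    s'.word 96 0 < 2 ^ k ∧ s'.word 97 0 = 2 ^ k) h10 (by omega) (by simp [h96, h97]) ?_ ?_)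
  · rintro k s' hk ⟨h1, h1', h2⟩ h98 hF
    have g10 : s'.word 10 0 = w := by rw [hF.word 10 rfl, h10]
    have g95 : s'.word 95 0 = r := by rw [hF.word 95 rfl, h95]
    have g3 : s'.ring 3 = s.ring 3 := by rw [hF.ring 3 rfl, hring]
    have hpow : 2 ^ (k + 1) ≤ 2 ^ w := Nat.pow_le_pow_right two_pos hk
    have hpow' : 2 ^ (k + 1) = 2 ^ k * 2 := pow_succ _ _
    have htest : (Test.req (.get 3 (digitAddr + 1)) .zero).Holds s' ↔
        s.ring 3 ((r * w + k) * 2 + 1) = 0 := by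
      simp [Test.Holds, RExpr.val, digitAddr, g10, g95, h98, g3]
    refine Runs.seq (N := 2) (N' := 1) (Runs.ite (N := 1) (fun h => Runs.skip ?_)
      (fun h => Runs.setW ?_ ?_))
    · refine Runs.setW (by simp [h2]; omega) ⟨?_, ?_, ?_⟩
      · rw [htest] at h
        simp [Finset.sum_range_succ, h1, h]
      · simp; omega
      · simp [h2, hpow']
    · simp [h2]; omega
    · refine Runs.setW (by simp [h2]; omega) ⟨?_, ?_, ?_⟩
      · rw [htest] at h
        simp [Finset.sum_range_succ, h1, h, h2]
      · simp [h2]; omega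
      · simp [h2, hpow']
  · rintro s' ⟨h1, -, -⟩ _ hF
    have g10 : s'.word 10 0 = w := by rw [hF.word 10 rfl, h10]
    have g95 : s'.word 95 0 = r := by rw [hF.word 95 rfl, h95]
    have g3 : s'.ring 3 = s.ring 3 := by rw [hF.ring 3 rfl, hring]
    -- Because `v ≠ 0`, the second row of a pair is nonzero exactly when the digit is `1`.
    have hdec : ∀ j v, v ≠ 0 → j < 2 ^ w → Vote w (s.ring 3) j v r → s'.word 96 0 = j := by
      intro j v hv hj hvote
      rw [h1, ← Nat.mod_eq_of_lt hj, ← sum_bit w]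
      refine Finset.sum_congr rfl fun b hb => ?_
      obtain ⟨k1, k2⟩ := hvote b (Finset.mem_range.1 hb)
      rcases (by have := bit_lt_two j b; omega : bit j b = 0 ∨ bit j b = 1) with hb0 | hb1
      · rw [hb0] at k1 k2 ⊢
        simp [k2]
      · rw [hb1] at k1 k2 ⊢
        simp [k1, hv]
    have htest : (Test.req (.get 3 (.reg 95 * .reg 10 * 2)) .zero).Holds s' ↔
        s.ring 3 ((r * w + 0) * 2 + 0) = 0 := by
      simp [Test.Holds, RExpr.val, g10, g95, g3]
    refine Runs.ite (N := 2) (fun h => Runs.setR fun j v hv hj hvote => ?_)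
      (fun h => Runs.setR fun j v hv hj hvote => ?_)
    · refine ⟨by simpa using hdec j v hv hj hvote, ?_⟩
      rw [htest] at h
      obtain ⟨k1, k2⟩ := hvote 0 hw1
      have hb1 : bit j 0 = 1 := by
        by_contra hb1
        have hb0 : bit j 0 = 0 := by have := bit_lt_two j 0; omega
        rw [hb0, h] at k1
        exact hv k1.symm
      rw [hb1] at k1
      simpa [RExpr.val, g10, g95, g3] using k1
    · refine ⟨by simpa using hdec j v hv hj hvote, ?_⟩
      rw [htest] at h
      obtain ⟨k1, k2⟩ := hvote 0 hw1
      have hb0 : bit j 0 = 0 := by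
        by_contra hb0
        have hb1 : bit j 0 = 1 := by have := bit_lt_two j 0; omega
        rw [hb1] at k2
        exact h k2
      rw [hb0] at k1
      simpa [RExpr.val, g10, g95, g3] using k1

/-- The other row of a pair arises by flipping the lowest bit of the row number. Adding `1` first
keeps the truncated subtraction exact. -/
theorem flip_row {q w l j y b : ℕ} :
    row q w l j y b + 1 - row q w l j y b % 2 * 2 = (vertex q w j y l * w + b) * 2 + (1 - bit j b) := by
  have := bit_lt_two j b
  rw [row]
  omega

open Classical in
theorem runs_checkProg {n q w l j y : ℕ} (hs : Table n q w l s) (hj : j < n) (hy : y < q)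
    (hp : s.word 99 0 = j * (q * w + 1)) (hy' : s.word 101 0 = y)
    (hB : w + 2 + q ^ (l + 1) * w * 2 < 2 ^ B)
    (hQ : ∀ s', s'.word 102 0 = (if Vote w (s.ring 3) j (s.ring 30 0) (vertex q w j y l) then 1
      else 0) → Frame checkProg s s' → Q s') :
    Runs B (w * 7 + 3) checkProg s Q := by
  refine (Runs.frame (Q := fun s' => s'.word 102 0 = (if Vote w (s.ring 3) j (s.ring 30 0)
    (vertex q w j y l) then 1 else 0)) ?_).mono le_rfl fun s' h => hQ s' h.1 h.2
  refine Runs.setW_seq (N := w * 7 + 2) (by simp only [WExpr.val_ofNat]; omega) ?_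
  refine Runs.forTo (n := w) (Nb := 5) (fun k s' => s'.word 102 0 = if (∀ b < k,
    s.ring 3 ((vertex q w j y l * w + b) * 2 + bit j b) = s.ring 30 0 ∧
    s.ring 3 ((vertex q w j y l * w + b) * 2 + (1 - bit j b)) = 0) then 1 else 0)
    (by simpa using hs.hw) (by omega) (by simp) ?_ ?_
  · rintro k s₁ hk h1 h103 hF
    have hT : Table n q w l s₁ := (hs.congr (s' := s.writeW 102 _ _) (by simp [State.writeW_array])
      (by simp [State.writeW_array]) (by simp [State.writeW_array]) (by simp [State.writeW_array])
      (by simp [State.writeW_array]) (by simp [State.writeW_array]) rfl).frame hF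
    have g99 : s₁.word 99 0 = j * (q * w + 1) := by rw [hF.word 99 rfl]; simpa using hp
    have g101 : s₁.word 101 0 = y := by rw [hF.word 101 rfl]; simpa using hy'
    have g3 : s₁.ring 3 = s.ring 3 := hF.ring 3 rfl
    have g30 : s₁.ring 30 = s.ring 30 := hF.ring 30 rfl
    have hread := (hT.read hj hy hk).1
    have hlt := row_lt (l := l) (j := j) hy hk
    refine Runs.setW_seq (N := 4) ?_ ?_
    · simp only [WExpr.val_get, WExpr.val_add, WExpr.val_mul, WExpr.val_const, WExpr.val_ofNat, g99,
        g101, hT.hw, h103, hread]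
      omega
    set s₂ := s₁.writeW 104 _ _ with hs₂
    have e104 : s₂.word 104 0 = row q w l j y k := by
      simp [hs₂, g99, g101, hT.hw, h103, hread]
    have e102 : s₂.word 102 0 = s₁.word 102 0 := by simp [hs₂]
    have e3 : s₂.ring 3 = s.ring 3 := g3
    have e30 : s₂.ring 30 = s.ring 30 := g30
    clear_value s₂
    have ht1 : (Test.req (.get 3 (.reg 104)) (.get 30 0)).Holds s₂ ↔
        s.ring 3 ((vertex q w j y l * w + k) * 2 + bit j k) = s.ring 30 0 := by
      simp [Test.Holds, RExpr.val, e104, e3, e30, row]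
    have ht2 : ∀ s₃ : State R, s₃.word 104 0 = s₂.word 104 0 → s₃.ring = s₂.ring →
        ((Test.req (.get 3 (.reg 104 + 1 - .reg 104 % 2 * 2)) .zero).Holds s₃ ↔
        s.ring 3 ((vertex q w j y l * w + k) * 2 + (1 - bit j k)) = 0) := by
      intro s₃ k1 k2
      rw [← flip_row, ← e104, ← e3, ← k1, ← k2]
      simp [Test.Holds, RExpr.val]
    refine Runs.seq (N := 2) (N' := 2) (Runs.ite (N := 1) (fun h => Runs.skip ?_)
      (fun h => Runs.setW (by simp) ?_))
    · rw [ht1] at h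
      refine Runs.ite (N := 1) (fun h' => Runs.skip ?_) (fun h' => Runs.setW (by simp) ?_)
      · rw [ht2 _ rfl rfl] at h'
        simp only [State.writeW_word, Nat.reduceEqDiff, false_and, if_false, e102, h1]
        refine if_congr ⟨fun hall b hb => ?_, fun hall b hb => hall b (by omega)⟩ rfl rfl
        rcases Nat.lt_succ_iff_lt_or_eq.1 hb with hb | rfl
        · exact hall b hb
        · exact ⟨h, h'⟩
      · rw [ht2 _ rfl rfl] at h'
        rw [if_neg fun hall => h' (hall k (by omega)).2]
        simp
    · rw [ht1] at h
      refine Runs.ite (N := 1) (fun h' => Runs.skip ?_) (fun h' => Runs.setW (by simp) ?_)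
      · rw [if_neg fun hall => h (hall k (by omega)).1]
        simp
      · rw [if_neg fun hall => h (hall k (by omega)).1]
        simp
  · rintro s' h1 - -
    exact h1.trans (if_congr Iff.rfl rfl rfl)

theorem runs_countProg {n q w l j : ℕ} (hs : Table n q w l s) (hj : j < n)
    (hj' : s.word 96 0 = j)
    (hB : n * (q * w + 1) + w + 2 * q + 2 + q ^ (l + 1) * w * 2 < 2 ^ B)
    (hQ : ∀ s', s'.word 100 0 = voteCount q w l (s.ring 3) j (s.ring 30 0) →
      s'.word 99 0 = j * (q * w + 1) → Frame countProg s s' → Q s') :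
    Runs B (q * (w * 7 + 6) + 4) countProg s Q := by
  classical
  refine (Runs.frame (Q := fun s' => s'.word 100 0 = voteCount q w l (s.ring 3) j (s.ring 30 0) ∧
    s'.word 99 0 = j * (q * w + 1)) ?_).mono le_rfl fun s' h => hQ s' h.1.1 h.1.2 h.2
  have hjn : j * (q * w + 1) ≤ n * (q * w + 1) := Nat.mul_le_mul_right _ hj.le
  refine Runs.setW_seq (N := q * (w * 7 + 6) + 3) ?_
    (Runs.setW_seq (N := q * (w * 7 + 6) + 2) (by simp) ?_)
  · simp only [WExpr.val_get, WExpr.val_const, hj', hs.ptr j hj]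
    omega
  set s₁ := (s.writeW 99 _ _).writeW 100 _ _ with hs₁
  have hT₁ : Table n q w l s₁ := hs.congr (by simp [hs₁, State.writeW_array])
    (by simp [hs₁, State.writeW_array]) (by simp [hs₁, State.writeW_array])
    (by simp [hs₁, State.writeW_array]) (by simp [hs₁, State.writeW_array])
    (by simp [hs₁, State.writeW_array]) rfl
  have h99 : s₁.word 99 0 = j * (q * w + 1) := by simp [hs₁, hj', hs.ptr j hj]
  have h100 : s₁.word 100 0 = 0 := by simp [hs₁]
  have hr : s₁.ring = s.ring := rfl
  clear_value s₁
  refine Runs.forTo (n := q) (Nb := w * 7 + 4) (fun k s' => s'.word 100 0 =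
    ((Finset.range k).filter fun y => Vote w (s.ring 3) j (s.ring 30 0) (vertex q w j y l)).card)
    hT₁.hq (by omega) (by simp [h100]) ?_ ?_
  · rintro k s₂ hk h1 h101 hF
    have g99 : s₂.word 99 0 = j * (q * w + 1) := by rw [hF.word 99 rfl, h99]
    have g3 : s₂.ring 3 = s.ring 3 := by rw [hF.ring 3 rfl, hr]
    have g30 : s₂.ring 30 = s.ring 30 := by rw [hF.ring 30 rfl, hr]
    refine Runs.seq (N := w * 7 + 3) (N' := 1) (runs_checkProg (hT₁.frame hF) hj hk g99 h101 (by omega) fun s₃ k1 hF' => ?_)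
    have e100 : s₃.word 100 0 = s₂.word 100 0 := by rw [hF'.word 100 rfl]
    have hle : ((Finset.range k).filter fun y =>
        Vote w (s.ring 3) j (s.ring 30 0) (vertex q w j y l)).card ≤ k :=
      (Finset.card_filter_le _ _).trans (by simp)
    rw [g3, g30] at k1
    have hval : (WExpr.reg 100 + WExpr.reg 102).val s₃ = ((Finset.range (k + 1)).filter fun y =>
        Vote w (s.ring 3) j (s.ring 30 0) (vertex q w j y l)).card := by
      simp only [WExpr.val_add, WExpr.val_get, WExpr.val_const, e100, h1, k1]
      rw [Finset.range_add_one, Finset.filter_insert]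
      split_ifs
      · rw [Finset.card_insert_of_notMem (by simp)]
      · rfl
    have hle' : ((Finset.range (k + 1)).filter fun y =>
        Vote w (s.ring 3) j (s.ring 30 0) (vertex q w j y l)).card ≤ k + 1 :=
      (Finset.card_filter_le _ _).trans (by simp)
    refine Runs.setW ?_ ?_
    · rw [hval]; omega
    · rw [hval]; simp
  · rintro s' h1 _ hF
    exact ⟨h1, by rw [hF.word 99 rfl, h99]⟩

open Classical in
theorem runs_subtractProg {n q w l j t : ℕ} (hs : Table n q w l s) (hw1 : 1 ≤ w) (hj : j < n)
    (hp : s.word 99 0 = j * (q * w + 1)) (ht : s.word 91 0 = t)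
    (hB : t + w + q + q ^ (l + 1) < 2 ^ B)
    (hQ : ∀ s', s'.ring 3 = subColumn q w l (s.ring 3) j (s.ring 30 0) →
      (∀ i < t, s'.word 20 i = s.word 20 i) → (∀ y < q, s'.word 20 (t + y) = vertex q w j y l) →
      s'.word 91 0 = t + q → Frame subtractProg s s' → Q s') :
    Runs B (q * (w * 3 + 6) + 2) subtractProg s Q := by
  refine (Runs.frame (Q := fun s' => s'.ring 3 = subColumn q w l (s.ring 3) j (s.ring 30 0) ∧
      (∀ i < t, s'.word 20 i = s.word 20 i) ∧ (∀ y < q, s'.word 20 (t + y) = vertex q w j y l) ∧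
      s'.word 91 0 = t + q) ?_).mono le_rfl
    fun s' h => hQ s' h.1.1 h.1.2.1 h.1.2.2.1 h.1.2.2.2 h.2
  refine Runs.forTo (n := q) (Nb := w * 3 + 4) (fun y s' =>
    (∀ i, s'.ring 3 i = if ∃ k < y * w, i = rowAt q w l j k then s.ring 3 i - s.ring 30 0
      else s.ring 3 i) ∧
    (∀ i < t, s'.word 20 i = s.word 20 i) ∧ (∀ y' < y, s'.word 20 (t + y') = vertex q w j y' l) ∧
    s'.word 91 0 = t + y) hs.hq (by omega) (by simp [ht]) ?_ ?_
  · rintro y s₁ hy ⟨h1, h2, h3, h4⟩ h105 hF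
    have hT₁ := hs.frame hF
    have h99 : s₁.word 99 0 = j * (q * w + 1) := by rw [hF.word 99 rfl, hp]
    have h30 : s₁.ring 30 = s.ring 30 := by rw [hF.ring 30 rfl]
    refine Runs.seq (N := w * 3 + 2) (N' := 2) (Runs.forTo (n := w) (Nb := 1) (fun b s' =>
      ∀ i, s'.ring 3 i = if ∃ k < y * w + b, i = rowAt q w l j k then s.ring 3 i - s.ring 30 0
        else s.ring 3 i) hT₁.hw (by omega) (fun i => h1 i) ?_ ?_)
    · rintro b s₂ hb k1 h106 hF'
      have g99 : s₂.word 99 0 = j * (q * w + 1) := by rw [hF'.word 99 rfl, h99]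
      have g105 : s₂.word 105 0 = y := by rw [hF'.word 105 rfl, h105]
      have g30 : s₂.ring 30 = s.ring 30 := by rw [hF'.ring 30 rfl, h30]
      have hT₂ := hT₁.frame hF'
      have haddr : updateAddr.val s₂ = rowAt q w l j (y * w + b) := by
        rw [rowAt_add hb, ← (hT₂.read hj hy hb).1]
        simp [updateAddr, g99, g105, h106, hT₂.hw]
      refine Runs.setR fun i => ?_
      simp only [RExpr.val, haddr, State.writeW_ring, State.writeR_ring, true_and, g30,
        WExpr.val_ofNat]
      by_cases hi : i = rowAt q w l j (y * w + b)
      · rw [if_pos hi, if_pos ⟨y * w + b, by omega, hi⟩, k1, if_neg, hi]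
        rintro ⟨k, hk, he⟩
        have := rowAt_injective hw1 (addr_lt hy hb) he
        omega
      · rw [if_neg hi, k1]
        refine if_congr ⟨fun ⟨k', e1, e2⟩ => ⟨k', by omega, e2⟩, ?_⟩ rfl rfl
        rintro ⟨k', e1, e2⟩
        refine ⟨k', ?_, e2⟩
        have : k' ≠ y * w + b := by rintro rfl; exact hi e2
        omega
    · rintro s₂ k1 _ hF'
      have g99 : s₂.word 99 0 = j * (q * w + 1) := by rw [hF'.word 99 rfl, h99]
      have g105 : s₂.word 105 0 = y := by rw [hF'.word 105 rfl, h105]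
      have g91 : s₂.word 91 0 = t + y := by rw [hF'.word 91 rfl, h4]
      have g20 : s₂.word 20 = s₁.word 20 := hF'.word 20 rfl
      have hT₂ := hT₁.frame hF'
      have hread := (hT₂.read hj hy (show 0 < w by omega)).1
      rw [add_zero] at hread
      have hval : (.get 2 (.reg 99 + 1 + .reg 105 * .reg 10) / (2 * .reg 10) : WExpr).val s₂ =
          vertex q w j y l := by
        rw [← row_div (show 0 < w by omega), ← hread]
        simp [g99, g105, hT₂.hw]
      have hlt := vertex_lt (w := w) (j := j) (by omega : 0 < q) hy l
      refine Runs.setW_seq (by rw [hval]; omega) (Runs.setW (by simp [g91]; omega) ⟨fun i => ?_,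
        fun i hi => ?_, fun y' hy' => ?_, ?_⟩)
      · simp only [State.writeW_ring, k1 i, add_mul, one_mul]
      · rw [hval]
        have : i ≠ t + y := by omega
        simp [g91, this, g20, h2 i hi]
      · rw [hval]
        by_cases hyy : y' = y
        · simp [g91, hyy]
        · simp [g91, hyy, g20, h3 y' (by omega)]
      · simp [g91]; omega
  · rintro s' ⟨h1, h2, h3, h4⟩ - -
    refine ⟨funext fun i => ?_, h2, h3, h4⟩
    rw [h1, subColumn]
    exact if_congr Iff.rfl rfl rfl

open Classical in
theorem measure_update {q w l n j : ℕ} (x x' : ℕ → R) (v : R) (hj : j < n)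
    (h : ∀ i, x' i = if i = j then x j + v else x i) (i : ℕ) :
    measure q w l n x' i = measure q w l n x i + if Hits q w l j i then v else 0 := by
  have : ∀ k ∈ Finset.range n, (if Hits q w l k i then x' k else 0) =
      (if Hits q w l k i then x k else 0) +
        if k = j then (if Hits q w l j i then v else 0) else 0 := by
    intro k _
    rw [h]
    by_cases hk : k = j
    · subst hk
      by_cases hh : Hits q w l k i <;> simp [hh]
    · simp [hk]
  rw [measure, Finset.sum_congr rfl this, Finset.sum_add_distrib, Finset.sum_ite_eq',
    if_pos (Finset.mem_range.2 hj), measure]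

/-- The invariant of the recovery algorithm after the examination of the first `k` elements of the
queue, for the measurement vector `z`. -/
structure Inv (n q w l : ℕ) (z : ℕ → R) (k : ℕ) (s : State R) : Prop where
  sum : ∀ i, s.ring 3 i + measure q w l n (s.ring 21) i = z i
  supp : ∀ j, s.ring 21 j ≠ 0 → ∃ i < s.word 92 0, s.word 22 i = j
  touched : ∀ i < s.word 92 0, s.word 22 i < n
  count : busyCount w (q ^ (l + 1)) (s.ring 3) + s.word 92 0 ≤ busyCount w (q ^ (l + 1)) z
  tail : s.word 91 0 = q ^ (l + 1) + q * s.word 92 0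
  queue : ∀ i < s.word 91 0, s.word 20 i < q ^ (l + 1)
  exam : Examined n q w l (s.ring 3) {r | ∃ i, k ≤ i ∧ i < s.word 91 0 ∧ s.word 20 i = r}

theorem busyCount_le_self (w M : ℕ) (A : ℕ → R) : busyCount w M A ≤ M := by
  classical
  exact (Finset.card_filter_le _ _).trans (by simp)

theorem Inv.congr {n q w l k : ℕ} {z : ℕ → R} {s s' : State R} (h : Inv n q w l z k s)
    (h3 : s'.ring 3 = s.ring 3) (h21 : s'.ring 21 = s.ring 21) (h92 : s'.word 92 = s.word 92)
    (h22 : s'.word 22 = s.word 22) (h91 : s'.word 91 = s.word 91) (h20 : s'.word 20 = s.word 20) :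
    Inv n q w l z k s' := by
  obtain ⟨k1, k2, k3, k4, k5, k6, k7⟩ := h
  constructor <;> simp only [h3, h21, h92, h22, h91, h20] <;> assumption

/-- A block without a majority may be dropped. The frame of `decodeProg` serves only as the list of
arrays that have not changed. -/
theorem Inv.skip {n q w l k : ℕ} {z : ℕ → R} {s s' : State R} (h : Inv n q w l z k s)
    (hF : Frame decodeProg s s')
    (hr : ∀ j < n, ∀ v : R, v ≠ 0 → Vote w (s.ring 3) j v (s.word 20 k) →
      2 * voteCount q w l (s.ring 3) j v ≤ q) :
    Inv n q w l z (k + 1) s' := by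
  have h3 : s'.ring 3 = s.ring 3 := hF.ring 3 rfl
  have h91 : s'.word 91 = s.word 91 := hF.word 91 rfl
  have h20 : s'.word 20 = s.word 20 := hF.word 20 rfl
  obtain ⟨k1, k2, k3, k4, k5, k6, k7⟩ := h.congr h3 (hF.ring 21 rfl) (hF.word 92 rfl)
    (hF.word 22 rfl) h91 h20
  refine ⟨k1, k2, k3, k4, k5, k6, k7.pop (r := s.word 20 k) ?_ ?_⟩
  · rintro r ⟨i, h1, h2, rfl⟩
    rcases h1.eq_or_lt with rfl | h1
    · exact Or.inl (by rw [h20])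
    · exact Or.inr ⟨i, h1, h2, rfl⟩
  · rwa [h3]

/-- The majority pays for the update: one more touched entry is offset by at least one nonzero block
fewer. Since every column voted for by block `k` is `j`, whose blocks all rejoin the queue, the
examined block leaves nothing behind. -/
theorem runs_updateProg {n q w l j k : ℕ} {z : ℕ → R} (hs : Table n q w l s) (hw1 : 1 ≤ w)
    (hj : j < n) (hI : Inv n q w l z k s) (hp : s.word 99 0 = j * (q * w + 1))
    (h96 : s.word 96 0 = j) (hk : k < s.word 91 0) (hv : s.ring 30 0 ≠ 0)
    (hmaj : q < 2 * voteCount q w l (s.ring 3) j (s.ring 30 0))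
    (hr : ∀ j' < n, ∀ v' : R, v' ≠ 0 → Vote w (s.ring 3) j' v' (s.word 20 k) → j' = j)
    (hB : q ^ (l + 1) * (q + 2) + q + w + n + 2 < 2 ^ B) :
    Runs B (q * (w * 3 + 6) + 5) (subtractProg ;; creditProg) s (Inv n q w l z (k + 1)) := by
  classical
  obtain ⟨k1, k2, k3, k4, k5, k6, k7⟩ := hI
  have hq : 0 < q := by
    rcases Nat.eq_zero_or_pos q with rfl | h
    · simp [voteCount] at hmaj
    · exact h
  have hcnt := busyCount_subColumn_lt (l := l) (A := s.ring 3) (by omega : 0 < w) hv hq hmaj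
  have hz := busyCount_le_self w (q ^ (l + 1)) z
  have hnu : s.word 92 0 < q ^ (l + 1) := by omega
  have htl : s.word 91 0 + q ≤ q ^ (l + 1) * (q + 1) := by
    rw [k5]; nlinarith
  have hB' : q ^ (l + 1) * (q + 2) = q ^ (l + 1) * (q + 1) + q ^ (l + 1) := by ring
  refine Runs.seq (N := q * (w * 3 + 6) + 2) (N' := 3) (runs_subtractProg hs hw1 hj hp rfl (by omega)
    fun s₁ h1 h2 h3 h4 hF => ?_)
  have g96 : s₁.word 96 0 = j := by rw [hF.word 96 rfl, h96]
  have g92 : s₁.word 92 0 = s.word 92 0 := by rw [hF.word 92 rfl]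
  have g22 : s₁.word 22 = s.word 22 := hF.word 22 rfl
  have g21 : s₁.ring 21 = s.ring 21 := hF.ring 21 rfl
  have g30 : s₁.ring 30 = s.ring 30 := hF.ring 30 rfl
  refine Runs.setR_seq (Runs.setW_seq (by simp [g96]; omega) (Runs.setW (by simp [g92]; omega) ?_))
  set s₂ := ((s₁.writeR 21 _ _).writeW 22 _ _).writeW 92 _ _ with hs₂
  have e21 : ∀ i, s₂.ring 21 i = if i = j then s.ring 21 j + s.ring 30 0 else s.ring 21 i := by
    intro i
    by_cases hi : i = j <;> simp [hs₂, g96, g21, g30, RExpr.val, hi]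
  have e22 : ∀ i, s₂.word 22 i = if i = s.word 92 0 then j else s.word 22 i := by
    intro i
    by_cases hi : i = s.word 92 0 <;> simp [hs₂, g96, g92, g22, hi]
  have e92 : s₂.word 92 0 = s.word 92 0 + 1 := by simp [hs₂, g92]
  have e91 : s₂.word 91 0 = s.word 91 0 + q := by simp [hs₂, h4]
  have e20 : s₂.word 20 = s₁.word 20 := by simp [hs₂, State.writeW_array]
  have e3 : s₂.ring 3 = subColumn q w l (s.ring 3) j (s.ring 30 0) := by
    rw [← h1]; simp [hs₂, State.writeR_array]
  clear_value s₂
  refine ⟨fun i => ?_, fun i hi => ?_, fun i hi => ?_, ?_, ?_, fun i hi => ?_, ?_⟩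
  -- What is subtracted from the residual measurement is credited to the result, so their sum
  -- remains `z`.
  · rw [e3, measure_update _ _ _ hj e21, ← k1 i, subColumn]
    split_ifs <;> abel
  · rw [e92]
    rw [e21] at hi
    by_cases hij : i = j
    · exact ⟨s.word 92 0, by omega, by rw [e22, if_pos rfl, hij]⟩
    · rw [if_neg hij] at hi
      obtain ⟨a, ha, ha'⟩ := k2 i hi
      exact ⟨a, by omega, by rw [e22, if_neg (by omega), ha']⟩
  · rw [e92] at hi
    rw [e22]
    split_ifs with h
    · exact hj
    · exact k3 i (by omega)
  · rw [e3, e92]; omega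
  · rw [e91, e92, k5]; ring
  · rw [e91] at hi
    rw [e20]
    by_cases hlt : i < s.word 91 0
    · rw [h2 i hlt]; exact k6 i hlt
    · obtain ⟨y, rfl⟩ := Nat.exists_eq_add_of_le (not_lt.1 hlt)
      rw [h3 y (by omega)]
      exact vertex_lt hq (by omega) l
  · rw [e3]
    refine k7.update (r := s.word 20 k) ?_ ?_ hr
    · rintro r ⟨i, h5, h6, rfl⟩
      rcases h5.eq_or_lt with rfl | h5
      · exact Or.inl rfl
      · exact Or.inr ⟨i, h5, by omega, by rw [e20, h2 i h6]⟩
    · intro y hy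
      refine ⟨s.word 91 0 + y, ?_, by omega, by rw [e20, h3 y hy]⟩
      omega

/-- The three ways to skip (decoded index not below `n`, decoded value zero, no majority) each show
that no admissible pair for which this block votes has a majority. -/
theorem runs_examineProg {n q w l k : ℕ} {z : ℕ → R} (hs : Table n q w l s) (hw1 : 1 ≤ w)
    (hn : n ≤ 2 ^ w) (hI : Inv n q w l z k s) (hk : s.word 94 0 = k) (hkt : k < s.word 91 0)
    (hB : n * (q * w + 1) + w + 2 * q + 2 + q ^ (l + 1) * w * 2 < 2 ^ B)
    (hB' : q ^ (l + 1) * (q + 2) + q + w + n + 2 < 2 ^ B) (hB'' : w + 2 ^ (w + 1) < 2 ^ B) :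
    Runs B (q * (w * 10 + 12) + w * 5 + 20) examineProg s (Inv n q w l z (k + 1)) := by
  have hq := hI.queue k hkt
  have hM : q ^ (l + 1) ≤ q ^ (l + 1) * (q + 2) := Nat.le_mul_of_pos_right _ (by omega)
  refine Runs.setW_seq (N := q * (w * 10 + 12) + w * 5 + 19) ?_ ?_
  · simp only [WExpr.val_get, WExpr.val_const, hk]; omega
  set s₁ := s.writeW 95 _ _ with hs₁
  have hT₁ : Table n q w l s₁ := hs.congr (by simp [hs₁, State.writeW_array])
    (by simp [hs₁, State.writeW_array]) (by simp [hs₁, State.writeW_array])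
    (by simp [hs₁, State.writeW_array]) (by simp [hs₁, State.writeW_array])
    (by simp [hs₁, State.writeW_array]) rfl
  have hI₁ : Inv n q w l z k s₁ := hI.congr rfl rfl (by simp [hs₁, State.writeW_array])
    (by simp [hs₁, State.writeW_array]) (by simp [hs₁, State.writeW_array])
    (by simp [hs₁, State.writeW_array])
  have h95 : s₁.word 95 0 = s₁.word 20 k := by simp [hs₁, hk]
  have h91 : k < s₁.word 91 0 := by simpa [hs₁] using hkt
  clear_value s₁
  refine Runs.seq (N := w * 5 + 7) (N' := q * (w * 10 + 12) + 12)
    (runs_decodeProg hw1 hT₁.hw h95 hB'' fun s₂ hdec hF => ?_) |>.le (by omega)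
  have hT₂ := hT₁.frame hF
  have h3 : s₂.ring 3 = s₁.ring 3 := hF.ring 3 rfl
  refine Runs.ite (N := q * (w * 10 + 12) + 11) (fun hlt => ?_) (fun hlt => Runs.skip ?_)
  · simp only [Test.Holds, WExpr.val_get, WExpr.val_const, hT₂.hn] at hlt
    refine Runs.ite (N := q * (w * 10 + 12) + 10) (fun hv => Runs.skip ?_) (fun hv => ?_)
    · refine hI₁.skip hF fun j hj v hv' hvote => ?_
      refine absurd ((hdec j v hv' (hj.trans_le hn) hvote).2.symm.trans ?_) hv'
      simpa [Test.Holds, RExpr.val] using hv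
    · simp only [Test.Holds, RExpr.val, WExpr.val_ofNat] at hv
      refine Runs.seq (N := q * (w * 7 + 6) + 4) (N' := q * (w * 3 + 6) + 6)
        (runs_countProg hT₂ hlt rfl hB fun s₃ h1 h2 hF' => ?_) |>.le
        (le_of_eq (by ring))
      have hT₃ := hT₂.frame hF'
      have g3 : s₃.ring 3 = s₁.ring 3 := by rw [hF'.ring 3 rfl, h3]
      have g30 : s₃.ring 30 = s₂.ring 30 := hF'.ring 30 rfl
      have g20 : s₃.word 20 = s₁.word 20 := by rw [hF'.word 20 rfl, hF.word 20 rfl]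
      have hI₃ : Inv n q w l z k s₃ := hI₁.congr g3 (by rw [hF'.ring 21 rfl, hF.ring 21 rfl])
        (by rw [hF'.word 92 rfl, hF.word 92 rfl]) (by rw [hF'.word 22 rfl, hF.word 22 rfl])
        (by rw [hF'.word 91 rfl, hF.word 91 rfl]) g20
      have hdec₃ : ∀ j < n, ∀ v : R, v ≠ 0 → Vote w (s₃.ring 3) j v (s₃.word 20 k) →
          j = s₂.word 96 0 ∧ v = s₃.ring 30 0 := by
        intro j hj v hv' hvote
        rw [g3, g20] at hvote
        obtain ⟨e1, e2⟩ := hdec j v hv' (hj.trans_le hn) hvote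
        exact ⟨e1.symm, by rw [g30, e2]⟩
      rw [h3, ← g3, ← g30] at h1
      refine Runs.ite (N := q * (w * 3 + 6) + 5) (fun hmaj => ?_) (fun hmaj => Runs.skip ?_)
      · simp only [Test.Holds, WExpr.val_get, WExpr.val_const, WExpr.val_mul, WExpr.val_ofNat,
          hT₃.hq, h1] at hmaj
        refine runs_updateProg hT₃ hw1 hlt hI₃ h2 (by rw [hF'.word 96 rfl])
          (by rwa [hF'.word 91 rfl, hF.word 91 rfl]) (by rwa [g30])
          (by omega) (fun j' hj' v' hv' hvote => (hdec₃ j' hj' v' hv' hvote).1) hB'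
      · simp only [Test.Holds, WExpr.val_get, WExpr.val_const, WExpr.val_mul, WExpr.val_ofNat,
          hT₃.hq, h1] at hmaj
        refine hI₃.skip (Frame.refl _ _) fun j hj v hv' hvote => ?_
        obtain ⟨rfl, rfl⟩ := hdec₃ j hj v hv' hvote
        omega
  · simp only [Test.Holds, WExpr.val_get, WExpr.val_const, hT₂.hn] at hlt
    refine hI₁.skip hF fun j hj v hv hvote => ?_
    have := (hdec j v hv (hj.trans_le hn) hvote).1
    omega

theorem runs_queueProg {n q w l : ℕ} (hs : Table n q w l s) (h21 : ∀ i, s.ring 21 i = 0)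
    (hB : q ^ (l + 1) * (q + 2) + q < 2 ^ B)
    (hQ : ∀ s', Inv n q w l (s.ring 3) 0 s' → s'.word 93 0 = q ^ (l + 1) * (q + 1) →
      Frame queueProg s s' → Q s') :
    Runs B (q ^ (l + 1) * 3 + 5) queueProg s Q := by
  classical
  refine (Runs.frame (Q := fun s' => Inv n q w l (s.ring 3) 0 s' ∧
    s'.word 93 0 = q ^ (l + 1) * (q + 1)) ?_).mono le_rfl fun s' h => hQ s' h.1.1 h.1.2 h.2
  have hB' : q ^ (l + 1) * (q + 2) = q ^ (l + 1) * (q + 1) + q ^ (l + 1) := by ring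
  refine Runs.seq (N' := 3) (Runs.forTo (n := q ^ (l + 1)) (Nb := 1) (fun k s' => ∀ i < k,
    s'.word 20 i = i) hs.hv (by omega) (by simp) ?_ ?_)
  · rintro k s₁ hk h1 h90 hF
    refine Runs.setW (by simp [h90]; omega) fun i hi => ?_
    by_cases hik : i = k
    · simp [h90, hik]
    · simp [h90, hik, h1 i (by omega)]
  · rintro s₁ h1 _ hF
    have hT := hs.frame hF
    have g21 : s₁.ring 21 = s.ring 21 := hF.ring 21 rfl
    have g3 : s₁.ring 3 = s.ring 3 := hF.ring 3 rfl
    refine Runs.setW_seq ?_ (Runs.setW_seq (by simp) (Runs.setW ?_ ?_))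
    · simp only [WExpr.val_get, WExpr.val_const, hT.hv]; omega
    · simp [hT.hv, hT.hq]; omega
    set s₂ := ((s₁.writeW 91 _ _).writeW 92 _ _).writeW 93 _ _ with hs₂
    have e91 : s₂.word 91 0 = q ^ (l + 1) := by simp [hs₂, hT.hv]
    have e92 : s₂.word 92 0 = 0 := by simp [hs₂]
    have e93 : s₂.word 93 0 = q ^ (l + 1) * (q + 1) := by simp [hs₂, hT.hv, hT.hq]
    have e20 : s₂.word 20 = s₁.word 20 := by simp [hs₂, State.writeW_array]
    have e3 : s₂.ring 3 = s.ring 3 := g3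
    have e21 : ∀ i, s₂.ring 21 i = 0 := by
      intro i
      rw [← h21 i, ← g21]
      rfl
    clear_value s₂
    refine ⟨⟨fun i => ?_, fun j hj => absurd (e21 j) hj, ?_, ?_, ?_, ?_, ?_⟩, e93⟩
    · rw [e3, measure, Finset.sum_eq_zero, add_zero]
      intro j _
      simp [e21]
    · rw [e92]; simp
    · rw [e3, e92, add_zero]
    · rw [e91, e92]; simp
    · intro i hi
      rw [e91] at hi
      rw [e20, h1 i hi]; exact hi
    -- Initially every block is waiting, so no vote counts against the invariant.
    · intro j hj v hv
      rw [Finset.filter_eq_empty_iff.2, Finset.card_empty]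
      · omega
      · rintro y hy ⟨-, hy'⟩
        have hyq := Finset.mem_range.1 hy
        have hlt := vertex_lt (w := w) (j := j) (by omega : 0 < q) hyq l
        exact hy' ⟨_, Nat.zero_le _, by rw [e91]; exact hlt, by rw [e20, h1 _ hlt]⟩

/-- The list of touched columns may contain repetitions, and credited values may cancel. An entry of
the result array is set to zero once it has been written out, so each nonzero coordinate appears
exactly once. -/
theorem runs_collectProg {n N : ℕ} (h92 : s.word 92 0 = N)
    (htouched : ∀ i < N, s.word 22 i < n) (hsupp : ∀ j, s.ring 21 j ≠ 0 → ∃ i < N, s.word 22 i = j)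
    (hB : N + n + 1 < 2 ^ B) :
    Runs B (N * 8 + 4) collectProg s fun s' =>
      HoldsSparse s' 4 0 (fun j : Fin n => s.ring 21 j) := by
  classical
  refine Runs.setW_seq (N := N * 8 + 3) (by simp) ?_
  refine Runs.seq (N := N * 8 + 2) (N' := 1) (Runs.forTo (n := N) (Nb := 6) (fun k s' =>
    ∃ C, s'.word 107 0 = C ∧ C ≤ k ∧
      (∀ c < C, s.ring 21 (s'.word 4 (c + 1)) ≠ 0 ∧
        s'.ring 4 (c + 1) = s.ring 21 (s'.word 4 (c + 1)) ∧ s'.word 4 (c + 1) < n ∧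
        s'.ring 21 (s'.word 4 (c + 1)) = 0) ∧
      (∀ c < C, ∀ c' < C, s'.word 4 (c + 1) = s'.word 4 (c' + 1) → c = c') ∧
      (∀ j, (∀ c < C, s'.word 4 (c + 1) ≠ j) → s'.ring 21 j = s.ring 21 j) ∧
      ∀ i < k, s'.ring 21 (s.word 22 i) = 0) (by simpa using h92) (by omega) ⟨0, by simp⟩ ?_ ?_)
  · rintro k s₁ hk ⟨C, h1, h2, h3, h4, h5, h6⟩ h108 hF
    have g22 : s₁.word 22 = s.word 22 := by
      rw [hF.word 22 rfl]; simp [State.writeW_array]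
    have hlt := htouched k hk
    refine Runs.setW_seq (N := 5) (by simp [h108, g22]; omega) ?_
    set s₂ := s₁.writeW 109 _ _ with hs₂
    have e109 : s₂.word 109 0 = s.word 22 k := by simp [hs₂, h108, g22]
    have e107 : s₂.word 107 0 = C := by simp [hs₂, h1]
    have e4 : s₂.word 4 = s₁.word 4 := by simp [hs₂, State.writeW_array]
    have er : s₂.ring = s₁.ring := rfl
    clear_value s₂
    rw [← e4, ← er] at h3 h5
    rw [← e4] at h4
    rw [← er] at h6
    have htest : (Test.req (.get 21 (.reg 109)) .zero).Holds s₂ ↔ s₂.ring 21 (s.word 22 k) = 0 := by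
      simp [Test.Holds, RExpr.val, e109]
    refine Runs.ite (N := 4) (fun h => Runs.skip ⟨C, by simpa using e107, by omega, ?_⟩) (fun h => ?_)
    · rw [htest] at h
      refine ⟨by simpa using h3, by simpa using h4, by simpa using h5, fun i hi => ?_⟩
      rcases Nat.lt_succ_iff_lt_or_eq.1 hi with hi | rfl
      · exact h6 i hi
      · exact h
    · rw [htest] at h
      -- Indices already written out have value zero in array 21; a nonzero value there marks a new
      -- index.
      have hnew : ∀ c < C, s₂.word 4 (c + 1) ≠ s.word 22 k := by
        intro c hc he
        exact h (he ▸ (h3 c hc).2.2.2)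
      have hval := h5 _ hnew
      refine Runs.setW_seq (by simp [e107]; omega) (Runs.setW_seq (by simp [e109]; omega)
        (Runs.setR_seq (Runs.setR ?_)))
      set s₃ := (((s₂.writeW 107 _ _).writeW 4 _ _).writeR 4 _ _).writeR 21 _ _ with hs₃
      have f107 : s₃.word 107 0 = C + 1 := by simp [hs₃, e107]
      have f4 : ∀ i, s₃.word 4 i = if i = C + 1 then s.word 22 k else s₂.word 4 i := by
        intro i; by_cases hi : i = C + 1 <;> simp [hs₃, e107, e109, hi]
      have fr4 : ∀ i, s₃.ring 4 i = if i = C + 1 then s.ring 21 (s.word 22 k) else s₂.ring 4 i := by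
        intro i; by_cases hi : i = C + 1 <;> simp [hs₃, e107, e109, hi, RExpr.val, hval]
      have fr21 : ∀ i, s₃.ring 21 i = if i = s.word 22 k then 0 else s₂.ring 21 i := by
        intro i; by_cases hi : i = s.word 22 k <;> simp [hs₃, e109, hi, RExpr.val]
      clear_value s₃
      rw [hval] at h
      have fold : ∀ c < C, s₃.word 4 (c + 1) = s₂.word 4 (c + 1) := fun c hc => by
        rw [f4, if_neg (by omega)]
      have fnew : s₃.word 4 (C + 1) = s.word 22 k := by rw [f4, if_pos rfl]
      refine ⟨C + 1, by simpa using f107, by omega, fun c hc => ?_, fun c hc c' hc' he => ?_,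
        fun j hj => ?_, fun i hi => ?_⟩
      · simp only [State.writeW_word, Nat.reduceEqDiff, false_and, if_false, State.writeW_ring]
        rcases Nat.lt_succ_iff_lt_or_eq.1 hc with hc | rfl
        · obtain ⟨a1, a2, a3, a4⟩ := h3 c hc
          rw [fold c hc, fr4, if_neg (by omega), fr21, if_neg (hnew c hc)]
          exact ⟨a1, a2, a3, a4⟩
        · rw [fnew, fr4, if_pos rfl, fr21, if_pos rfl]
          exact ⟨h, rfl, hlt, rfl⟩
      · simp only [State.writeW_word, Nat.reduceEqDiff, false_and, if_false] at he
        rcases Nat.lt_succ_iff_lt_or_eq.1 hc with hc | rfl <;>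
          rcases Nat.lt_succ_iff_lt_or_eq.1 hc' with hc' | rfl
        · rw [fold c hc, fold c' hc'] at he
          exact h4 c hc c' hc' he
        · rw [fold c hc, fnew] at he
          exact absurd he (hnew c hc)
        · rw [fold c' hc', fnew] at he
          exact absurd he.symm (hnew c' hc')
        · rfl
      · simp only [State.writeW_word, Nat.reduceEqDiff, false_and, if_false, State.writeW_ring]
          at hj ⊢
        rw [fr21, if_neg]
        · exact h5 j fun c hc => by rw [← fold c hc]; exact hj c (by omega)
        · rintro rfl
          exact hj C (by omega) fnew
      · simp only [State.writeW_ring]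
        rw [fr21]
        split_ifs with hik
        · rfl
        · refine h6 i ?_
          have : i ≠ k := by rintro rfl; exact hik rfl
          omega
  · rintro s₁ ⟨C, h1, h2, h3, h4, h5, h6⟩ _ hF
    refine Runs.setW (by simp [h1]; omega) ?_
    refine holdsSparse_of C (fun c => s₁.word 4 (c + 1)) (fun c hc => ⟨(h3 c hc).2.2.1, (h3 c hc).1⟩)
      h4 (fun j hj => ?_) (by simp [h1]) (fun c hc => ?_) (fun c hc hlt => ?_)
    · by_contra! hne
      obtain ⟨i, hi, he⟩ := hsupp j hj
      have := h6 i hi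
      rw [he, h5 j hne] at this
      exact hj this
    · simp [add_comm 1 c]
    · simp [add_comm 1 c, (h3 c hc).2.1]

/-- No assumption is made on the measurement vector, so the step bound covers inputs that are not
measurements of a sparse vector. Correctness is reduced to a result `x` and a residual `A` in which
no column has a majority. -/
theorem runs_recProg {n q w l : ℕ} (hs : Table n q w l s) (hw1 : 1 ≤ w)
    (hn : n ≤ 2 ^ w) (h21 : ∀ i, s.ring 21 i = 0)
    (hB : n * (q * w + 1) + w + 2 * q + 2 + q ^ (l + 1) * w * 2 < 2 ^ B)
    (hB' : q ^ (l + 1) * (q + 2) + q + w + n + 2 < 2 ^ B) (hB'' : w + 2 ^ (w + 1) < 2 ^ B) :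
    Runs B (q ^ (l + 1) * (q + 1) * (q * (w * 10 + 12) + w * 5 + 40) + 20) recProg s fun s' =>
      ∃ x A : ℕ → R, HoldsSparse s' 4 0 (fun j : Fin n => x j) ∧
        (∀ i, A i + measure q w l n x i = s.ring 3 i) ∧
        (∃ T : Finset ℕ, T.card ≤ busyCount w (q ^ (l + 1)) (s.ring 3) ∧ ∀ j, x j ≠ 0 → j ∈ T) ∧
        ∀ j < n, ∀ v : R, v ≠ 0 → 2 * voteCount q w l A j v ≤ q := by
  have hM : q ^ (l + 1) * (q + 2) = q ^ (l + 1) * (q + 1) + q ^ (l + 1) := by ring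
  have hMM : q ^ (l + 1) ≤ q ^ (l + 1) * (q + 1) := Nat.le_mul_of_pos_right _ (by omega)
  set z := s.ring 3 with hz
  refine Runs.le (N := q ^ (l + 1) * 3 + 5 +
    ((q ^ (l + 1) * (q + 1) * ((q * (w * 10 + 12) + w * 5 + 21) + 2) + 2) +
      (q ^ (l + 1) * 8 + 4))) ?_ ?_
  swap
  · have : q ^ (l + 1) * (q + 1) * (q * (w * 10 + 12) + w * 5 + 40) =
      q ^ (l + 1) * (q + 1) * (q * (w * 10 + 12) + w * 5 + 21 + 2) +
        q ^ (l + 1) * (q + 1) * 17 := by ring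
    omega
  refine Runs.seq (runs_queueProg hs h21 (by omega) fun s₁ hI h93 hF => Runs.seq ?_)
  have hT₁ := hs.frame hF
  refine Runs.forTo (n := q ^ (l + 1) * (q + 1)) (Nb := q * (w * 10 + 12) + w * 5 + 21)
    (fun k s' => Inv n q w l z k s') h93 (by omega) ?_ ?_ ?_
  · exact hI.congr rfl rfl (by simp [State.writeW_array]) (by simp [State.writeW_array])
      (by simp [State.writeW_array]) (by simp [State.writeW_array])
  · rintro k s₂ hk hI₂ h94 hF'
    have hT₂ := hT₁.frame hF'
    refine Runs.ite (N := q * (w * 10 + 12) + w * 5 + 20) (fun h => ?_) (fun h => Runs.skip ?_)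
    · simp only [Test.Holds, WExpr.val_get, WExpr.val_const, h94] at h
      refine (runs_examineProg hT₂ hw1 hn hI₂ h94 h hB hB' hB'').mono le_rfl fun s₃ hI₃ => ?_
      exact hI₃.congr rfl rfl (by simp [State.writeW_array]) (by simp [State.writeW_array])
        (by simp [State.writeW_array]) (by simp [State.writeW_array])
    · simp only [Test.Holds, WExpr.val_get, WExpr.val_const, h94] at h
      have hI₃ : Inv n q w l z (k + 1) s₂ := by
        obtain ⟨k1, k2, k3, k4, k5, k6, k7⟩ := hI₂
        refine ⟨k1, k2, k3, k4, k5, k6, ?_⟩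
        convert k7 using 2
        ext r
        constructor <;> rintro ⟨i, h1, h2, -⟩ <;> omega
      exact hI₃.congr rfl rfl (by simp [State.writeW_array]) (by simp [State.writeW_array])
        (by simp [State.writeW_array]) (by simp [State.writeW_array])
  · rintro s₂ hI₂ - -
    obtain ⟨k1, k2, k3, k4, k5, k6, k7⟩ := hI₂
    -- There are at most `q ^ (l + 1)` updates, each of which lengthens the queue by `q`. The fixed
    -- number of rounds thus reaches the end of the queue.
    have hz' := busyCount_le_self w (q ^ (l + 1)) z
    have htail : s₂.word 91 0 ≤ q ^ (l + 1) * (q + 1) := by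
      have : q * s₂.word 92 0 ≤ q * q ^ (l + 1) := Nat.mul_le_mul_left _ (by omega)
      rw [k5]; nlinarith
    refine (runs_collectProg rfl k3 k2 (by omega)).mono (by omega) fun s₃ h => ?_
    refine ⟨s₂.ring 21, s₂.ring 3, h, k1, ⟨(Finset.range (s₂.word 92 0)).image (s₂.word 22),
      Finset.card_image_le.trans (by rw [Finset.card_range]; omega), fun j hj => ?_⟩, ?_⟩
    · obtain ⟨i, hi, he⟩ := k2 j hj
      exact Finset.mem_image.2 ⟨i, Finset.mem_range.2 hi, he⟩
    -- No block is waiting any more, so the invariant turns into a bound on all votes.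
    · classical
      intro j hj v hv
      refine le_trans (le_of_eq ?_) (k7 j hj v hv)
      rw [voteCount]
      congr 2
      refine Finset.filter_congr fun y _ => ?_
      refine ⟨fun h => ⟨h, ?_⟩, fun h => h.1⟩
      rintro ⟨i, h1, h2, -⟩
      omega

end

end CompressedSensing

/-! ### Size of the parameters and of the words. -/

namespace CompressedSensing

open RingRAM

/-! ### Bounds for the parameters -/

/-- The parameters computed by the measurement algorithm. -/
structure Params (a n t w h q l : ℕ) : Prop where
  hw : w = n.size + 6
  hh : h = (4 * w * w) ^ a
  prime : q.Prime
  lt : 2 * h * w * w < q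
  le : q ≤ 2 * (2 * h * w * w)
  hl : l + 1 ≤ w
  ht : t * q * (q + 1) < h ^ (l + 1)
  ht' : h ^ l ≤ t * q * (q + 1)

theorem four_mul_le_cube {w : ℕ} (hw : 4 ≤ w) : 4 * w * w ≤ w ^ 3 := by
  calc 4 * w * w ≤ w * w * w := by gcongr
    _ = w ^ 3 := by ring

theorem height_le {a w : ℕ} (hw : 4 ≤ w) : 4 * (4 * w * w) ^ a * w * w ≤ w ^ (3 * a + 3) := by
  calc 4 * (4 * w * w) ^ a * w * w = (4 * w * w) ^ a * (4 * w * w) := by ring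
    _ ≤ (w ^ 3) ^ a * w ^ 3 :=
        Nat.mul_le_mul (Nat.pow_le_pow_left (four_mul_le_cube hw) _) (four_mul_le_cube hw)
    _ = w ^ (3 * a + 3) := by rw [← pow_mul, ← pow_add]

/-- The word length with which the algorithms work. -/
def wordLength (a w : ℕ) : ℕ := 10 * ((3 * a + 3) * w ^ 2)

theorem two_pow_wordLength (a w : ℕ) :
    2 ^ wordLength a w = (2 ^ ((3 * a + 3) * w ^ 2)) ^ 10 := by
  rw [wordLength, ← pow_mul, mul_comm]

theorem wordLength_base {a w : ℕ} : (w ^ (3 * a + 3)) ^ w ≤ 2 ^ ((3 * a + 3) * w ^ 2) := by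
  calc (w ^ (3 * a + 3)) ^ w ≤ ((2 ^ w) ^ (3 * a + 3)) ^ w := by
        gcongr; exact Nat.lt_two_pow_self.le
    _ = 2 ^ ((3 * a + 3) * w ^ 2) := by rw [← pow_mul, ← pow_mul]; congr 1; ring

/-- With `Z = 2 ^ ((3 * a + 3) * w ^ 2)` all parameters are at most `Z`, and the words are bounded
by small polynomials in `Z`. The tenth power in `wordLength` leaves ample room for these. -/
theorem lt_pow_ten {Z : ℕ} (hZ : 100 ≤ Z) : 90 * Z ^ 7 < Z ^ 10 := by
  have h7 : 0 < Z ^ 7 := by positivity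
  calc 90 * Z ^ 7 < 100 * Z ^ 7 := by omega
    _ ≤ Z ^ 3 * Z ^ 7 := by gcongr; exact hZ.trans (Nat.le_self_pow (by omega) Z)
    _ = Z ^ 10 := by ring

theorem le_wordLength_base {a w : ℕ} (hw : 7 ≤ w) :
    100 ≤ 2 ^ ((3 * a + 3) * w ^ 2) ∧ 2 ^ (w + 1) ≤ 2 ^ ((3 * a + 3) * w ^ 2) ∧
      w ≤ 2 ^ ((3 * a + 3) * w ^ 2) := by
  have h2 : 2 ^ (w + 1) ≤ 2 ^ ((3 * a + 3) * w ^ 2) := by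
    refine Nat.pow_le_pow_right two_pos ?_
    calc w + 1 ≤ 1 * w ^ 2 := by nlinarith
      _ ≤ _ := by gcongr; omega
  have h3 : 2 ^ 8 ≤ 2 ^ (w + 1) := Nat.pow_le_pow_right two_pos (by omega)
  have h4 : w + 1 < 2 ^ (w + 1) := Nat.lt_two_pow_self
  omega

/-- The search for `m` succeeds within `w` rounds: `t < h ^ n.size`, and the `6` extra factors `h`
in `h ^ w` absorb `q * (q + 1) ≤ 2 * h ^ 4`. -/
theorem length_bound {a n t w h q : ℕ} (ha : 1 ≤ a) (htn : t ≤ n)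
    (hw : w = n.size + 6) (hh : h = (4 * w * w) ^ a) (hq : q ≤ 2 * (2 * h * w * w)) :
    t * q * (q + 1) < h ^ w := by
  have hX : 4 * w * w ≤ h := hh ▸ Nat.le_self_pow (by omega) _
  have h4 : 4 ≤ h := by nlinarith
  have hqh : q ≤ h * h := by
    calc q ≤ 2 * (2 * h * w * w) := hq
      _ = h * (4 * w * w) := by ring
      _ ≤ h * h := by gcongr
  have ht : t < h ^ n.size := (htn.trans_lt (Nat.lt_size_self n)).trans_le
    (Nat.pow_le_pow_left (by omega) _)
  have hpos : 0 < h ^ n.size := by positivity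
  calc t * q * (q + 1) ≤ h ^ n.size * (h * h) * (h * h + h * h) := by
        gcongr; nlinarith
    _ = h ^ n.size * (2 * h ^ 4) := by ring
    _ < h ^ n.size * (h * h ^ 4) := by
        have : 0 < h ^ 4 := by positivity
        gcongr; omega
    _ ≤ h ^ n.size * h ^ 6 := by
        gcongr
        rw [← pow_succ']
        exact Nat.pow_le_pow_right (by omega) (by omega)
    _ = h ^ w := by rw [hw, pow_add]

theorem Params.bounds {a n t w h q l : ℕ} (hp : Params a n t w h q l) :
    q ≤ w ^ (3 * a + 3) ∧ n < 2 ^ w := by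
  refine ⟨?_, ?_⟩
  · refine hp.le.trans (le_trans (le_of_eq ?_) (height_le (by have := hp.hw; omega)))
    rw [hp.hh]; ring
  · exact (Nat.lt_size_self n).trans_le (Nat.pow_le_pow_right two_pos (by rw [hp.hw]; omega))

/-- All words that occur are short. -/
theorem Params.words {a n t w h q l : ℕ} (hp : Params a n t w h q l) (hw : 7 ≤ w) :
    ∃ Z : ℕ, 100 ≤ Z ∧ 2 ^ wordLength a w = Z ^ 10 ∧ n ≤ Z ∧ w ≤ Z ∧ q ≤ Z ∧ 2 ^ (w + 1) ≤ Z ∧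
      q ^ (l + 1) ≤ Z := by
  obtain ⟨h1, h2, h3⟩ := le_wordLength_base (a := a) hw
  obtain ⟨hq, hn⟩ := hp.bounds
  have h4 : q ^ w ≤ 2 ^ ((3 * a + 3) * w ^ 2) := (Nat.pow_le_pow_left hq _).trans wordLength_base
  have h5 : q ^ (l + 1) ≤ q ^ w := Nat.pow_le_pow_right hp.prime.pos hp.hl
  have h6 : q ≤ q ^ w := Nat.le_self_pow (by omega) _
  have h7 : 2 ^ (w + 1) = 2 ^ w * 2 := pow_succ _ _
  exact ⟨_, h1, two_pow_wordLength a w, by omega, h3, by omega, h2, by omega⟩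

theorem Params.table_bound {a n t w h q l : ℕ} (hp : Params a n t w h q l) (hw : 7 ≤ w) :
    n * (q * w + 1) + q ^ (l + 1) * w * 2 + q * w + q + w + n + 2 < 2 ^ wordLength a w := by
  obtain ⟨Z, hZ, hB, hn, hwZ, hq, -, hv⟩ := hp.words hw
  rw [hB]
  refine lt_of_le_of_lt ?_ (lt_pow_ten hZ)
  have e1 : 1 ≤ Z := by omega
  have h := fun i (hi : i ≤ 7) => Nat.pow_le_pow_right e1 hi
  have h0 := h 0 (by omega); have h1 := h 1 (by omega); have h2 := h 2 (by omega)
  have h3 := h 3 (by omega)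
  calc n * (q * w + 1) + q ^ (l + 1) * w * 2 + q * w + q + w + n + 2
      ≤ Z * (Z * Z + 1) + Z * Z * 2 + Z * Z + Z + Z + Z + 2 := by gcongr
    _ = Z ^ 3 + 3 * Z ^ 2 + 4 * Z ^ 1 + 2 * Z ^ 0 := by ring
    _ ≤ 90 * Z ^ 7 := by omega

theorem Params.rec_bound {a n t w h q l : ℕ} (hp : Params a n t w h q l) (hw : 7 ≤ w) :
    n * (q * w + 1) + w + 2 * q + 2 + q ^ (l + 1) * w * 2 < 2 ^ wordLength a w ∧
      q ^ (l + 1) * (q + 2) + q + w + n + 2 < 2 ^ wordLength a w ∧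
      w + 2 ^ (w + 1) < 2 ^ wordLength a w ∧
      n * (q * w + 1) + q * w + n < 2 ^ wordLength a w := by
  obtain ⟨Z, hZ, hB, hn, hwZ, hq, h2w, hv⟩ := hp.words hw
  rw [hB]
  have e1 : 1 ≤ Z := by omega
  have h := fun i (hi : i ≤ 7) => Nat.pow_le_pow_right e1 hi
  have h0 := h 0 (by omega); have h1 := h 1 (by omega); have h2 := h 2 (by omega)
  have h3 := h 3 (by omega)
  refine ⟨lt_of_le_of_lt ?_ (lt_pow_ten hZ), lt_of_le_of_lt ?_ (lt_pow_ten hZ),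
    lt_of_le_of_lt ?_ (lt_pow_ten hZ), lt_of_le_of_lt ?_ (lt_pow_ten hZ)⟩
  · calc n * (q * w + 1) + w + 2 * q + 2 + q ^ (l + 1) * w * 2
        ≤ Z * (Z * Z + 1) + Z + 2 * Z + 2 + Z * Z * 2 := by gcongr
      _ = Z ^ 3 + 2 * Z ^ 2 + 4 * Z ^ 1 + 2 * Z ^ 0 := by ring
      _ ≤ 90 * Z ^ 7 := by omega
  · calc q ^ (l + 1) * (q + 2) + q + w + n + 2 ≤ Z * (Z + 2) + Z + Z + Z + 2 := by gcongr
      _ = Z ^ 2 + 5 * Z ^ 1 + 2 * Z ^ 0 := by ring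
      _ ≤ 90 * Z ^ 7 := by omega
  · calc w + 2 ^ (w + 1) ≤ Z + Z := by gcongr
      _ = 2 * Z ^ 1 := by ring
      _ ≤ 90 * Z ^ 7 := by omega
  · calc n * (q * w + 1) + q * w + n ≤ Z * (Z * Z + 1) + Z * Z + Z := by gcongr
      _ = Z ^ 3 + Z ^ 2 + 2 * Z ^ 1 := by ring
      _ ≤ 90 * Z ^ 7 := by omega

theorem Params.card_bound {a n t w h q l α : ℕ} (hp : Params a n t w h q l) (ha : 1 ≤ a)
    (hw : 7 ≤ w) (hα : α = w ^ (3 * a + 3)) : (q ^ l) ^ a ≤ (t * α ^ 3) ^ (a + 1) := by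
  obtain ⟨hq, -⟩ := hp.bounds
  rw [← hα] at hq
  have hα2 : 2 ≤ α := by
    rw [hα]; exact (by omega : 2 ≤ w).trans (Nat.le_self_pow (by omega) _)
  -- Since `h = (4 * w * w) ^ a`, this says `q ^ a ≤ h ^ (a + 1)`. It is the source of the exponent
  -- `1 + 1 / a`.
  have hqX : q ≤ (4 * w * w) ^ (a + 1) := by
    refine hp.le.trans (le_of_eq ?_)
    rw [hp.hh]; ring
  have hT : t * q * (q + 1) ≤ t * α ^ 3 := by
    calc t * q * (q + 1) ≤ t * α * (α + α) := by gcongr; omega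
      _ = t * (2 * α ^ 2) := by ring
      _ ≤ t * (α * α ^ 2) := by gcongr
      _ = t * α ^ 3 := by ring
  calc (q ^ l) ^ a ≤ (((4 * w * w) ^ (a + 1)) ^ l) ^ a := by gcongr
    _ = (h ^ l) ^ (a + 1) := by rw [hp.hh, ← pow_mul, ← pow_mul, ← pow_mul, ← pow_mul]; congr 1; ring
    _ ≤ (t * α ^ 3) ^ (a + 1) := Nat.pow_le_pow_left (hp.ht'.trans hT) _

theorem Params.card_le {a n t w h q l : ℕ} {α : ℝ} (hp : Params a n t w h q l) (ha : 1 ≤ a)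
    (hw : 7 ≤ w) (ht : 1 ≤ t) (hα : 1 ≤ α * a) :
    ((q ^ (l + 1) : ℕ) : ℝ) ≤ (t : ℝ) ^ (1 + α) * ((w ^ (3 * a + 3)) ^ 7 : ℕ) := by
  have hb := hp.card_bound ha hw rfl
  obtain ⟨hq, -⟩ := hp.bounds
  set V := w ^ (3 * a + 3) with hV
  have hV1 : 1 ≤ V := Nat.one_le_pow _ _ (by omega)
  have ht1 : (1 : ℝ) ≤ t := by exact_mod_cast ht
  have hV1' : (1 : ℝ) ≤ V := by exact_mod_cast hV1
  -- The `a`-th root of `Params.card_bound`: `a + 1 ≤ (1 + α) * a` because `1 ≤ α * a`, and `3 * (a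
  -- + 1) ≤ 6 * a`. The last factor of `q ^ (l + 1)` costs one more power of `V`.
  have key : ((q : ℝ) ^ l) ≤ (t : ℝ) ^ (1 + α) * (V : ℝ) ^ 6 := by
    refine le_of_pow_le_pow_left₀ (n := a) (by omega) (by positivity) ?_
    calc ((q : ℝ) ^ l) ^ a ≤ ((t : ℝ) * (V : ℝ) ^ 3) ^ (a + 1) := by exact_mod_cast hb
      _ = (t : ℝ) ^ ((a + 1 : ℕ) : ℝ) * (V : ℝ) ^ (3 * (a + 1)) := by
        rw [mul_pow, ← pow_mul, Real.rpow_natCast]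
      _ ≤ (t : ℝ) ^ ((1 + α) * a) * (V : ℝ) ^ (6 * a) := by
        refine mul_le_mul (Real.rpow_le_rpow_of_exponent_le ht1 ?_)
          (pow_le_pow_right₀ hV1' (by omega)) (by positivity) (by positivity)
        push_cast; linarith
      _ = ((t : ℝ) ^ (1 + α) * (V : ℝ) ^ 6) ^ a := by
        rw [mul_pow, ← pow_mul, Real.rpow_mul (by positivity), Real.rpow_natCast]
  calc ((q ^ (l + 1) : ℕ) : ℝ) = (q : ℝ) ^ l * q := by push_cast; ring
    _ ≤ (t : ℝ) ^ (1 + α) * (V : ℝ) ^ 6 * V := by gcongr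
    _ = _ := by push_cast; ring

/-- For `n ≥ 1` the logarithm `L` is at least `1`, so `n.size + 6 ≤ L + 7 ≤ 8 * L`. The constant `8
^ d` has to serve as factor and as exponent, and `d ≤ 8 ^ d`. -/
theorem pow_le_polylog {n : ℕ} (hn : 1 ≤ n) (d : ℕ) :
    (((n.size + 6) ^ d : ℕ) : ℝ) ≤ polylog (8 ^ d) n := by
  have hn0 : n ≠ 0 := by omega
  have h1 : (1 : ℝ) ≤ Real.logb 2 (n + 1) := by
    rw [Real.le_logb_iff_rpow_le one_lt_two (by positivity)]
    have : (1 : ℝ) ≤ n := by exact_mod_cast hn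
    norm_num; linarith
  have h2 : (n.size : ℝ) ≤ Real.logb 2 (n + 1) + 1 := by
    have hpow : 2 ^ (n.size - 1) ≤ n := by
      have := Nat.lt_size.1 (show n.size - 1 < n.size by have := Nat.size_pos.2 hn; omega)
      exact this
    have : ((n.size - 1 : ℕ) : ℝ) ≤ Real.logb 2 (n + 1) := by
      rw [Real.le_logb_iff_rpow_le one_lt_two (by positivity), Real.rpow_natCast]
      have : ((2 ^ (n.size - 1) : ℕ) : ℝ) ≤ n := by exact_mod_cast hpow
      push_cast at this; linarith
    rw [Nat.cast_sub (Nat.size_pos.2 hn)] at this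
    push_cast at this; linarith
  set L := Real.logb 2 (n + 1) with hL
  have hd : d ≤ 8 ^ d := (Nat.lt_pow_self (by norm_num)).le
  calc (((n.size + 6) ^ d : ℕ) : ℝ) = ((n.size : ℝ) + 6) ^ d := by push_cast; rfl
    _ ≤ (8 * L) ^ d := by gcongr; linarith
    _ = ((8 ^ d : ℕ) : ℝ) * L ^ d := by rw [mul_pow]; push_cast; rfl
    _ ≤ ((8 ^ d : ℕ) : ℝ) * L ^ (8 ^ d) := by gcongr
    _ = polylog (8 ^ d) n := rfl

theorem polylog_mono {c n n' : ℕ} (h : n ≤ n') : polylog c n ≤ polylog c n' := by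
  have h0 : 0 ≤ Real.logb 2 (n + 1) := Real.logb_nonneg one_lt_two (by linarith [n.cast_nonneg (α := ℝ)])
  have h1 : Real.logb 2 (n + 1) ≤ Real.logb 2 (n' + 1) :=
    Real.logb_le_logb_of_le one_lt_two (by positivity) (by gcongr)
  unfold polylog
  gcongr

theorem polylog_nonneg (c n : ℕ) : 0 ≤ polylog c n :=
  mul_nonneg (Nat.cast_nonneg _) (pow_nonneg
    (Real.logb_nonneg one_lt_two (by linarith [n.cast_nonneg (α := ℝ)])) _)

end CompressedSensing

/-! ### Analysis of the measurement algorithm. -/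

namespace CompressedSensing

open RingRAM

/-- The measurement algorithm. -/
def measureProg (a : ℕ) : Prog := sizeProg ;; primeProg a ;; lengthProg ;; tableProg

section

variable {R : Type*} [Ring R]

theorem bounded_initial {n t B : ℕ} (hn : n < 2 ^ B) (ht : t < 2 ^ B) :
    Bounded B (initial R n t) := by
  intro a i _ _
  simp only [initial]
  split_ifs <;> first | assumption | positivity

theorem measure_steps {n w N V : ℕ} (hn : 1 ≤ n) (hV7 : 7 ≤ V) (hw : w ≤ V) (hN : 2 * N ≤ V) :
    n * 5 + 4 + (N * (2 * N * 4 + 10) + 4 + (w * 6 + 7 +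
      (n * (V * (w * 9 + w * (w * 5 + 7) + 11) + 6) + 2))) ≤ n * V ^ 6 := by
  have hVi := fun i j (hi : i ≤ j) => Nat.pow_le_pow_right (show 0 < V by omega) hi
  have k1 := hVi 1 3 (by omega)
  have k2 := hVi 2 3 (by omega)
  have k0 := hVi 0 3 (by omega)
  have h1 : N * (2 * N * 4 + 10) ≤ V * (V * 4 + 10) := by gcongr; omega
  have h2 : V * (w * 9 + w * (w * 5 + 7) + 11) ≤ V * (V * 9 + V * (V * 5 + 7) + 11) := by gcongr
  have hn1 : ∀ x, x ≤ n * x := fun x => Nat.le_mul_of_pos_left x hn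
  calc _ ≤ n * 5 + 4 + (V * (V * 4 + 10) + 4 + (V * 6 + 7 +
          (n * (V * (V * 9 + V * (V * 5 + 7) + 11) + 6) + 2))) := by gcongr
    _ = n * 5 + n * (V * (V * 9 + V * (V * 5 + 7) + 11) + 6) +
          (4 * V ^ 2 + 16 * V ^ 1 + 17 * V ^ 0) := by ring
    _ ≤ n * 5 + n * (V * (V * 9 + V * (V * 5 + 7) + 11) + 6) +
          n * (4 * V ^ 2 + 16 * V ^ 1 + 17 * V ^ 0) := by gcongr; exact hn1 _
    _ = n * (5 * V ^ 3 + 20 * V ^ 2 + 27 * V ^ 1 + 28 * V ^ 0) := by ring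
    _ ≤ n * (80 * V ^ 3) := Nat.mul_le_mul_left _ (by omega)
    _ ≤ n * (V ^ 3 * V ^ 3) := by
        have : 7 ^ 3 ≤ V ^ 3 := Nat.pow_le_pow_left hV7 3
        exact Nat.mul_le_mul_left _ (Nat.mul_le_mul_right _ (by omega))
    _ = n * V ^ 6 := by ring

theorem runs_measureProg {a n t : ℕ} (ha : 1 ≤ a) (ht : 1 ≤ t) (htn : t ≤ n) :
    Runs (wordLength a (n.size + 6)) (n * ((n.size + 6) ^ (3 * a + 3)) ^ 6) (measureProg a)
      (initial R n t) fun s' => ∃ h q l, Params a n t (n.size + 6) h q l ∧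
        Table n q (n.size + 6) l s' := by
  have hw7 : 7 ≤ n.size + 6 := by have := Nat.size_pos.2 (show 0 < n by omega); omega
  obtain ⟨w, hw⟩ : ∃ w, w = n.size + 6 := ⟨_, rfl⟩
  obtain ⟨h, hh⟩ : ∃ h, h = (4 * w * w) ^ a := ⟨_, rfl⟩
  obtain ⟨N, hN⟩ : ∃ N, N = 2 * h * w * w := ⟨_, rfl⟩
  rw [← hw] at hw7 ⊢
  have hh1 : 1 ≤ h := hh ▸ Nat.one_le_pow _ _ (by positivity)
  have hN1 : 1 ≤ N := by rw [hN]; exact Nat.one_le_iff_ne_zero.2 (by positivity)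
  obtain ⟨z1, z2, z3⟩ := le_wordLength_base (a := a) hw7
  have zV := wordLength_base (a := a) (w := w)
  have zB := two_pow_wordLength a w
  have hnw : n < 2 ^ w := (Nat.lt_size_self n).trans_le
    (Nat.pow_le_pow_right two_pos (by omega))
  have hhV : 4 * h * w * w ≤ w ^ (3 * a + 3) := hh ▸ height_le (by omega)
  obtain ⟨V, hV⟩ : ∃ V, V = w ^ (3 * a + 3) := ⟨_, rfl⟩
  obtain ⟨Z, hZ⟩ : ∃ Z, Z = 2 ^ ((3 * a + 3) * w ^ 2) := ⟨_, rfl⟩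
  rw [← hV] at hhV zV ⊢
  rw [← hZ] at z1 z2 z3 zV zB
  have hVZ : V ≤ Z := (Nat.le_self_pow (by omega) _).trans zV
  have hNV : 2 * N ≤ V := by rw [hN]; linarith
  have hhN : h ≤ N := by
    rw [hN, mul_assoc, mul_comm 2 h, mul_assoc]
    exact Nat.le_mul_of_pos_right _ (by positivity)
  have hwV : w ≤ V := hV ▸ Nat.le_self_pow (by omega) _
  have hlt := lt_pow_ten z1
  have e1 : 1 ≤ Z := by omega
  have hZi := fun i (hi : i ≤ 7) => Nat.pow_le_pow_right e1 hi
  have hZ2 := hZi 2 (by omega)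
  have hZ12 : Z ≤ Z ^ 2 := Nat.le_self_pow (by omega) Z
  have hwn : 2 ^ (w + 1) = 2 ^ w * 2 := pow_succ _ _
  have hV7 : 7 ≤ V := hw7.trans hwV
  have hsteps := measure_steps (n := n) (by omega) hV7 hwV hNV
  refine Runs.le ?_ hsteps
  refine Runs.seq (runs_sizeProg (n := n) (by simp [initial]) (by omega) fun s₁ h10 hF₁ => ?_)
  refine Runs.seq (runs_primeProg (a := a) (h10.trans hw.symm) hh hN hN1 (by omega)
    fun s₂ h42 hprime hgt hle hF₂ => ?_)
  obtain ⟨q, hq⟩ : ∃ q, q = s₂.word 11 0 := ⟨_, rfl⟩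
  rw [← hq] at hprime hgt hle
  have hqV : q ≤ V := hle.trans hNV
  have hT := length_bound ha htn hw hh (q := q) (by omega)
  have hT1 : 1 ≤ t * q * (q + 1) := Nat.one_le_iff_ne_zero.2 (by have := hprime.pos; positivity)
  have g10 : s₂.word 10 0 = w := by rw [hF₂.word 10 rfl, h10, hw]
  have g0 : s₂.word 0 = (initial R n t).word 0 := by rw [hF₂.word 0 rfl, hF₁.word 0 rfl]
  have hhw : h ^ w ≤ Z := (Nat.pow_le_pow_left (by omega) _).trans zV
  have hqw : q ^ w ≤ Z := (Nat.pow_le_pow_left hqV _).trans zV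
  refine Runs.seq (runs_lengthProg (D := Z ^ 2) g10 hq.symm h42 (t := t) (by simp [g0, initial]) rfl
    hT1 hT hprime.one_lt.le ?_ (by omega) (by omega) fun s₃ m hm1 hmw h12 h13 hm2 hm3 hF₃ => ?_)
  · rw [pow_two]; exact Nat.mul_le_mul (hT.le.trans hhw) (by omega)
  obtain ⟨l, rfl⟩ : ∃ l, m = l + 1 := ⟨m - 1, by omega⟩
  rw [Nat.add_sub_cancel] at h12 hm3
  have hp : Params a n t w h q l := ⟨hw, hh, hprime, by omega, by omega, hmw, hm2, hm3⟩
  have f10 : s₃.word 10 0 = w := by rw [hF₃.word 10 rfl, g10]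
  have f11 : s₃.word 11 0 = q := by rw [hF₃.word 11 rfl, hq]
  have f0 : s₃.word 0 0 = n := by rw [hF₃.word 0 rfl, g0]; simp [initial]
  refine (runs_tableProg (by omega) hprime.two_le f0 f10 f11 h12 (fun b => ?_)
    (hp.table_bound hw7) fun s₄ k1 k2 hF₄ => ?_).le ?_
  · rw [hF₃.word 57 rfl, hF₂.word 57 rfl, hF₁.word 57 rfl]; simp [initial]
  · refine ⟨h, q, l, hp, ?_, ?_, ?_, ?_, k1, k2⟩
    · rw [hF₄.word 0 rfl, f0]
    · rw [hF₄.word 10 rfl, f10]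
    · rw [hF₄.word 11 rfl, f11]
    · rw [hF₄.word 13 rfl, h13]
  · have : l ≤ w := by omega
    gcongr

end

end CompressedSensing

/-! ### Correctness and cost of recovery and multiplication. -/

namespace CompressedSensing

open RingRAM

section

variable {R : Type*} [Ring R]

/-! ### Correctness of recovery -/

/-- Extension of a vector by zeros. -/
def extend {n : ℕ} (x : Fin n → R) (j : ℕ) : R := if h : j < n then x ⟨j, h⟩ else 0

theorem extend_val {n : ℕ} (x : Fin n → R) (j : Fin n) : extend x j = x j := by
  simp [extend]

open Classical in
theorem card_extend_le {n : ℕ} (x : Fin n → R) :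
    ((Finset.range n).filter fun j => extend x j ≠ 0).card ≤ nnz x := by
  rw [nnz, Set.ncard_eq_toFinset_card', ← Finset.card_image_of_injective _ Fin.val_injective]
  refine Finset.card_le_card fun j hj => ?_
  obtain ⟨hjn, hne⟩ := Finset.mem_filter.1 hj
  rw [Finset.mem_range] at hjn
  refine Finset.mem_image.2 ⟨⟨j, hjn⟩, ?_, rfl⟩
  have := extend_val x ⟨j, hjn⟩
  simp only at this
  simpa [this] using hne

theorem mat_mulVec_eq_measure {q w l m n : ℕ} (x : Fin n → R) (i : Fin m) :
    (mat R q w l m n).mulVec x i = measure q w l n (extend x) i := by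
  rw [mat_mulVec, measure, Finset.sum_range]
  refine Finset.sum_congr rfl fun j _ => ?_
  rw [extend_val]

theorem measure_sub (q w l n : ℕ) (x y : ℕ → R) (i : ℕ) :
    measure q w l n (fun j => x j - y j) i = measure q w l n x i - measure q w l n y i := by
  classical
  rw [measure, measure, measure, ← Finset.sum_sub_distrib]
  refine Finset.sum_congr rfl fun j _ => ?_
  split_ifs <;> simp

/-- The residual `A` is the measurement of the error `x - y`. The error is supported on the support
of `x` and the touched coordinates, which is few enough for expansion to apply. -/
theorem eq_of_recovered {a n t w h q l : ℕ} (hp : Params a n t w h q l) (hw : 7 ≤ w)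
    {x : Fin n → R} (hx : nnz x ≤ t) {z y A : ℕ → R}
    (hz : ∀ i < q ^ (l + 1) * w * 2, z i = measure q w l n (extend x) i)
    (hA : ∀ i, A i + measure q w l n y i = z i)
    {T : Finset ℕ} (hT : T.card ≤ busyCount w (q ^ (l + 1)) z) (hyT : ∀ j, y j ≠ 0 → j ∈ T)
    (hvotes : ∀ j < n, ∀ v : R, v ≠ 0 → 2 * voteCount q w l A j v ≤ q) :
    (fun j : Fin n => y j) = x := by
  classical
  have hrow : ∀ r < q ^ (l + 1), ∀ b < w, ∀ c < 2, (r * w + b) * 2 + c < q ^ (l + 1) * w * 2 := by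
    intro r hr b hb c hc
    have : (r + 1) * w ≤ q ^ (l + 1) * w := Nat.mul_le_mul_right _ hr
    rw [add_mul, one_mul] at this
    omega
  have hbusy := busyCount_le (q := q) (w := w) (l := l) (n := n) (M := q ^ (l + 1)) (x := extend x)
    (z := z) fun r hr b hb c hc => hz _ (hrow r hr b hb c hc)
  have hh1 : 1 ≤ h := by rw [hp.hh]; exact Nat.one_le_pow _ _ (by positivity)
  have hu := eq_zero_of_votes (u := fun j => extend x j - y j) (A := A) (h := h) hp.prime
    (by omega) hh1 ?_ hp.bounds.2.le (fun r hr b hb c hc => ?_) ?_ hvotes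
  · funext j
    have := hu j j.2
    rw [extend_val] at this
    exact (sub_eq_zero.1 this).symm
  -- The prime exceeds `2 * h * w * w`, and `l + 1 ≤ w`.
  · have : (l + 1) * h * w ≤ w * h * w := by gcongr; exact hp.hl
    have h2 := hp.lt
    have : 2 * h * w * w = 2 * (w * h * w) := by ring
    omega
  · rw [measure_sub, ← hz _ (hrow r hr b hb c hc), ← hA]
    abel
  · refine lt_of_le_of_lt ?_ hp.ht
    have hcard : ((Finset.range n).filter fun j => extend x j ≠ 0).card ≤ t := by
      refine le_trans (le_of_eq ?_) ((card_extend_le x).trans hx)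
      congr
    have hT' : T.card ≤ t * q := by
      refine hT.trans (hbusy.trans (Nat.mul_le_mul_right _ ?_))
      refine le_trans (le_of_eq ?_) hcard
      congr
    have hsub : ((Finset.range n).filter fun j => extend x j - y j ≠ 0) ⊆
        ((Finset.range n).filter fun j => extend x j ≠ 0) ∪ T := by
      intro j hj
      obtain ⟨hjn, hne⟩ := Finset.mem_filter.1 hj
      rw [Finset.mem_union]
      by_cases hy : y j = 0
      · exact Or.inl (Finset.mem_filter.2 ⟨hjn, by simpa [hy] using hne⟩)
      · exact Or.inr (hyT j hy)
    have h3 := (Finset.card_le_card hsub).trans (Finset.card_union_le _ _)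
    -- At most `t` entries of the signal and `t * q` touched coordinates; this is why `t * q * (q +
    -- 1)` appears in the choice of `l`.
    calc _ ≤ (t + t * q) * q := by
          refine Nat.mul_le_mul_right _ (le_trans (le_of_eq ?_) (h3.trans (add_le_add hcard hT')))
          congr
      _ = t * q * (q + 1) := by ring

/-! ### The cost of the algorithms -/

theorem weight_le (a : ℕ) {w : ℕ} (hw : 7 ≤ w) (k : ℕ) :
    k * (wordLength a w + 1) ≤ w ^ ((30 * a + 31) * k + 2) := by
  have h1 : (30 * a + 31) * k ≤ w ^ ((30 * a + 31) * k) :=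
    (Nat.lt_pow_self (show 1 < w by omega)).le
  calc k * (wordLength a w + 1) ≤ k * (10 * ((3 * a + 3) * w ^ 2) + w ^ 2) := by
        rw [wordLength]; gcongr; exact Nat.one_le_pow _ _ (by omega)
    _ = (30 * a + 31) * k * w ^ 2 := by ring
    _ ≤ w ^ ((30 * a + 31) * k) * w ^ 2 := by gcongr
    _ = _ := by rw [pow_add]

theorem measure_spec {a n t : ℕ} (ha : 1 ≤ a) (ht : 1 ≤ t) (htn : t ≤ n) :
    ∃ (σ : State R) (k : Cost) (h q l : ℕ), Exec (measureProg a) (initial R n t) σ k ∧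
      k.time ≤ n * ((n.size + 6) ^ (3 * a + 3)) ^ 6 *
        ((measureProg a).weight * (wordLength a (n.size + 6) + 1)) ∧
      Bounded (wordLength a (n.size + 6)) σ ∧ Params a n t (n.size + 6) h q l ∧
      Table n q (n.size + 6) l σ ∧ (∀ i, σ.ring 4 i = 0) ∧ ∀ i, σ.ring 21 i = 0 := by
  have hw7 : 7 ≤ n.size + 6 := by have := Nat.size_pos.2 (show 0 < n by omega); omega
  obtain ⟨z1, z2, -⟩ := le_wordLength_base (a := a) hw7
  have hn : n < 2 ^ wordLength a (n.size + 6) := by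
    rw [two_pow_wordLength]
    refine ((Nat.lt_size_self n).trans_le ?_).trans_le (Nat.le_self_pow (by omega) _)
    exact (Nat.pow_le_pow_right two_pos (by omega)).trans z2
  obtain ⟨σ, k, h1, h2, h3, h, q, l, h4, h5⟩ := runs_measureProg (R := R) ha ht htn
    (bounded_initial hn (htn.trans_lt hn))
  have hF := h1.frame
  exact ⟨σ, k, h, q, l, h1, h2, h3, h4, h5, fun i => by rw [hF.ring 4 rfl]; rfl,
    fun i => by rw [hF.ring 21 rfl]; rfl⟩

theorem _root_.RingRAM.Bounded.agreesOff {B a : ℕ} {s s' : State R} (hs : Bounded B s) (h : AgreesOff a s s')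
    (ha : a = 3 ∨ a = 5) : Bounded B s' := by
  intro b i h3 h5
  rw [(h b (by omega)).1]
  exact hs b i h3 h5

theorem recovery_steps {M q w V : ℕ} (hM : 1 ≤ M) (hq : q ≤ V) (hw : w ≤ V) (hV : 7 ≤ V) :
    M * (q + 1) * (q * (w * 10 + 12) + w * 5 + 40) + 20 ≤ M * V ^ 6 := by
  have hVi := fun i j (hi : i ≤ j) => Nat.pow_le_pow_right (show 0 < V by omega) hi
  have k1 := hVi 1 3 (by omega)
  have k2 := hVi 2 3 (by omega)
  have k0 := hVi 0 3 (by omega)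
  have h7 : 7 ^ 3 ≤ V ^ 3 := Nat.pow_le_pow_left hV 3
  calc _ ≤ M * (V + 1) * (V * (V * 10 + 12) + V * 5 + 40) + M * 20 := by gcongr; omega
    _ = M * (10 * V ^ 3 + 27 * V ^ 2 + 57 * V ^ 1 + 60 * V ^ 0) := by ring
    _ ≤ M * (V ^ 3 * V ^ 3) := Nat.mul_le_mul_left _ (le_trans (by omega)
        (Nat.mul_le_mul_right (V ^ 3) h7))
    _ = M * V ^ 6 := by ring

theorem recovery_spec {a n t h q l : ℕ} {σ s : State R} (hσ : Bounded (wordLength a (n.size + 6)) σ)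
    (hn : 1 ≤ n) (hp : Params a n t (n.size + 6) h q l) (hT : Table n q (n.size + 6) l σ)
    (h21 : ∀ i, σ.ring 21 i = 0) (hs : AgreesOff measurementArr σ s) :
    ∃ (s' : State R) (k : Cost), Exec recProg s s' k ∧
      k.time ≤ q ^ (l + 1) * ((n.size + 6) ^ (3 * a + 3)) ^ 6 *
        (recProg.weight * (wordLength a (n.size + 6) + 1)) ∧
      ∀ x : Fin n → R, nnz x ≤ t →
        (∀ i < q ^ (l + 1) * (n.size + 6) * 2,
          s.ring 3 i = measure q (n.size + 6) l n (extend x) i) → HoldsSparse s' 4 0 x := by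
  have hw7 : 7 ≤ n.size + 6 := by have := Nat.size_pos.2 hn; omega
  obtain ⟨hq, hnw⟩ := hp.bounds
  obtain ⟨b1, b2, b3, -⟩ := hp.rec_bound hw7
  have hV : n.size + 6 ≤ (n.size + 6) ^ (3 * a + 3) := Nat.le_self_pow (by omega) _
  obtain ⟨s', k, h1, h2, -, y, A, h3, h4, ⟨T, h5, h6⟩, h7⟩ := runs_recProg
    (hT.agreesOff hs (by decide)) (by omega) hnw.le
    (fun i => by rw [(hs 21 (by decide)).2]; exact h21 i) b1 b2 b3 (hσ.agreesOff hs (Or.inl rfl))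
  refine ⟨s', k, h1, h2.trans (Nat.mul_le_mul_right _ (recovery_steps
    (Nat.one_le_pow _ _ hp.prime.pos) hq hV (hw7.trans hV))), fun x hx hz => ?_⟩
  rw [← eq_of_recovered hp hw7 hx hz h4 h5 h6 h7]
  exact h3

theorem multiplication_steps {k q w V : ℕ} (hq : q ≤ V) (hw : w ≤ V) (hV : 7 ≤ V) :
    k * (q * w * 3 + 7) + 3 ≤ (k + 1) * V ^ 3 := by
  have h2 : q * w ≤ V ^ 2 := by rw [pow_two]; gcongr
  have h3 : 7 * V ^ 2 ≤ V ^ 3 := by rw [pow_succ' V 2]; gcongr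
  have h4 : 7 ^ 2 ≤ V ^ 2 := Nat.pow_le_pow_left hV 2
  calc k * (q * w * 3 + 7) + 3 ≤ k * V ^ 3 + V ^ 3 := by
        gcongr <;> omega
    _ = (k + 1) * V ^ 3 := by ring

/-- For an empty list the allowed number of additions is zero, which no time bound can yield. The
run is written down explicitly: the loop is never entered. -/
theorem mulProg_adds_eq_zero {s s' : State R} {k : Cost} (h : Exec mulProg s s' k)
    (hs : s.word 5 0 = 0) : k.adds = 0 := by
  have h' : Exec mulProg s _ _ := .seq (.setW s _ _ _) (.seq (.setW _ _ _ _) (.loopFalse (by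
    simp [Test.Holds, hs])))
  rw [(h.deterministic h').2]
  rfl

theorem multiplication_spec {a n t h q l m : ℕ} {σ s : State R}
    (hσ : Bounded (wordLength a (n.size + 6)) σ)
    (hn : 1 ≤ n) (hp : Params a n t (n.size + 6) h q l) (hT : Table n q (n.size + 6) l σ)
    (h4 : ∀ i, σ.ring 4 i = 0) {x : Fin n → R} (hs : MultiplicationInput σ x s) :
    ∃ (s' : State R) (k : Cost), Exec mulProg s s' k ∧
      HoldsDense s' outputArr ((mat R q (n.size + 6) l m n).mulVec x) ∧ k.others = 0 ∧
      k.time ≤ (nnz x + 1) * ((n.size + 6) ^ (3 * a + 3)) ^ 3 *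
        (mulProg.weight * (wordLength a (n.size + 6) + 1)) ∧ (nnz x = 0 → k.adds = 0) := by
  have hw7 : 7 ≤ n.size + 6 := by have := Nat.size_pos.2 hn; omega
  obtain ⟨hq, -⟩ := hp.bounds
  obtain ⟨-, -, -, b⟩ := hp.rec_bound hw7
  have hV : n.size + 6 ≤ (n.size + 6) ^ (3 * a + 3) := Nat.le_self_pow (by omega) _
  obtain ⟨s', k, h1, h2, -, h3⟩ := runs_mulProg (m := m) (hT.agreesOff hs.1 (by decide)) (by omega)
    hs.2 (fun i => by rw [(hs.1 4 (by decide)).2]; exact h4 i) b (hσ.agreesOff hs.1 (Or.inr rfl))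
  exact ⟨s', k, h1, h3, h1.others_eq_zero rfl, h2.trans (Nat.mul_le_mul_right _
    (multiplication_steps hq hV (hw7.trans hV))), fun h0 => mulProg_adds_eq_zero h1
    (hs.2.1.trans h0)⟩

end

end CompressedSensing

/-! ### Assembly of the main theorem. -/

namespace CompressedSensing

open RingRAM

theorem exists_cast_weight_le (a k d e : ℕ) {D n : ℕ} (hn : 1 ≤ n) (hD : (3 * a + 3) * d + e +
    ((30 * a + 31) * k + 2) ≤ D) :
    ((((n.size + 6) ^ (3 * a + 3)) ^ d * (n.size + 6) ^ e *
      (k * (wordLength a (n.size + 6) + 1)) : ℕ) : ℝ) ≤ polylog (8 ^ D) n := by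
  have hw7 : 7 ≤ n.size + 6 := by have := Nat.size_pos.2 hn; omega
  refine le_trans (Nat.cast_le.2 ?_) (pow_le_polylog hn D)
  calc _ ≤ ((n.size + 6) ^ (3 * a + 3)) ^ d * (n.size + 6) ^ e *
        (n.size + 6) ^ ((30 * a + 31) * k + 2) := Nat.mul_le_mul_left _ (weight_le a hw7 k)
    _ = (n.size + 6) ^ ((3 * a + 3) * d + e + ((30 * a + 31) * k + 2)) := by
        rw [← pow_mul, ← pow_add, ← pow_add]
    _ ≤ _ := Nat.pow_le_pow_right (by omega) hD

section

variable {R : Type*} [Ring R]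

/-- Over the zero ring a list of entries `1` does not represent a matrix sparsely, since these
entries are zero. Zero measurements and programs that do nothing suffice here. -/
theorem main_of_subsingleton [Subsingleton R] (α : ℝ) (hα : 0 < α) :
    ∃ (m : ℕ → ℕ → ℕ) (M Rec Mul : RingRAM.Prog) (c : ℕ),
      IsScheme R m M Rec ∧
      ∀ n t : ℕ, 1 ≤ t → t ≤ n →
        (m n t : ℝ) ≤ (t : ℝ) ^ (1 + α) * polylog c n ∧
        ∀ (H : Matrix (Fin (m n t)) (Fin n) R) (σ : State R) (k : Cost),
          Outputs M n t H σ k →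
          ((k.time : ℝ) ≤ n * polylog c n ∧ k.ringOps = 0) ∧
          (∀ (z : Fin (m n t) → R) (s : State R), RecoveryInput σ z s →
            ∃ (s' : State R) (k' : Cost), Exec Rec s s' k' ∧
              (k'.ringOps : ℝ) ≤ (t : ℝ) ^ (1 + α) * polylog c n ∧
              (k'.time : ℝ) ≤ (t : ℝ) ^ (1 + α) * polylog c n) ∧
          (∀ i j, H i j = 0 ∨ H i j = 1) ∧
          (∀ j, (nnz (fun i => H i j) : ℝ) ≤ polylog c n) ∧
          (∀ (x : Fin n → R) (s : State R), MultiplicationInput σ x s →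
            ∃ (s' : State R) (k' : Cost), Exec Mul s s' k' ∧
              HoldsDense s' outputArr (H.mulVec x) ∧
              (k'.adds : ℝ) ≤ nnz x * polylog c n ∧ k'.others = 0 ∧
              (k'.time : ℝ) ≤ (nnz x + 1) * polylog c n) := by
  have hnnz : ∀ {n : ℕ} (x : Fin n → R), nnz x = 0 := by
    intro n x
    simp [nnz, Subsingleton.elim _ (0 : R)]
  have hsparse : ∀ {n : ℕ} (x : Fin n → R) (s : State R) (a p : ℕ), s.word a p = 0 →
      HoldsSparse s a p x := fun x s a p h =>
    holdsSparse_of 0 id (by simp) (by simp) (fun i hi => absurd (Subsingleton.elim _ _) hi) h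
      (by simp) (by simp)
  refine ⟨fun _ _ => 0, .skip, .skip, .skip, 8 ^ 1, ⟨fun _ _ _ _ _ _ _ _ _ => le_rfl,
    fun n t ht htn => ⟨0, initial R n t, _, ⟨.skip _, fun j => hsparse _ _ _ _ ?_⟩,
      fun x hx s hs => ⟨s, _, .skip _, hsparse _ _ _ _ ?_⟩⟩⟩, fun n t ht htn => ?_⟩
  · simp [initial]
  · rw [(hs.1 outputArr (by decide)).1]; simp [initial]
  have hn : 1 ≤ n := ht.trans htn
  have hp : (1 : ℝ) ≤ polylog (8 ^ 1) n :=
    le_trans (by exact_mod_cast Nat.one_le_pow 1 (n.size + 6) (by omega)) (pow_le_polylog hn 1)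
  have ht1 : (1 : ℝ) ≤ (t : ℝ) ^ (1 + α) :=
    Real.one_le_rpow (by exact_mod_cast ht) (by linarith)
  have hn1 : (1 : ℝ) ≤ n := by exact_mod_cast hn
  refine ⟨by simp only [Nat.cast_zero]; nlinarith, fun H σ k hk => ?_⟩
  obtain ⟨rfl, rfl⟩ := hk.1.deterministic (.skip _)
  refine ⟨⟨?_, rfl⟩, fun z s hs => ⟨s, _, .skip _, ?_, ?_⟩, fun i => i.elim0,
    fun j => by rw [hnnz]; simp only [Nat.cast_zero]; linarith,
    fun x s hs => ⟨s, _, .skip _, fun i => i.elim0, ?_, rfl, ?_⟩⟩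
  · simp only [Cost.time_ofTime, Nat.cast_one]; nlinarith
  · simp only [Cost.ringOps, Cost.adds_ofTime, Cost.others_ofTime, add_zero, Nat.cast_zero]
    nlinarith
  · simp only [Cost.time_ofTime, Nat.cast_one]; nlinarith
  · simp [hnnz, Cost.ofTime]
  · simpa [hnnz] using hp

theorem main_of_nontrivial [Nontrivial R] (α : ℝ) (hα : 0 < α) :
    ∃ (m : ℕ → ℕ → ℕ) (M Rec Mul : RingRAM.Prog) (c : ℕ),
      IsScheme R m M Rec ∧
      ∀ n t : ℕ, 1 ≤ t → t ≤ n →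
        (m n t : ℝ) ≤ (t : ℝ) ^ (1 + α) * polylog c n ∧
        ∀ (H : Matrix (Fin (m n t)) (Fin n) R) (σ : State R) (k : Cost),
          Outputs M n t H σ k →
          ((k.time : ℝ) ≤ n * polylog c n ∧ k.ringOps = 0) ∧
          (∀ (z : Fin (m n t) → R) (s : State R), RecoveryInput σ z s →
            ∃ (s' : State R) (k' : Cost), Exec Rec s s' k' ∧
              (k'.ringOps : ℝ) ≤ (t : ℝ) ^ (1 + α) * polylog c n ∧
              (k'.time : ℝ) ≤ (t : ℝ) ^ (1 + α) * polylog c n) ∧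
          (∀ i j, H i j = 0 ∨ H i j = 1) ∧
          (∀ j, (nnz (fun i => H i j) : ℝ) ≤ polylog c n) ∧
          (∀ (x : Fin n → R) (s : State R), MultiplicationInput σ x s →
            ∃ (s' : State R) (k' : Cost), Exec Mul s s' k' ∧
              HoldsDense s' outputArr (H.mulVec x) ∧
              (k'.adds : ℝ) ≤ nnz x * polylog c n ∧ k'.others = 0 ∧
              (k'.time : ℝ) ≤ (nnz x + 1) * polylog c n) := by
  obtain ⟨a, haα⟩ := exists_nat_ge (1 / α)
  have ha : 1 ≤ a := by
    have : (0 : ℝ) < a := (by positivity : 0 < 1 / α).trans_le haα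
    exact_mod_cast this
  have hαa : 1 ≤ α * a := by rwa [div_le_iff₀' hα] at haα
  -- `13 = 7 + 6`: seven powers of `w ^ (3 * a + 3)` from `Params.card_le` and six from
  -- `recovery_steps`, the most expensive case. The additional square of `w` absorbs small factors,
  -- and the rest covers program weight times word length.
  obtain ⟨D, hD⟩ : ∃ D, D = (3 * a + 3) * 13 + 2 + ((30 * a + 31) *
    ((measureProg a).weight + recProg.weight + mulProg.weight + 1) + 2) := ⟨_, rfl⟩
  have hcost : ∀ {k d n : ℕ}, 1 ≤ n → d ≤ 13 →
      k ≤ (measureProg a).weight + recProg.weight + mulProg.weight + 1 →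
      ((((n.size + 6) ^ (3 * a + 3)) ^ d * (n.size + 6) ^ 2 *
        (k * (wordLength a (n.size + 6) + 1)) : ℕ) : ℝ) ≤ polylog (8 ^ D) n := by
    intro k d n hn hd hk
    refine exists_cast_weight_le a k d 2 hn ?_
    rw [hD]
    gcongr
  have hrows : ∀ {n t h q l : ℕ}, 1 ≤ t → 1 ≤ n → Params a n t (n.size + 6) h q l →
      q ^ (l + 1) * (n.size + 6) * 2 ≤ ⌊(t : ℝ) ^ (1 + α) * polylog (8 ^ D) n⌋₊ := by
    intro n t h q l ht hn hp
    have hw7 : 7 ≤ n.size + 6 := by have := Nat.size_pos.2 hn; omega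
    refine Nat.le_floor ?_
    have h1 := hp.card_le ha hw7 ht hαa
    have h2 := hcost (k := 1) (d := 7) hn (by omega) (by omega)
    calc ((q ^ (l + 1) * (n.size + 6) * 2 : ℕ) : ℝ)
        = ((q ^ (l + 1) : ℕ) : ℝ) * (((n.size + 6) * 2 : ℕ) : ℝ) := by push_cast; ring
      _ ≤ (t : ℝ) ^ (1 + α) * (((n.size + 6) ^ (3 * a + 3)) ^ 7 : ℕ) *
          (((n.size + 6) ^ 2 * (1 * (wordLength a (n.size + 6) + 1)) : ℕ) : ℝ) := by
          have hB : 1 ≤ 1 * (wordLength a (n.size + 6) + 1) := by omega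
          have h3 : (n.size + 6) * 2 ≤ (n.size + 6) ^ 2 := by
            rw [pow_two]; exact Nat.mul_le_mul_left _ (by omega)
          exact mul_le_mul h1 (Nat.cast_le.2 (h3.trans (Nat.le_mul_of_pos_right _ hB)))
            (Nat.cast_nonneg _) (by positivity)
      _ = (t : ℝ) ^ (1 + α) * ((((n.size + 6) ^ (3 * a + 3)) ^ 7 * (n.size + 6) ^ 2 *
          (1 * (wordLength a (n.size + 6) + 1)) : ℕ) : ℝ) := by push_cast; ring
      _ ≤ _ := by gcongr
  refine ⟨fun n t => ⌊(t : ℝ) ^ (1 + α) * polylog (8 ^ D) n⌋₊, measureProg a, recProg, mulProg,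
    8 ^ D, ⟨fun n t n' t' ht htn ht' hn ht'' => ?_, fun n t ht htn => ?_⟩, fun n t ht htn => ?_⟩
  · refine Nat.floor_le_floor (mul_le_mul ?_ (polylog_mono hn) (polylog_nonneg _ _) (by positivity))
    exact Real.rpow_le_rpow (by positivity) (by exact_mod_cast ht'') (by linarith)
  · have hn : 1 ≤ n := ht.trans htn
    obtain ⟨σ, k, h, q, l, hE, -, hBd, hp, hT, -, h21⟩ := measure_spec (R := R) ha ht htn
    have hr := hrows ht hn hp
    refine ⟨mat R q (n.size + 6) l _ n, σ, k, ⟨hE, hT.holdsMatrix (by omega) hr⟩, ?_⟩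
    intro x hx s hs
    obtain ⟨s', k', h1, -, h2⟩ := recovery_spec hBd hn hp hT h21 hs.1
    refine ⟨s', k', h1, h2 x hx fun i hi => ?_⟩
    rw [hs.2 ⟨i, hi.trans_le hr⟩, mat_mulVec_eq_measure]
  have hn : 1 ≤ n := ht.trans htn
  refine ⟨Nat.floor_le (mul_nonneg (by positivity) (polylog_nonneg _ _)), ?_⟩
  intro H σ k hk
  obtain ⟨σ', k', h, q, l, hE, hk', hBd, hp, hT, h4, h21⟩ := measure_spec (R := R) ha ht htn
  -- The given run is the constructed one by determinism, and then the given matrix is `mat`,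
  -- because the memory determines it.
  obtain ⟨rfl, rfl⟩ := hk.1.deterministic hE
  have hr := hrows ht hn hp
  have hw7 : 7 ≤ n.size + 6 := by have := Nat.size_pos.2 hn; omega
  have hH := hT.holdsMatrix (R := R) (by omega) hr
  obtain rfl := hk.2.unique hH
  have hw1 : 1 ≤ (n.size + 6) ^ 2 := Nat.one_le_pow _ _ (by omega)
  obtain ⟨hqV, -⟩ := hp.bounds
  have hV7 : 7 ≤ (n.size + 6) ^ (3 * a + 3) := hw7.trans (Nat.le_self_pow (by omega) _)
  refine ⟨⟨?_, hE.ringOps_eq_zero rfl⟩, fun z s hs => ?_, fun i j => ?_, fun j => ?_,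
    fun x s hs => ?_⟩
  · refine le_trans ?_ (mul_le_mul_of_nonneg_left (hcost (k := (measureProg a).weight) (d := 6) hn
      (by omega) (by omega)) (by positivity))
    rw [← Nat.cast_mul]
    refine Nat.cast_le.2 (hk'.trans ?_)
    rw [mul_assoc]
    gcongr
    exact Nat.le_mul_of_pos_right _ hw1
  · obtain ⟨s', k', h1, h2, -⟩ := recovery_spec hBd hn hp hT h21 hs.1
    have htime : (k'.time : ℝ) ≤ (t : ℝ) ^ (1 + α) * polylog (8 ^ D) n := by
      refine le_trans ?_ (mul_le_mul_of_nonneg_left (hcost (k := recProg.weight) (d := 13) hn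
        (by omega) (by omega)) (by positivity))
      refine le_trans (Nat.cast_le.2 h2) ?_
      rw [mul_assoc, Nat.cast_mul]
      refine le_trans (mul_le_mul_of_nonneg_right (hp.card_le ha hw7 ht hαa) (Nat.cast_nonneg _)) ?_
      rw [mul_assoc, ← Nat.cast_mul]
      refine mul_le_mul_of_nonneg_left (Nat.cast_le.2 ?_) (by positivity)
      rw [← mul_assoc, ← pow_add]
      gcongr
      exact Nat.le_mul_of_pos_right _ hw1
    exact ⟨s', k', h1, (Nat.cast_le.2 h1.ringOps_le).trans htime, htime⟩
  · simp only [mat]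
    split_ifs <;> simp
  · rw [← (hH j).1, hT.ptr j j.2, hT.head j.2]
    refine le_trans (Nat.cast_le.2 ?_) (hcost (k := 1) (d := 1) hn (by omega) (by omega))
    calc q * (n.size + 6) ≤ ((n.size + 6) ^ (3 * a + 3)) ^ 1 * (n.size + 6) ^ 2 * 1 := by
          rw [pow_one, mul_one]; gcongr; exact Nat.le_self_pow (by omega) _
      _ ≤ _ := by gcongr; omega
  · obtain ⟨s', k', h1, h2, h3, h5, h6⟩ := multiplication_spec hBd hn hp hT h4 hs
    have hmul : ∀ A N S V W : ℕ, A ≤ N * S → A * V * W ≤ N * (V * S * W) := by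
      intro A N S V W hA
      calc A * V * W ≤ N * S * V * W := by gcongr
        _ = _ := by ring
    have hstep : ∀ N : ℕ, nnz x + 1 ≤ N * (n.size + 6) ^ 2 →
        (k'.time : ℝ) ≤ N * polylog (8 ^ D) n := by
      intro N hN
      refine le_trans ?_ (mul_le_mul_of_nonneg_left (hcost (k := mulProg.weight) (d := 3) hn
        (by omega) (by omega)) (by positivity))
      rw [← Nat.cast_mul]
      refine Nat.cast_le.2 (h5.trans ?_)
      exact hmul _ _ _ _ _ hN
    refine ⟨s', k', h1, h2, ?_, h3, ?_⟩
    -- For a nonzero vector, additions are bounded by time, and `nnz x + 1` is at most `nnz x` times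
    -- the spare square of `w`.
    · rcases Nat.eq_zero_or_pos (nnz x) with h0 | h0
      · simp [h6 h0, h0]
      · refine le_trans (Nat.cast_le.2 ?_) (hstep (nnz x) ?_)
        · exact le_trans (by simp [Cost.ringOps]) h1.ringOps_le
        · nlinarith
    · rw [← Nat.cast_add_one]
      exact hstep _ (Nat.le_mul_of_pos_right _ hw1)

end

end CompressedSensing

theorem mainTheorem6 (R : Type*) [Ring R] (α : ℝ) (hα : 0 < α) :
    ∃ (m : ℕ → ℕ → ℕ) (M Rec Mul : RingRAM.Prog) (c : ℕ),
      CompressedSensing.IsScheme R m M Rec ∧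
      ∀ n t : ℕ, 1 ≤ t → t ≤ n →
        -- the number of measurements
        (m n t : ℝ) ≤ (t : ℝ) ^ (1 + α) * CompressedSensing.polylog c n ∧
        ∀ (H : Matrix (Fin (m n t)) (Fin n) R) (σ : RingRAM.State R) (k : RingRAM.Cost),
          CompressedSensing.Outputs M n t H σ k →
          -- the running time of the measurement algorithm
          ((k.time : ℝ) ≤ n * CompressedSensing.polylog c n ∧ k.ringOps = 0) ∧
          -- the cost of recovery
          (∀ (z : Fin (m n t) → R) (s : RingRAM.State R),
            CompressedSensing.RecoveryInput σ z s →
            ∃ (s' : RingRAM.State R) (k' : RingRAM.Cost), RingRAM.Exec Rec s s' k' ∧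
              (k'.ringOps : ℝ) ≤ (t : ℝ) ^ (1 + α) * CompressedSensing.polylog c n ∧
              (k'.time : ℝ) ≤ (t : ℝ) ^ (1 + α) * CompressedSensing.polylog c n) ∧
          -- the matrix is binary and column-sparse
          (∀ i j, H i j = 0 ∨ H i j = 1) ∧
          (∀ j, (CompressedSensing.nnz (fun i => H i j) : ℝ) ≤ CompressedSensing.polylog c n) ∧
          -- multiplication by a vector, with additions as the only ring operations
          (∀ (x : Fin n → R) (s : RingRAM.State R),
            CompressedSensing.MultiplicationInput σ x s →
            ∃ (s' : RingRAM.State R) (k' : RingRAM.Cost), RingRAM.Exec Mul s s' k' ∧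
              CompressedSensing.HoldsDense s' CompressedSensing.outputArr (H.mulVec x) ∧
              (k'.adds : ℝ) ≤ CompressedSensing.nnz x * CompressedSensing.polylog c n ∧
              k'.others = 0 ∧
              (k'.time : ℝ) ≤ (CompressedSensing.nnz x + 1) * CompressedSensing.polylog c n) := by
  rcases subsingleton_or_nontrivial R with _ | _
  · exact CompressedSensing.main_of_subsingleton α hα
  · exact CompressedSensing.main_of_nontrivial α hα
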